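/- Let $C=\{(x,y)\in\mathbb C^2 : (y^2-x)(y+x+1)=0\}$, let $K(x)=\{y : (x,y)\in C\}$, and let $N=\{x\in\mathbb C : \#K(x)<3\}=\{0,x_{p_1},x_{p_2}\}$, where $x_{p_1}=-\frac12+\frac{\sqrt3}{2}i$ and $x_{p_2}=-\frac12-\frac{\sqrt3}{2}i$ are the $x$-coordinates of the two intersection points $p_1,p_2$ of the conic and the line. Put $x_0=-\frac14$, $x_1=-\frac34$, $A=K(x_0)=\{\pm\frac i2,-\frac34\}$, $A'=K(x_1)=\{\pm\frac{\sqrt3}{2}i,-\frac14\}$. Let $D$ be a closed round disk in the $y$-line whose interior contains $A\cup A'$. For a finite set $K\subset\operatorname{Int}D$ let $B[D,K]$ be the braid group: the group of diffeomorphisms $f$ of $D$ with $f(K)=K$ and $f|_{\partial D}=\mathrm{id}$, modulo isotopy relative to $\partial D$ and $K$. For a smooth simple arc $\sigma\subset\operatorname{Int}D$ that joins two points of $K$ and contains no other point of $K$, let $H(\sigma)\in B[D,K]$ be the half-twist along $\sigma$: the class of a diffeomorphism that is the identity outside a small regular neighbourhood $U$ of $\sigma$ with $U\cap K=\sigma\cap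 K$ and exchanges the end points of $\sigma$ by a counterclockwise rotation by $180^\circ$ inside $U$. For a path $T:[0,1]\to\mathbb C\setminus N$ with $K(T(t))\subset\operatorname{Int}D$ for all $t$, a Lefschetz diffeomorphism $\psi_T:(D,K(T(0)))\to(D,K(T(1)))$ is $\psi_{(1)}$ for a continuous family of diffeomorphisms $\psi_{(t)}$ of $D$ with $\psi_{(0)}=\mathrm{id}$, $\psi_{(t)}|_{\partial D}=\mathrm{id}$ and $\psi_{(t)}(K(T(0)))=K(T(t))$. All paths below lie in $\mathbb C\setminus N$, have $K(\cdot)\subset\operatorname{Int}D$ along them, and are described up to homotopy in $\mathbb C\setminus N$ with fixed end points. * $l_1$ is a loop at $x_0$ that goes once counterclockwise around $x_{p_1}$ through the upper half-plane, i.e. it is homotopic to the boundary of the rectangle with successive vertices $x_0,\ x_0+2i,\ x_1+2i,\ x_1$. * $l_2$ is a loop at $x_0$ that goes once counterclockwise around $x_{p_2}$ through the lower half-plane, i.e. it is homotopic to the boundary of the rectangle with successive vertices $x_0,\ x_1,\ x_1-2i,\ x_0-2i$. * $l_3$ is a path from $x_1$ to $x_0$ that passes below $x_{p_2}$, i.e.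 it is homotopic to the polygonal path $x_1,\ x_1-2i,\ x_0-2i,\ x_0$. Let $\sigma_1,\sigma_2$ be the segments from $-\frac34$ to $\frac i2$ and to $-\frac i2$, respectively, and let $\sigma_1'$ be the segment from $-\frac14$ to $\frac{\sqrt3}{2}i$. Let $W$ be an open neighbourhood of the part of the real and imaginary axes in $D$, and let $\beta$ be a diffeomorphism of $D$ that is the identity on $\partial D$ and outside $W$, maps the real axis in $D$ onto itself and the imaginary axis in $D$ onto itself, and satisfies $\beta(-\frac34)=-\frac14$ and $\beta(\pm\frac i2)=\pm\frac{\sqrt3}{2}i$; such $\beta$ exist for every $W$. Then the classes of half-twists and of Lefschetz diffeomorphisms below exist and do not depend on the choices, and $$\psi_{l_1}=H(\sigma_2)^2,\qquad \psi_{l_2}=H(\sigma_1)^2\quad\text{in }B[D,A],\qquad \beta\circ\psi_{l_3}=H(\sigma_1')^2\quad\text{in }B[D,A'].$$ -/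

import Mathlib

open Set Metric Topology
open scoped unitInterval ContDiff Pointwise

noncomputable section

namespace PlaneBraid

/-! ### Diffeomorphisms of a closed disk and the braid group `B_n[D, K]`

The disk `D` is `closedBall c R` in the complex `y`-line. -/

/-- `f : D → D` is smooth up to the boundary of the closed disk `D`. -/
def SmoothOnDisk {c : ℂ} {R : ℝ} (f : closedBall c R → closedBall c R) : Prop :=
  ∃ F : ℂ → ℂ, ContDiffOn ℝ ∞ F (closedBall c R) ∧ ∀ y : closedBall c R, F y = f y

theorem SmoothOnDisk.comp {c : ℂ} {R : ℝ} {f g : closedBall c R → closedBall c R}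
    (hf : SmoothOnDisk f) (hg : SmoothOnDisk g) : SmoothOnDisk (f ∘ g) := by
  obtain ⟨F, hF, hFf⟩ := hf
  obtain ⟨G, hG, hGg⟩ := hg
  refine ⟨F ∘ G, hF.comp hG ?_, fun y => ?_⟩
  · intro y hy
    rw [hGg ⟨y, hy⟩]
    exact (g ⟨y, hy⟩).2
  · simp only [Function.comp_apply]
    rw [hGg y, hFf (g y)]

theorem smoothOnDisk_id {c : ℂ} {R : ℝ} :
    SmoothOnDisk (id : closedBall c R → closedBall c R) :=
  ⟨id, contDiffOn_id, fun _ => rfl⟩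

/-- The diffeomorphisms of `D` that are the identity on `∂D`. -/
def diskDiffeo (c : ℂ) (R : ℝ) : Subgroup (closedBall c R ≃ₜ closedBall c R) where
  carrier := {f | SmoothOnDisk f ∧ SmoothOnDisk f.symm ∧
    ∀ y : closedBall c R, (y : ℂ) ∈ sphere c R → f y = y}
  mul_mem' := by
    rintro f g ⟨hf, hf', hfb⟩ ⟨hg, hg', hgb⟩
    refine ⟨hf.comp hg, hg'.comp hf', fun y hy => ?_⟩
    change f (g y) = y
    rw [hgb y hy, hfb y hy]
  one_mem' := ⟨smoothOnDisk_id, smoothOnDisk_id, fun _ _ => rfl⟩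
  inv_mem' := by
    rintro f ⟨hf, hf', hfb⟩
    refine ⟨hf', hf, fun y hy => ?_⟩
    change f.symm y = y
    rw [Homeomorph.symm_apply_eq, hfb y hy]

/-- The diffeomorphisms `f` of `D` with `f(K) = K` and `f = id` on `∂D`. -/
def braidDiffeo (c : ℂ) (R : ℝ) (K : Set ℂ) :
    Subgroup (closedBall c R ≃ₜ closedBall c R) where
  carrier := {f | f ∈ diskDiffeo c R ∧ ∀ y : closedBall c R, (f y : ℂ) ∈ K ↔ (y : ℂ) ∈ K}
  mul_mem' := by
    rintro f g ⟨hf, hfK⟩ ⟨hg, hgK⟩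
    exact ⟨mul_mem hf hg, fun y => (hfK (g y)).trans (hgK y)⟩
  one_mem' := ⟨one_mem _, fun _ => Iff.rfl⟩
  inv_mem' := by
    rintro f ⟨hf, hfK⟩
    refine ⟨inv_mem hf, fun y => ?_⟩
    have h := hfK (f.symm y)
    rw [f.apply_symm_apply] at h
    exact h.symm

/-- A family `t ↦ H t`, `t ∈ [0, 1]`, of self-homeomorphisms of `D` is an isotopy relative to
`∂D` and `K`: it is jointly continuous, every `H t` is the identity on `∂D`, and maps `K` onto
itself. -/
structure IsIsotopyRel {c : ℂ} {R : ℝ} (K : Set ℂ)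
    (H : I → (closedBall c R ≃ₜ closedBall c R)) : Prop where
  continuous : Continuous fun p : I × closedBall c R => H p.1 p.2
  boundary : ∀ (t : I) (y : closedBall c R), (y : ℂ) ∈ sphere c R → H t y = y
  marked : ∀ (t : I) (y : closedBall c R), (H t y : ℂ) ∈ K ↔ (y : ℂ) ∈ K

theorem continuous_family_symm {X : Type*} [TopologicalSpace X] [CompactSpace X] [T2Space X]
    (H : I → (X ≃ₜ X)) (hH : Continuous fun p : I × X => H p.1 p.2) :
    Continuous fun p : I × X => (H p.1).symm p.2 := by
  let e : I × X ≃ I × X :=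
    { toFun := fun p => (p.1, H p.1 p.2)
      invFun := fun p => (p.1, (H p.1).symm p.2)
      left_inv := fun p => by simp
      right_inv := fun p => by simp }
  have he : Continuous e := continuous_fst.prodMk hH
  exact continuous_snd.comp he.continuous_symm_of_equiv_compact_to_t2

/-- The elements of `braidDiffeo c R K` that are isotopic to the identity relative to `∂D`
and `K`. -/
def isotopicToId (c : ℂ) (R : ℝ) (K : Set ℂ) : Subgroup (braidDiffeo c R K) where
  carrier := {f | ∃ H : I → (closedBall c R ≃ₜ closedBall c R),
    IsIsotopyRel K H ∧ H 0 = 1 ∧ H 1 = f}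
  mul_mem' := by
    rintro f g ⟨H, hH, hH0, hH1⟩ ⟨G, hG, hG0, hG1⟩
    refine ⟨fun t => H t * G t, ⟨?_, ?_, ?_⟩, by simp [hH0, hG0], by simp [hH1, hG1]⟩
    · exact hH.continuous.comp (continuous_fst.prodMk hG.continuous)
    · intro t y hy
      change H t (G t y) = y
      rw [hG.boundary t y hy, hH.boundary t y hy]
    · intro t y
      exact (hH.marked t (G t y)).trans (hG.marked t y)
  one_mem' := ⟨fun _ => 1, ⟨continuous_snd, fun _ _ _ => rfl, fun _ _ => Iff.rfl⟩, rfl, rfl⟩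
  inv_mem' := by
    rintro f ⟨H, hH, hH0, hH1⟩
    refine ⟨fun t => (H t)⁻¹, ⟨?_, ?_, ?_⟩, by simp [hH0], by simp [hH1]⟩
    · exact continuous_family_symm H hH.continuous
    · intro t y hy
      change (H t).symm y = y
      rw [Homeomorph.symm_apply_eq, hH.boundary t y hy]
    · intro t y
      have h := hH.marked t ((H t).symm y)
      rw [(H t).apply_symm_apply] at h
      exact h.symm

instance (c : ℂ) (R : ℝ) (K : Set ℂ) : (isotopicToId c R K).Normal where
  conj_mem := by
    rintro f ⟨H, hH, hH0, hH1⟩ g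
    refine ⟨fun t => (g : closedBall c R ≃ₜ closedBall c R) * H t *
      (g : closedBall c R ≃ₜ closedBall c R)⁻¹, ⟨?_, ?_, ?_⟩, by simp [hH0], by simp [hH1]⟩
    · exact g.1.continuous.comp (hH.continuous.comp
        (continuous_fst.prodMk (g.1.symm.continuous.comp continuous_snd)))
    · intro t y hy
      change g.1 (H t (g.1.symm y)) = y
      have h1 : g.1.symm y = y := (inv_mem g.2.1).2.2 y hy
      rw [h1, hH.boundary t y hy]
      exact g.2.1.2.2 y hy
    · intro t y
      refine (g.2.2 (H t (g.1.symm y))).trans ((hH.marked t (g.1.symm y)).trans ?_)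
      exact (inv_mem g.2).2 y

/-- The braid group `B_n[D, K]`, `n = #K`: diffeomorphisms `f` of `D` with `f(K) = K` and
`f = id` on `∂D`, up to isotopy relative to `∂D` and `K`. -/
abbrev Braid (c : ℂ) (R : ℝ) (K : Set ℂ) : Type :=
  braidDiffeo c R K ⧸ isotopicToId c R K

/-- The braid represented by a diffeomorphism. -/
abbrev toBraid {c : ℂ} {R : ℝ} {K : Set ℂ} (f : braidDiffeo c R K) : Braid c R K :=
  QuotientGroup.mk f

/-! ### Half-twists -/

/-- The model half-twist of the plane: the counterclockwise rotation by `180` degrees on the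
closed unit disk, damped to the identity outside the disk of radius `√2`. -/
def modelHalfTwist (z : ℂ) : ℂ :=
  Complex.exp (Real.pi * Real.smoothTransition (2 - ‖z‖ ^ 2) * Complex.I) * z

/-- `h` is a half-twist along `arc`, an arc joining two points of `K`. Here `φ` is an orientation
preserving smooth embedding of the disk of radius `2` onto a regular neighbourhood `U` of `arc` in
the interior of `D`; it takes the segment `[-1, 1]` to `arc`, and `U` contains no point of `K` but
the two end points of `arc`. The map `h` is the model half-twist on `U` and the identity on
`D \ U`. -/
def IsHalfTwist {c : ℂ} {R : ℝ} (K arc : Set ℂ)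
    (h : closedBall c R ≃ₜ closedBall c R) : Prop :=
  ∃ φ : ℂ → ℂ,
    ContDiffOn ℝ ∞ φ (ball 0 2) ∧ InjOn φ (ball 0 2) ∧
    (∀ z ∈ ball (0 : ℂ) 2, 0 < (fderiv ℝ φ z).det) ∧
    φ '' ball 0 2 ⊆ ball c R ∧
    φ '' segment ℝ (-1) 1 = arc ∧
    φ '' ball 0 2 ∩ K = {φ (-1), φ 1} ∧
    (∀ y : closedBall c R, ∀ z ∈ ball (0 : ℂ) 2, (y : ℂ) = φ z →
      (h y : ℂ) = φ (modelHalfTwist z)) ∧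
    (∀ y : closedBall c R, (y : ℂ) ∉ φ '' ball 0 2 → h y = y)

/-- The braid `b` is represented by a half-twist along `arc`. -/
def IsHalfTwistBraid {c : ℂ} {R : ℝ} {K : Set ℂ} (arc : Set ℂ) (b : Braid c R K) : Prop :=
  ∃ f : braidDiffeo c R K, IsHalfTwist K arc (f : closedBall c R ≃ₜ closedBall c R) ∧ toBraid f = b

/-! ### Lefschetz diffeomorphisms of a plane curve over the `x`-line -/

/-- The fibre `K(x)` over `x` of the projection `(x, y) ↦ x` of the curve `S`. -/
def fibre (S : Set (ℂ × ℂ)) (x : ℂ) : Set ℂ := {y | (x, y) ∈ S}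

/-- The points of the `x`-line over which the curve `S`, of degree `m` over the `x`-line, has
fewer than `m` points. -/
def branchSet (S : Set (ℂ × ℂ)) (m : ℕ) : Set ℂ := {x | (fibre S x).encard < m}

/-- `ψ` is a Lefschetz diffeomorphism of `D` induced by the path `T`: the end of a continuous
family of diffeomorphisms `Ψ t` of `D` with `Ψ 0 = id`, with `Ψ t = id` on `∂D`, and with
`Ψ t (K(T 0)) = K(T t)`. -/
def IsLefschetzDiffeo {c : ℂ} {R : ℝ} (S : Set (ℂ × ℂ)) {a b : ℂ} (T : Path a b)
    (ψ : closedBall c R ≃ₜ closedBall c R) : Prop :=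
  ∃ Ψ : I → (closedBall c R ≃ₜ closedBall c R),
    (Continuous fun p : I × closedBall c R => Ψ p.1 p.2) ∧
    Ψ 0 = 1 ∧ Ψ 1 = ψ ∧
    (∀ t, Ψ t ∈ diskDiffeo c R) ∧
    (∀ t, (fun y => (Ψ t y : ℂ)) '' {y : closedBall c R | (y : ℂ) ∈ fibre S a} =
      fibre S (T t))

/-- The braid `b` is represented by a Lefschetz diffeomorphism induced by the loop `T`. -/
def IsLefschetzBraid {c : ℂ} {R : ℝ} (S : Set (ℂ × ℂ)) {a : ℂ} (T : Path a a)
    (b : Braid c R (fibre S a)) : Prop :=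
  ∃ f : braidDiffeo c R (fibre S a),
    IsLefschetzDiffeo S T (f : closedBall c R ≃ₜ closedBall c R) ∧ toBraid f = b

/-- Two paths with the same end points are homotopic, with fixed end points, in `ℂ \ N`. -/
def HomotopicOff (N : Set ℂ) {a b : ℂ} (T T' : Path a b) : Prop :=
  ∃ F : Path.Homotopy T T', ∀ p : I × I, F p ∉ N

/-! ### The curve `(y ^ 2 - x) (y + x + 1) = 0` -/

/-- The union of the conic `y ^ 2 = x` and the line `y = - x - 1`. -/
def conicLine : Set (ℂ × ℂ) := {p | (p.2 ^ 2 - p.1) * (p.2 + p.1 + 1) = 0}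

/-- The base point `x₀ = -1/4`. -/
def xZero : ℂ := -1 / 4

/-- The base point `x₁ = -3/4`. -/
def xOne : ℂ := -3 / 4

/-- The boundary, counterclockwise from `x₀`, of the rectangle with vertices `x₀`, `x₀ + 2i`,
`x₁ + 2i`, `x₁`. This rectangle lies in the closed upper half-plane; its only point in the branch
set `{0, -1/2 + (√3/2) i, -1/2 - (√3/2) i}` is the interior point `-1/2 + (√3/2) i`. -/
def upperLoop : Path xZero xZero :=
  (((Path.segment xZero (xZero + 2 * Complex.I)).trans
    (Path.segment (xZero + 2 * Complex.I) (xOne + 2 * Complex.I))).trans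
      (Path.segment (xOne + 2 * Complex.I) xOne)).trans (Path.segment xOne xZero)

/-- The boundary, counterclockwise from `x₀`, of the rectangle with vertices `x₀`, `x₁`,
`x₁ - 2i`, `x₀ - 2i`. This rectangle lies in the closed lower half-plane; its only point in the
branch set is the interior point `-1/2 - (√3/2) i`. -/
def lowerLoop : Path xZero xZero :=
  (((Path.segment xZero xOne).trans (Path.segment xOne (xOne - 2 * Complex.I))).trans
    (Path.segment (xOne - 2 * Complex.I) (xZero - 2 * Complex.I))).trans
      (Path.segment (xZero - 2 * Complex.I) xZero)

/-- The polygonal path `x₁`, `x₁ - 2i`, `x₀ - 2i`, `x₀`, which goes from `x₁` to `x₀` and passes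
below `-1/2 - (√3/2) i`. -/
def lowerArc : Path xOne xZero :=
  ((Path.segment xOne (xOne - 2 * Complex.I)).trans
    (Path.segment (xOne - 2 * Complex.I) (xZero - 2 * Complex.I))).trans
      (Path.segment (xZero - 2 * Complex.I) xZero)

/-- `β` is a diffeomorphism of `D`, the identity on `∂D` and outside of the neighbourhood `W` of
the coordinate axes, that preserves the real and the imaginary axis and takes `-3/4`, `i/2`,
`-i/2` to `-1/4`, `(√3/2) i`, `-(√3/2) i`. -/
structure IsAxisShift {c : ℂ} {R : ℝ} (W : Set ℂ)
    (β : closedBall c R ≃ₜ closedBall c R) : Prop where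
  diffeo : β ∈ diskDiffeo c R
  line : ∀ y : closedBall c R, (y : ℂ) = -3 / 4 → (β y : ℂ) = -1 / 4
  upper : ∀ y : closedBall c R, (y : ℂ) = Complex.I / 2 → (β y : ℂ) = (√3 : ℝ) / 2 * Complex.I
  lower : ∀ y : closedBall c R, (y : ℂ) = -Complex.I / 2 →
    (β y : ℂ) = -((√3 : ℝ) / 2 * Complex.I)
  realAxis : ∀ y : closedBall c R, (β y : ℂ).im = 0 ↔ (y : ℂ).im = 0
  imagAxis : ∀ y : closedBall c R, (β y : ℂ).re = 0 ↔ (y : ℂ).re = 0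
  off : ∀ y : closedBall c R, (y : ℂ) ∉ W → β y = y

end PlaneBraid

end

open PlaneBraid

/-!
A braid in `B[D, K]` is determined by a motion of the points of `K`: if two diffeomorphisms are the
ends of isotopies of `D`, fixed on `∂D`, that move `K` in the same way, then they differ by an
isotopy relative to `K` (`toBraid_eq_of_carries`). Only the homotopy class of the motion in the
configuration space of the plane matters. Indeed, an isotopy can be corrected by short pushes when
the motion is changed a little (`Moves.exists_of_close`), hence it follows every homotopy of motions
in `D` (`Moves.exists_of_homotopy`), and a homotopy that leaves `D` can be squeezed back into `D`
(`Carries.of_confHomotopic`). So two diffeomorphisms that realize homotopic motions represent the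
same braid (`toBraid_eq_of_realizes`), and both sides of each identity are compared as motions of
three labelled points.

The square of the half-twist along the segment `[p, q]` realizes the full rotation `turn` of `p` and
`q` about their midpoint, with the third point at rest (`exists_halfTwistBraid`). The chart of the
half-twist is arbitrary: the motion of the two points in it is deformed to the rotation by
flattening the circle, on which they move, to a thin ellipse, and by deforming the chart to its derivative
through symmetric difference quotients (`confHomotopic_of_normalized`).

A Lefschetz diffeomorphism realizes the motion of the fibre `-x - 1`, `√x`, `-√x`, where a homotopy
of paths off the branch set lifts to a homotopy of fibres because `z ↦ z ^ 2` is a covering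
(`IsLefschetzDiffeo.carries`, `exists_fibre_lift`). Along each of the four sides of the rectangles,
the difference of the point on the line and one of the two roots stays in an open half-plane, and
from side to side this half-plane turns by a right angle; the second root stays on one side of the
other two points. Therefore the straight-line homotopy to the full rotation avoids collisions
(`confHomotopic_of_sameSide`, `matches_upperLoop`, `matches_lowerLoop`).

The path `lowerArc` makes up three quarters of such a rotation (`matches_lowerArc`). The last
quarter comes from `β`: by the Alexander trick centred at the origin, `β` is the end of an isotopy
that moves the three points within the half-axes (`IsAxisShift.realizes`), and the configurations
with prescribed half-axes form a convex set.
-/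

noncomputable section

namespace PlaneBraid

/-! ### Homeomorphisms of the plane supported in a disk -/

/-- A homeomorphism of the plane that is the identity off the open disk restricts to the closed
disk. -/
def restrictDisk {c : ℂ} {R : ℝ} (e : ℂ ≃ₜ ℂ) (he : ∀ y, y ∉ ball c R → e y = y) :
    closedBall c R ≃ₜ closedBall c R :=
  e.subtype (p := (· ∈ closedBall c R)) (q := (· ∈ closedBall c R)) fun y => by
    constructor
    · intro hy
      by_contra h
      have h1 : e (e y) = e y := he _ fun h' => h (ball_subset_closedBall h')
      rw [e.injective h1] at h
      exact h hy
    · intro hy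
      by_contra h
      rw [he y fun h' => h (ball_subset_closedBall h')] at hy
      exact h hy

theorem sphere_notMem_ball {c y : ℂ} {R : ℝ} (hy : y ∈ sphere c R) : y ∉ ball c R := by
  rw [mem_sphere] at hy
  rw [mem_ball, hy]
  exact lt_irrefl _

theorem restrictDisk_mem_diskDiffeo {c : ℂ} {R : ℝ} (e : ℂ ≃ₜ ℂ)
    (he : ∀ y, y ∉ ball c R → e y = y) (h : ContDiff ℝ ∞ e) (h' : ContDiff ℝ ∞ e.symm) :
    restrictDisk e he ∈ diskDiffeo c R := by
  refine ⟨⟨e, h.contDiffOn, fun y => rfl⟩, ⟨e.symm, h'.contDiffOn, fun y => rfl⟩, fun y hy => ?_⟩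
  exact Subtype.ext (he y (sphere_notMem_ball hy))

theorem continuous_restrictDisk {Z : Type*} [TopologicalSpace Z] {c : ℂ} {R : ℝ}
    (e : Z → ℂ ≃ₜ ℂ) (he : ∀ z y, y ∉ ball c R → e z y = y)
    (h : Continuous fun p : Z × ℂ => e p.1 p.2) :
    Continuous fun p : Z × closedBall c R => restrictDisk (e p.1) (he p.1) p.2 :=
  Continuous.subtype_mk (h.comp (continuous_fst.prodMk (continuous_subtype_val.comp
    continuous_snd))) _

/-- A map of the plane whose distance to the identity is `1/2`-Lipschitz is a homeomorphism. -/
def perturbation (u : ℂ → ℂ) (hu : LipschitzWith (1 / 2) u) : ℂ ≃ₜ ℂ :=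
  ApproximatesLinearOn.toHomeomorph (𝕜 := ℝ) (f' := ContinuousLinearEquiv.refl ℝ ℂ)
    (c := 1 / 2) (fun y => y + u y)
    (by
      intro x _ y _
      have := hu.dist_le_mul x y
      rw [dist_eq_norm, dist_eq_norm] at this
      change ‖x + u x - (y + u y) - (x - y)‖ ≤ _
      rw [show x + u x - (y + u y) - (x - y) = u x - u y by ring]
      exact this)
    (by
      right
      have h1 : (ContinuousLinearEquiv.refl ℝ ℂ).symm = ContinuousLinearEquiv.refl ℝ ℂ := rfl
      rw [h1, ContinuousLinearEquiv.coe_refl, ContinuousLinearMap.nnnorm_id, inv_one]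
      rw [← NNReal.coe_lt_coe]
      norm_num)

theorem perturbation_apply (u : ℂ → ℂ) (hu : LipschitzWith (1 / 2) u) (y : ℂ) :
    perturbation u hu y = y + u y := rfl

theorem contDiff_perturbation (u : ℂ → ℂ) (hu : LipschitzWith (1 / 2) u) (h : ContDiff ℝ ∞ u) :
    ContDiff ℝ ∞ (perturbation u hu) := contDiff_id.add h

theorem contDiff_perturbation_symm (u : ℂ → ℂ) (hu : LipschitzWith (1 / 2) u)
    (h : ContDiff ℝ ∞ u) : ContDiff ℝ ∞ (perturbation u hu).symm := by
  have hd : ∀ y, HasFDerivAt (perturbation u hu)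
      (ContinuousLinearMap.id ℝ ℂ + fderiv ℝ u y) y := fun y =>
    (hasFDerivAt_id y).add ((h.differentiable (by simp)) y).hasFDerivAt
  have hinj : ∀ y, Function.Injective (ContinuousLinearMap.id ℝ ℂ + fderiv ℝ u y).toLinearMap := by
    intro y
    rw [← LinearMap.ker_eq_bot, LinearMap.ker_eq_bot']
    intro w hw
    have h1 : w = - fderiv ℝ u y w := by
      have : w + fderiv ℝ u y w = 0 := hw
      exact eq_neg_of_add_eq_zero_left this
    have h2 : ‖fderiv ℝ u y w‖ ≤ 1 / 2 * ‖w‖ :=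
      (fderiv ℝ u y).le_of_opNorm_le (by simpa using norm_fderiv_le_of_lipschitz ℝ hu) w
    have h3 : ‖w‖ ≤ 1 / 2 * ‖w‖ := by
      nth_rewrite 1 [h1]
      rwa [norm_neg]
    exact norm_le_zero_iff.1 (by linarith)
  let A : ℂ → ℂ ≃L[ℝ] ℂ := fun y => (LinearEquiv.ofInjectiveEndo _ (hinj y)).toContinuousLinearEquiv
  refine (perturbation u hu).contDiff_symm (f₀' := A) (fun y => ?_) (contDiff_perturbation u hu h)
  exact (hd y).congr_fderiv (ContinuousLinearMap.ext fun w => rfl)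

/-! ### Pushing finitely many points along short vectors -/

/-- A smooth bump at the origin, equal to `1` there and to `0` off the unit disk. -/
def bump : ContDiffBump (0 : ℂ) := ⟨1 / 2, 1, by norm_num, by norm_num⟩

theorem bump_zero : bump 0 = 1 :=
  bump.one_of_mem_closedBall (mem_closedBall_self (by norm_num [bump]))

theorem bump_eq_zero {z : ℂ} (hz : 1 ≤ ‖z‖) : bump z = 0 :=
  bump.zero_of_le_dist (by simpa [bump] using hz)

theorem exists_lipschitzWith_bump : ∃ L : NNReal, LipschitzWith L bump :=
  (bump.contDiff (n := 1)).lipschitzWith_of_hasCompactSupport bump.hasCompactSupport (by simp)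

/-- A Lipschitz constant of `bump`. -/
def bumpLip : NNReal := exists_lipschitzWith_bump.choose

theorem lipschitzWith_bump : LipschitzWith bumpLip bump := exists_lipschitzWith_bump.choose_spec

section Push

variable {ι : Type*} [Fintype ι]

/-- The displacement that moves the points `P i` by the vectors `v i`, supported in the disks of
radius `δ` about the points `P i`. -/
def displacement (δ : ℝ) (P v : ι → ℂ) (y : ℂ) : ℂ :=
  ∑ i, bump (δ⁻¹ • (y - P i)) • v i

theorem displacement_eq_zero {δ : ℝ} (hδ : 0 < δ) {P v : ι → ℂ} {y : ℂ}
    (hy : ∀ i, δ ≤ dist y (P i)) : displacement δ P v y = 0 := by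
  refine Finset.sum_eq_zero fun i _ => ?_
  rw [bump_eq_zero, zero_smul]
  rw [norm_smul, norm_inv, Real.norm_of_nonneg hδ.le, ← dist_eq_norm, le_inv_mul_iff₀ hδ, mul_one]
  exact hy i

theorem displacement_self {δ : ℝ} (hδ : 0 < δ) {P v : ι → ℂ}
    (hP : ∀ i j, i ≠ j → δ ≤ dist (P i) (P j)) (i : ι) : displacement δ P v (P i) = v i := by
  unfold displacement
  rw [Finset.sum_eq_single i]
  · simp [bump_zero]
  · intro j _ hj
    rw [bump_eq_zero, zero_smul]
    rw [norm_smul, norm_inv, Real.norm_of_nonneg hδ.le, ← dist_eq_norm, le_inv_mul_iff₀ hδ,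
      mul_one]
    exact hP i j hj.symm
  · simp

theorem contDiff_displacement (δ : ℝ) (P v : ι → ℂ) : ContDiff ℝ ∞ (displacement δ P v) := by
  unfold displacement
  refine ContDiff.sum fun i _ => ContDiff.smul
    (bump.contDiff.comp (f := fun y => δ⁻¹ • (y - P i)) ?_) contDiff_const
  exact (contDiff_id.sub contDiff_const).const_smul δ⁻¹

theorem continuous_displacement (δ : ℝ) :
    Continuous fun p : (ι → ℂ) × (ι → ℂ) × ℂ => displacement δ p.1 p.2.1 p.2.2 := by
  unfold displacement
  refine continuous_finsetSum _ fun i _ => Continuous.smul (bump.continuous.comp ?_) ?_ <;>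
  fun_prop

theorem lipschitzWith_displacement {δ : ℝ} (hδ : 0 < δ) {P v : ι → ℂ}
    (hv : ∀ i, Fintype.card ι * bumpLip * ‖v i‖ ≤ δ / 2) :
    LipschitzWith (1 / 2) (displacement δ P v) := by
  refine LipschitzWith.of_dist_le_mul fun y y' => ?_
  rw [dist_eq_norm]
  unfold displacement
  rw [← Finset.sum_sub_distrib]
  rcases isEmpty_or_nonempty ι with hι | hι
  · simp
  have hc : (0 : ℝ) < Fintype.card ι := by exact_mod_cast Fintype.card_pos
  have key : ∀ i, ‖bump (δ⁻¹ • (y - P i)) • v i - bump (δ⁻¹ • (y' - P i)) • v i‖ ≤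
      (1 / 2 * dist y y') / Fintype.card ι := by
    intro i
    rw [← sub_smul, norm_smul, ← dist_eq_norm]
    have h1 := lipschitzWith_bump.dist_le_mul (δ⁻¹ • (y - P i)) (δ⁻¹ • (y' - P i))
    have h2 : dist (δ⁻¹ • (y - P i)) (δ⁻¹ • (y' - P i)) = δ⁻¹ * dist y y' := by
      rw [dist_smul₀, dist_sub_right, norm_inv, Real.norm_of_nonneg hδ.le]
    rw [h2] at h1
    rw [le_div_iff₀ hc]
    calc _ ≤ bumpLip * (δ⁻¹ * dist y y') * ‖v i‖ * Fintype.card ι := by gcongr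
      _ = (Fintype.card ι * bumpLip * ‖v i‖) * (δ⁻¹ * dist y y') := by ring
      _ ≤ δ / 2 * (δ⁻¹ * dist y y') := by
        gcongr
        exact hv i
      _ = 1 / 2 * dist y y' := by field_simp
  calc _ ≤ ∑ i, ‖bump (δ⁻¹ • (y - P i)) • v i - bump (δ⁻¹ • (y' - P i)) • v i‖ := norm_sum_le _ _
    _ ≤ ∑ _i : ι, (1 / 2 * dist y y') / Fintype.card ι := Finset.sum_le_sum fun i _ => key i
    _ = 1 / 2 * dist y y' := by
      rw [Finset.sum_const, Finset.card_univ, nsmul_eq_mul]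
      field_simp
    _ = _ := by norm_num

end Push

/-! ### Families of homeomorphisms that carry a moving configuration -/

section Carries

variable {ι : Type*} {c : ℂ} {R : ℝ}

/-- The homeomorphisms of the disk that are the identity on the boundary circle. -/
def boundaryFix (c : ℂ) (R : ℝ) : Subgroup (closedBall c R ≃ₜ closedBall c R) where
  carrier := {f | ∀ y : closedBall c R, (y : ℂ) ∈ sphere c R → f y = y}
  mul_mem' := by
    intro f g hf hg y hy
    change f (g y) = y
    rw [hg y hy, hf y hy]
  one_mem' := fun _ _ => rfl
  inv_mem' := by
    intro f hf y hy
    change f.symm y = y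
    rw [Homeomorph.symm_apply_eq, hf y hy]

theorem diskDiffeo_le_boundaryFix : diskDiffeo c R ≤ boundaryFix c R := fun _ hf => hf.2.2

/-- `Ψ` is a continuous family of homeomorphisms of the disk, all in the subgroup `S`, that starts
at the identity and moves the points `γ 0 i` along the paths `t ↦ γ t i`. -/
structure Moves (S : Subgroup (closedBall c R ≃ₜ closedBall c R)) (γ : I → ι → ℂ)
    (Ψ : I → (closedBall c R ≃ₜ closedBall c R)) : Prop where
  continuous : Continuous fun p : I × closedBall c R => Ψ p.1 p.2
  zero : Ψ 0 = 1
  mem : ∀ t, Ψ t ∈ S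
  apply : ∀ t i (y : closedBall c R), (y : ℂ) = γ 0 i → (Ψ t y : ℂ) = γ t i

/-- `f` is the end of a family of homeomorphisms in `S` that starts at the identity and moves
points along `γ`. Under the identification of the braid group with the fundamental group of the
configuration space, `f` corresponds to `γ`. -/
def Carries (S : Subgroup (closedBall c R ≃ₜ closedBall c R)) (γ : I → ι → ℂ)
    (f : closedBall c R ≃ₜ closedBall c R) : Prop :=
  ∃ Ψ, Moves S γ Ψ ∧ Ψ 1 = f

theorem Carries.mono {S S' : Subgroup (closedBall c R ≃ₜ closedBall c R)} (hS : S ≤ S')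
    {γ : I → ι → ℂ} {f : closedBall c R ≃ₜ closedBall c R} (h : Carries S γ f) :
    Carries S' γ f := by
  obtain ⟨Ψ, hΨ, h1⟩ := h
  exact ⟨Ψ, ⟨hΨ.continuous, hΨ.zero, fun t => hS (hΨ.mem t), hΨ.apply⟩, h1⟩

/-- Two diffeomorphisms carried by the same motion of the marked points represent the same
braid: `t ↦ Φ_t⁻¹ ∘ Ψ_t` is an isotopy that fixes the marked points. -/
theorem toBraid_eq_of_carries {K : Set ℂ} {γ : I → ι → ℂ} (hK : K = range (γ 0))
    {f g : braidDiffeo c R K}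
    (hf : Carries (boundaryFix c R) γ (f : closedBall c R ≃ₜ closedBall c R))
    (hg : Carries (boundaryFix c R) γ (g : closedBall c R ≃ₜ closedBall c R)) :
    toBraid f = toBraid g := by
  obtain ⟨Ψ, hΨ, hΨ1⟩ := hf
  obtain ⟨Φ, hΦ, hΦ1⟩ := hg
  refine Eq.symm (QuotientGroup.eq.2 ?_)
  have hfix : ∀ (t : I) (k : closedBall c R), (k : ℂ) ∈ K → (Φ t).symm (Ψ t k) = k := by
    intro t k hk
    rw [hK] at hk
    obtain ⟨i, hi⟩ := hk
    rw [Homeomorph.symm_apply_eq]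
    exact Subtype.ext ((hΨ.apply t i k hi.symm).trans (hΦ.apply t i k hi.symm).symm)
  refine ⟨fun t => (Φ t)⁻¹ * Ψ t, ⟨?_, ?_, ?_⟩, ?_, ?_⟩
  · exact (continuous_family_symm Φ hΦ.continuous).comp (continuous_fst.prodMk hΨ.continuous)
  · intro t y hy
    exact (boundaryFix c R).mul_mem ((boundaryFix c R).inv_mem (hΦ.mem t)) (hΨ.mem t) y hy
  · intro t y
    constructor
    · intro h
      have h1 : (Φ t).symm (Ψ t ((Φ t).symm (Ψ t y))) = (Φ t).symm (Ψ t y) :=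
        hfix t ((Φ t).symm (Ψ t y)) h
      have h2 : (Φ t).symm (Ψ t y) = y := (Ψ t).injective ((Φ t).symm.injective h1)
      change (((Φ t).symm (Ψ t y) : closedBall c R) : ℂ) ∈ K at h
      rwa [h2] at h
    · intro h
      have h1 := hfix t y h
      change (((Φ t).symm (Ψ t y) : closedBall c R) : ℂ) ∈ K
      rwa [h1]
  · simp [hΨ.zero, hΦ.zero]
  · simp [hΨ1, hΦ1]

variable [Fintype ι]

/-- If `γ'` is close to `γ`, then a family that moves points along `γ` can be corrected by short
pushes to a family that moves points along `γ'`. -/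
theorem Moves.exists_of_close {S : Subgroup (closedBall c R ≃ₜ closedBall c R)}
    (hS : diskDiffeo c R ≤ S) {γ γ' : I → ι → ℂ} (hγ : Continuous γ) (hγ' : Continuous γ')
    {Ψ : I → (closedBall c R ≃ₜ closedBall c R)} (h : Moves S γ Ψ) (h0 : γ' 0 = γ 0)
    {δ : ℝ} (hδ : 0 < δ) (hsep : ∀ t i j, i ≠ j → δ ≤ dist (γ t i) (γ t j))
    (hball : ∀ t i, ball (γ t i) δ ⊆ ball c R)
    (hclose : ∀ t i, Fintype.card ι * bumpLip * ‖γ' t i - γ t i‖ ≤ δ / 2) :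
    ∃ Ψ', Moves S γ' Ψ' ∧ (γ' 1 = γ 1 → Ψ' 1 = Ψ 1) := by
  let u : I → ℂ → ℂ := fun t => displacement δ (γ t) (γ' t - γ t)
  have hu : ∀ t, LipschitzWith (1 / 2) (u t) := fun t => lipschitzWith_displacement hδ (hclose t)
  let e : I → ℂ ≃ₜ ℂ := fun t => perturbation (u t) (hu t)
  have he : ∀ t y, y ∉ ball c R → e t y = y := by
    intro t y hy
    change y + u t y = y
    rw [show u t y = 0 from displacement_eq_zero hδ fun i => ?_, add_zero]
    by_contra hlt
    exact hy (hball t i (not_le.1 hlt))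
  have hone : ∀ t, γ' t = γ t → restrictDisk (e t) (he t) = 1 := by
    intro t ht
    ext y
    change (y : ℂ) + displacement δ (γ t) (γ' t - γ t) y = y
    simp [ht, displacement]
  refine ⟨fun t => restrictDisk (e t) (he t) * Ψ t, ⟨?_, ?_, ?_, ?_⟩, ?_⟩
  · have hd : Continuous fun p : I × ℂ => displacement δ (γ p.1) (γ' p.1 - γ p.1) p.2 :=
      (continuous_displacement δ).comp
        (f := fun p : I × ℂ => (γ p.1, γ' p.1 - γ p.1, p.2)) (by fun_prop)
    have hc : Continuous fun p : I × ℂ => e p.1 p.2 := continuous_snd.add hd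
    exact (continuous_restrictDisk e he hc).comp (continuous_fst.prodMk h.continuous)
  · rw [hone 0 h0, h.zero, one_mul]
  · intro t
    refine S.mul_mem (hS (restrictDisk_mem_diskDiffeo _ _ ?_ ?_)) (h.mem t)
    · exact contDiff_perturbation _ _ (contDiff_displacement _ _ _)
    · exact contDiff_perturbation_symm _ _ (contDiff_displacement _ _ _)
  · intro t i y hy
    rw [h0] at hy
    change (Ψ t y : ℂ) + displacement δ (γ t) (γ' t - γ t) (Ψ t y) = γ' t i
    rw [h.apply t i y hy, displacement_self hδ (hsep t)]
    simp
  · intro h1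
    change restrictDisk (e 1) (he 1) * Ψ 1 = Ψ 1
    rw [hone 1 h1, one_mul]

theorem exists_pos_forall_le {Z : Type*} [TopologicalSpace Z] [CompactSpace Z] {f : Z → ℝ}
    (hf : Continuous f) (hpos : ∀ z, 0 < f z) : ∃ m, 0 < m ∧ ∀ z, m ≤ f z := by
  obtain ⟨m, hm, h⟩ := isCompact_univ.exists_forall_le' hf.continuousOn fun z _ => hpos z
  exact ⟨m, hm, fun z => h z (mem_univ z)⟩

/-- A set of parameters that is not empty and contains with a point every point at distance less
than `η` is everything. -/
theorem forall_of_uniform_step {p : I → Prop} {s₀ : I} (h0 : p s₀) {η : ℝ} (hη : 0 < η)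
    (hstep : ∀ s s', dist s s' < η → p s → p s') (s : I) : p s := by
  have hopen : ∀ q : I → Prop, (∀ s s', dist s s' < η → q s → q s') → IsOpen {s | q s} := by
    intro q hq
    refine Metric.isOpen_iff.2 fun s hs => ⟨η, hη, fun s' hs' => hq s s' ?_ hs⟩
    rw [dist_comm]
    exact hs'
  have hclopen : IsClopen {s | p s} := by
    refine ⟨⟨?_⟩, hopen p hstep⟩
    refine hopen (fun s => ¬ p s) fun s s' hd hs hs' => hs (hstep s' s ?_ hs')
    rwa [dist_comm]
  have := hclopen.eq_univ ⟨s₀, h0⟩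
  exact (this.symm.subset (mem_univ s) : s ∈ {s | p s})

/-- A margin for a compact family of configurations in the open disk. -/
theorem exists_margin {Z : Type*} [TopologicalSpace Z] [CompactSpace Z] {G : Z → ι → ℂ}
    (hG : Continuous G) (hinj : ∀ p, Function.Injective (G p)) (hball : ∀ p i, G p i ∈ ball c R) :
    ∃ δ, 0 < δ ∧ (∀ p i j, i ≠ j → δ ≤ dist (G p i) (G p j)) ∧
      ∀ p i, ball (G p i) δ ⊆ ball c R := by
  have h1 : ∀ᶠ δ in 𝓝[>] (0 : ℝ), ∀ i j, i ≠ j → ∀ p, δ ≤ dist (G p i) (G p j) := by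
    refine Filter.eventually_all.2 fun i => Filter.eventually_all.2 fun j => ?_
    by_cases hij : i = j
    · exact Filter.Eventually.of_forall fun _ h => absurd hij h
    obtain ⟨m, hm, h⟩ := exists_pos_forall_le (f := fun p => dist (G p i) (G p j))
      (((continuous_apply i).comp hG).dist ((continuous_apply j).comp hG))
      fun p => dist_pos.2 fun h => hij (hinj p h)
    filter_upwards [Ioc_mem_nhdsGT hm] with δ hδ _ p
    exact hδ.2.trans (h p)
  have h2 : ∀ᶠ δ in 𝓝[>] (0 : ℝ), ∀ i p, ball (G p i) δ ⊆ ball c R := by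
    refine Filter.eventually_all.2 fun i => ?_
    obtain ⟨m, hm, h⟩ := exists_pos_forall_le (f := fun p => R - dist (G p i) c)
      (continuous_const.sub (((continuous_apply i).comp hG).dist continuous_const))
      fun p => sub_pos.2 (hball p i)
    filter_upwards [Ioc_mem_nhdsGT hm] with δ hδ p
    exact ball_subset_ball' (by linarith [h p, hδ.2])
  obtain ⟨δ, ⟨h1, h2⟩, h0⟩ := ((h1.and h2).and self_mem_nhdsWithin).exists
  exact ⟨δ, h0, fun p i j hij => h1 i j hij p, fun p i => h2 i p⟩

/-- Isotopy lifting: a family that moves points along `G (0, ·)` can be deformed along a homotopy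
`G` of motions in the open disk, and its end is unchanged if the homotopy is constant there. -/
theorem Moves.exists_of_homotopy {S : Subgroup (closedBall c R ≃ₜ closedBall c R)}
    (hS : diskDiffeo c R ≤ S) {G : I × I → ι → ℂ} (hG : Continuous G)
    (hinj : ∀ p, Function.Injective (G p)) (hball : ∀ p i, G p i ∈ ball c R)
    (h0 : ∀ s, G (s, 0) = G (0, 0)) {Ψ : I → (closedBall c R ≃ₜ closedBall c R)}
    (h : Moves S (fun t => G (0, t)) Ψ) :
    ∃ Ψ', Moves S (fun t => G (1, t)) Ψ' ∧ ((∀ s, G (s, 1) = G (0, 1)) → Ψ' 1 = Ψ 1) := by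
  obtain ⟨δ, hδ, hsep, hballδ⟩ := exists_margin hG hinj hball
  set C : ℝ := Fintype.card ι * bumpLip with hC
  have hC0 : 0 ≤ C := by positivity
  obtain ⟨η, hη, hunif⟩ := Metric.uniformContinuous_iff.1
    (CompactSpace.uniformContinuous_of_continuous hG) (δ / 2 / (C + 1)) (by positivity)
  refine forall_of_uniform_step (p := fun s => ∃ Ψ', Moves S (fun t => G (s, t)) Ψ' ∧
    ((∀ s, G (s, 1) = G (0, 1)) → Ψ' 1 = Ψ 1)) ⟨Ψ, h, fun _ => rfl⟩ hη ?_ 1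
  rintro s s' hs ⟨Ψ', hΨ', hend⟩
  obtain ⟨Ψ'', hΨ'', hend'⟩ := hΨ'.exists_of_close hS (γ' := fun t => G (s', t)) (by fun_prop)
    (by fun_prop) ((h0 s').trans (h0 s).symm) hδ (fun t => hsep (s, t)) (fun t => hballδ (s, t))
    (fun t i => by
      have h1 : dist (G (s, t)) (G (s', t)) < δ / 2 / (C + 1) := by
        refine hunif ?_
        rw [Prod.dist_eq, dist_self]
        exact max_lt hs hη
      have h2 : ‖G (s', t) i - G (s, t) i‖ ≤ δ / 2 / (C + 1) := by
        rw [← dist_eq_norm, dist_comm]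
        exact (dist_le_pi_dist _ _ i).trans h1.le
      calc C * ‖G (s', t) i - G (s, t) i‖ ≤ (C + 1) * (δ / 2 / (C + 1)) := by gcongr; linarith
        _ = δ / 2 := by field_simp)
  exact ⟨Ψ'', hΨ'', fun he => (hend' ((he s').trans (he s).symm)).trans (hend he)⟩

/-- Every motion of a configuration in the open disk is carried by diffeomorphisms. -/
theorem exists_moves {γ : I → ι → ℂ} (hγ : Continuous γ)
    (hinj : ∀ t, Function.Injective (γ t)) (hball : ∀ t i, γ t i ∈ ball c R) :
    ∃ Ψ, Moves (diskDiffeo c R) γ Ψ := by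
  have h := Moves.exists_of_homotopy (c := c) (R := R) le_rfl
    (G := fun p => γ (p.1 * p.2)) (hγ.comp (continuous_fst.mul continuous_snd)) (fun _ => hinj _)
    (fun _ => hball _) (fun s => by simp) (Ψ := fun _ => 1)
    ⟨continuous_snd, rfl, fun _ => one_mem _, fun t i y hy => by simpa using hy⟩
  obtain ⟨Ψ, hΨ, -⟩ := h
  exact ⟨Ψ, by simpa using hΨ⟩

end Carries

/-! ### Homotopies of motions -/

section Homotopy

variable {ι : Type*}

/-- Two motions of a configuration of distinct points of the plane are homotopic with fixed ends
in the configuration space. -/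
def ConfHomotopic (γ γ' : I → ι → ℂ) : Prop :=
  ∃ G : I × I → ι → ℂ, Continuous G ∧ (∀ p, Function.Injective (G p)) ∧
    (∀ t, G (0, t) = γ t) ∧ (∀ t, G (1, t) = γ' t) ∧ (∀ s, G (s, 0) = γ 0) ∧ ∀ s, G (s, 1) = γ 1

/-- The radial map `c + z ↦ c + k(‖z‖) z` with `k(x) = 1 / (1 + max (x - r) 0 / R)`. For `0 ≤ r < R`
it is an embedding of the plane into the open disk of radius `R` that fixes the closed disk of
radius `r`. -/
def squeeze (c : ℂ) (r R : ℝ) (y : ℂ) : ℂ :=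
  c + (1 + max (‖y - c‖ - r) 0 / R)⁻¹ • (y - c)

theorem squeeze_eq {c y : ℂ} {r R : ℝ} (hy : ‖y - c‖ ≤ r) : squeeze c r R y = y := by
  simp [squeeze, max_eq_right (sub_nonpos.2 hy)]

theorem squeeze_factor_pos {r R : ℝ} (hR : 0 < R) (x : ℝ) : 0 < 1 + max (x - r) 0 / R := by
  positivity

theorem continuous_squeeze (c : ℂ) (r : ℝ) {R : ℝ} (hR : 0 < R) : Continuous (squeeze c r R) := by
  have h1 : Continuous fun y : ℂ => (1 + max (‖y - c‖ - r) 0 / R)⁻¹ :=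
    Continuous.inv₀ (by fun_prop) fun y => (squeeze_factor_pos hR _).ne'
  exact continuous_const.add (h1.smul (by fun_prop : Continuous fun y : ℂ => y - c))

theorem squeeze_mem_ball (c y : ℂ) {r R : ℝ} (hr : r < R) (hR : 0 < R) :
    squeeze c r R y ∈ ball c R := by
  have hk := squeeze_factor_pos (r := r) hR ‖y - c‖
  rw [mem_ball, dist_eq_norm, squeeze, add_sub_cancel_left, norm_smul, norm_inv,
    Real.norm_of_nonneg hk.le, inv_mul_lt_iff₀ hk, add_mul, one_mul, div_mul_cancel₀ _ hR.ne']
  linarith [le_max_left (‖y - c‖ - r) 0]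

theorem injective_squeeze (c : ℂ) {r R : ℝ} (hr : r < R) (hR : 0 < R) :
    Function.Injective (squeeze c r R) := by
  intro y y' h
  have hk := squeeze_factor_pos (r := r) hR ‖y - c‖
  have hk' := squeeze_factor_pos (r := r) hR ‖y' - c‖
  have h1 : (1 + max (‖y - c‖ - r) 0 / R)⁻¹ • (y - c) =
      (1 + max (‖y' - c‖ - r) 0 / R)⁻¹ • (y' - c) := add_left_cancel h
  have h2 := congrArg norm h1
  rw [norm_smul, norm_smul, norm_inv, norm_inv, Real.norm_of_nonneg hk.le,
    Real.norm_of_nonneg hk'.le, inv_mul_eq_div, inv_mul_eq_div, div_eq_div_iff hk.ne' hk'.ne'] at h2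
  have h3 : ‖y - c‖ = ‖y' - c‖ := by
    have e1 : ‖y - c‖ * (R + max (‖y' - c‖ - r) 0) = ‖y' - c‖ * (R + max (‖y - c‖ - r) 0) := by
      field_simp at h2
      linarith
    have n1 := norm_nonneg (y - c)
    have n2 := norm_nonneg (y' - c)
    rcases le_total (‖y - c‖) r with a | a <;> rcases le_total (‖y' - c‖) r with b | b
    · rw [max_eq_right (by linarith), max_eq_right (by linarith)] at e1
      nlinarith
    · rw [max_eq_left (by linarith), max_eq_right (by linarith)] at e1
      nlinarith
    · rw [max_eq_right (by linarith), max_eq_left (by linarith)] at e1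
      nlinarith
    · rw [max_eq_left (by linarith), max_eq_left (by linarith)] at e1
      nlinarith
  rw [h3] at h1
  exact sub_left_injective (smul_right_injective ℂ (inv_ne_zero hk'.ne') h1)

/-- Homotopic motions in the open disk are carried by the same homeomorphisms, even if the homotopy
leaves the disk. -/
theorem Carries.of_confHomotopic [Fintype ι] {c : ℂ} {R : ℝ} (hR : 0 < R)
    {S : Subgroup (closedBall c R ≃ₜ closedBall c R)} (hS : diskDiffeo c R ≤ S)
    {γ γ' : I → ι → ℂ} (h : ConfHomotopic γ γ') (hγ : ∀ t i, γ t i ∈ ball c R)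
    (hγ' : ∀ t i, γ' t i ∈ ball c R) {f : closedBall c R ≃ₜ closedBall c R}
    (hf : Carries S γ f) : Carries S γ' f := by
  obtain ⟨G, hG, hinj, hG0, hG1, hGl, hGr⟩ := h
  have hb : ∀ H : I → ι → ℂ, Continuous H → (∀ t i, H t i ∈ ball c R) →
      ∃ m, 0 < m ∧ ∀ t i, m ≤ R - ‖H t i - c‖ := by
    intro H hH hHb
    have : ∀ᶠ δ in 𝓝[>] (0 : ℝ), ∀ i t, δ ≤ R - ‖H t i - c‖ := by
      refine Filter.eventually_all.2 fun i => ?_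
      obtain ⟨m, hm, h⟩ := exists_pos_forall_le (f := fun t => R - ‖H t i - c‖)
        (continuous_const.sub (((continuous_apply i).comp hH).sub continuous_const).norm)
        fun t => sub_pos.2 (mem_ball_iff_norm.1 (hHb t i))
      filter_upwards [Ioc_mem_nhdsGT hm] with δ hδ t
      exact hδ.2.trans (h t)
    obtain ⟨m, hm, h0⟩ := (this.and self_mem_nhdsWithin).exists
    exact ⟨m, h0, fun t i => hm i t⟩
  have hγc : Continuous γ := by
    rw [show γ = fun t => G (0, t) from funext fun t => (hG0 t).symm]
    fun_prop
  have hγc' : Continuous γ' := by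
    rw [show γ' = fun t => G (1, t) from funext fun t => (hG1 t).symm]
    fun_prop
  obtain ⟨m, hm, hmγ⟩ := hb γ hγc hγ
  obtain ⟨m', hm', hmγ'⟩ := hb γ' hγc' hγ'
  set r := R - min m m' with hr
  have hrR : r < R := by
    have : 0 < min m m' := lt_min hm hm'
    linarith
  let G' : I × I → ι → ℂ := fun p i => squeeze c r R (G p i)
  have e0 : ∀ t, G' (0, t) = γ t := fun t => funext fun i => by
    simp only [G', hG0]
    exact squeeze_eq (by linarith [hmγ t i, min_le_left m m'])
  have e1 : ∀ t, G' (1, t) = γ' t := fun t => funext fun i => by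
    simp only [G', hG1]
    exact squeeze_eq (by linarith [hmγ' t i, min_le_right m m'])
  obtain ⟨Ψ, hΨ, hΨ1⟩ := hf
  obtain ⟨Ψ', hΨ', hend⟩ := Moves.exists_of_homotopy (G := G') hS
    (continuous_pi fun i => (continuous_squeeze c r hR).comp (by fun_prop))
    (fun p => (injective_squeeze c hrR hR).comp (hinj p))
    (fun p i => squeeze_mem_ball c _ hrR hR)
    (fun s => by simp only [G', hGl]) (Ψ := Ψ)
    (by simpa only [e0] using hΨ)
  refine ⟨Ψ', by simpa only [e1] using hΨ', (hend fun s => ?_).trans hΨ1⟩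
  simp only [G', hGr]

/-- Gluing of two families along the parameter `1/2`. -/
theorem continuous_glue {Z E : Type*} [TopologicalSpace Z] [TopologicalSpace E] {A B : I × Z → E}
    (hA : Continuous A) (hB : Continuous B) (h : ∀ z, A (1, z) = B (0, z)) :
    Continuous fun p : I × Z => if (p.1 : ℝ) ≤ 1 / 2 then A (projIcc 0 1 zero_le_one (2 * p.1), p.2)
      else B (projIcc 0 1 zero_le_one (2 * p.1 - 1), p.2) := by
  refine Continuous.if_le ?_ ?_ (by fun_prop) continuous_const ?_
  · exact hA.comp ((continuous_projIcc.comp (by fun_prop)).prodMk continuous_snd)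
  · exact hB.comp ((continuous_projIcc.comp (by fun_prop)).prodMk continuous_snd)
  · intro p hp
    rw [hp, show (2 : ℝ) * (1 / 2) = 1 by norm_num, sub_self, projIcc_right, projIcc_left]
    exact h p.2

theorem ConfHomotopic.trans {γ γ' γ'' : I → ι → ℂ} (h : ConfHomotopic γ γ')
    (h' : ConfHomotopic γ' γ'') : ConfHomotopic γ γ'' := by
  obtain ⟨G, hG, hinj, hG0, hG1, hGl, hGr⟩ := h
  obtain ⟨G', hG', hinj', hG'0, hG'1, hG'l, hG'r⟩ := h'
  have el : γ' 0 = γ 0 := by rw [← hG1, hGl]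
  have er : γ' 1 = γ 1 := by rw [← hG1, hGr]
  refine ⟨_, continuous_glue hG hG' fun t => by rw [hG1, hG'0], ?_, ?_, ?_, ?_, ?_⟩
  · intro p
    split_ifs
    exacts [hinj _, hinj' _]
  · intro t
    simp [hG0]
  · intro t
    norm_num [hG'1, projIcc_right]
  · intro s
    dsimp only
    split_ifs
    · rw [hGl]
    · rw [hG'l, el]
  · intro s
    dsimp only
    split_ifs
    · rw [hGr]
    · rw [hG'r, er]

end Homotopy

/-! ### The model half-twist as the end of a one-parameter group -/

/-- The damped rotation by the angle `π a`; `modelHalfTwist` is the case `a = 1`. -/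
def twist (a : ℝ) (z : ℂ) : ℂ :=
  Complex.exp (Real.pi * (a * Real.smoothTransition (2 - ‖z‖ ^ 2)) * Complex.I) * z

theorem twist_one : twist 1 = modelHalfTwist := by
  ext z
  simp [twist, modelHalfTwist]

theorem norm_twist (a : ℝ) (z : ℂ) : ‖twist a z‖ = ‖z‖ := by
  rw [twist, norm_mul, show (Real.pi * (a * Real.smoothTransition (2 - ‖z‖ ^ 2)) * Complex.I : ℂ) =
    (Real.pi * (a * Real.smoothTransition (2 - ‖z‖ ^ 2)) : ℝ) * Complex.I by push_cast; ring,
    Complex.norm_exp_ofReal_mul_I, one_mul]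

theorem twist_add (a b : ℝ) (z : ℂ) : twist (a + b) z = twist a (twist b z) := by
  have h := norm_twist b z
  rw [twist, twist, h, twist, ← mul_assoc (Complex.exp _), ← Complex.exp_add]
  congr 2
  push_cast
  ring

theorem twist_zero (z : ℂ) : twist 0 z = z := by simp [twist]

theorem twist_eq_self (a : ℝ) {z : ℂ} (hz : 2 ≤ ‖z‖ ^ 2) : twist a z = z := by
  simp [twist, Real.smoothTransition.zero_of_nonpos (sub_nonpos.2 hz)]

theorem twist_of_norm_le_one (a : ℝ) {z : ℂ} (hz : ‖z‖ ≤ 1) :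
    twist a z = Complex.exp ((Real.pi * a : ℝ) * Complex.I) * z := by
  have : ‖z‖ ^ 2 ≤ 1 := pow_le_one₀ (norm_nonneg z) hz
  rw [twist, Real.smoothTransition.one_of_one_le (by linarith)]
  push_cast
  ring_nf

theorem continuous_twist : Continuous fun p : ℝ × ℂ => twist p.1 p.2 := by
  have h : Continuous fun p : ℝ × ℂ => (Real.smoothTransition (2 - ‖p.2‖ ^ 2) : ℂ) :=
    Complex.continuous_ofReal.comp (Real.smoothTransition.continuous.comp (by fun_prop))
  unfold twist
  fun_prop

theorem contDiff_twist (a : ℝ) : ContDiff ℝ ∞ (twist a) := by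
  have h : ContDiff ℝ ∞ fun z : ℂ => (Real.smoothTransition (2 - ‖z‖ ^ 2) : ℂ) :=
    Complex.ofRealCLM.contDiff.comp ((Real.smoothTransition.contDiff (n := ⊤)).comp
      (contDiff_const.sub (contDiff_norm_sq ℝ)))
  unfold twist
  exact (((contDiff_const.mul (contDiff_const.mul h)).mul contDiff_const).cexp).mul contDiff_id

/-! ### Half-twists along an embedded disk -/

/-- An orientation preserving smooth embedding of the disk of radius `2` into the interior of
the disk `D`. -/
structure TwistChart (c : ℂ) (R : ℝ) (φ : ℂ → ℂ) : Prop where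
  smooth : ContDiffOn ℝ ∞ φ (ball 0 2)
  inj : InjOn φ (ball 0 2)
  det_pos : ∀ z ∈ ball (0 : ℂ) 2, 0 < (fderiv ℝ φ z).det
  image_subset : φ '' ball 0 2 ⊆ ball c R

namespace TwistChart

variable {c : ℂ} {R : ℝ} {φ : ℂ → ℂ}

theorem contDiffAt (h : TwistChart c R φ) {z : ℂ} (hz : z ∈ ball (0 : ℂ) 2) :
    ContDiffAt ℝ ∞ φ z := h.smooth.contDiffAt (isOpen_ball.mem_nhds hz)

theorem hasStrictFDerivAt (h : TwistChart c R φ) {z : ℂ} (hz : z ∈ ball (0 : ℂ) 2) :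
    HasStrictFDerivAt φ (((fderiv ℝ φ z).toContinuousLinearEquivOfDetNeZero
      (h.det_pos z hz).ne' : ℂ ≃L[ℝ] ℂ) : ℂ →L[ℝ] ℂ) z := by
  rw [ContinuousLinearMap.coe_toContinuousLinearEquivOfDetNeZero]
  exact (h.contDiffAt hz).hasStrictFDerivAt (by simp)

theorem isOpenMap (h : TwistChart c R φ) : IsOpenMap ((ball (0 : ℂ) 2).domRestrict φ) := by
  rw [isOpenMap_iff_nhds_le]
  rintro ⟨z, hz⟩
  have h1 : Filter.map ((ball (0 : ℂ) 2).domRestrict φ) (𝓝 ⟨z, hz⟩) = Filter.map φ (𝓝 z) := by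
    rw [← map_nhds_subtype_coe_eq_nhds hz (isOpen_ball.mem_nhds hz), Filter.map_map]
    rfl
  rw [h1]
  exact (h.hasStrictFDerivAt hz).map_nhds_eq_of_equiv.ge

/-- The chart as a partial homeomorphism, whose inverse is smooth. -/
def homeo (h : TwistChart c R φ) : OpenPartialHomeomorph ℂ ℂ where
  toPartialHomeomorph := PartialHomeomorph.ofContinuousOpenRestrict
    (InjOn.toPartialEquiv φ (ball 0 2) h.inj) h.smooth.continuousOn h.isOpenMap
  open_source := isOpen_ball
  open_target := by
    have := h.isOpenMap.isOpen_range
    rwa [range_domRestrict] at this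

theorem isOpen_image (h : TwistChart c R φ) : IsOpen (φ '' ball 0 2) := h.homeo.open_target

theorem homeo_symm_mem (h : TwistChart c R φ) {y : ℂ} (hy : y ∈ φ '' ball 0 2) :
    h.homeo.symm y ∈ ball (0 : ℂ) 2 := h.homeo.map_target hy

theorem homeo_symm_apply (h : TwistChart c R φ) {z : ℂ} (hz : z ∈ ball (0 : ℂ) 2) :
    h.homeo.symm (φ z) = z := h.homeo.left_inv hz

theorem contDiffAt_homeo_symm (h : TwistChart c R φ) {y : ℂ} (hy : y ∈ φ '' ball 0 2) :
    ContDiffAt ℝ ∞ h.homeo.symm y :=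
  h.homeo.contDiffAt_symm hy (h.hasStrictFDerivAt (h.homeo_symm_mem hy)).hasFDerivAt
    (h.contDiffAt (h.homeo_symm_mem hy))

theorem twist_mem {a : ℝ} {z : ℂ} (hz : z ∈ ball (0 : ℂ) 2) : twist a z ∈ ball (0 : ℂ) 2 := by
  rw [mem_ball_zero_iff] at hz ⊢
  rwa [norm_twist]

open Classical in
/-- The damped rotation by `π a`, transplanted by the chart, and extended by the identity. -/
def twistFun (h : TwistChart c R φ) (a : ℝ) (y : ℂ) : ℂ :=
  if y ∈ φ '' ball 0 2 then φ (twist a (h.homeo.symm y)) else y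

theorem twistFun_apply (h : TwistChart c R φ) (a : ℝ) {z : ℂ} (hz : z ∈ ball (0 : ℂ) 2) :
    h.twistFun a (φ z) = φ (twist a z) := by
  rw [twistFun, if_pos (mem_image_of_mem φ hz), h.homeo_symm_apply hz]

theorem twistFun_of_notMem (h : TwistChart c R φ) (a : ℝ) {y : ℂ} (hy : y ∉ φ '' ball 0 2) :
    h.twistFun a y = y := if_neg hy

theorem twistFun_add (h : TwistChart c R φ) (a b : ℝ) (y : ℂ) :
    h.twistFun (a + b) y = h.twistFun a (h.twistFun b y) := by
  by_cases hy : y ∈ φ '' ball 0 2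
  · obtain ⟨z, hz, rfl⟩ := hy
    rw [h.twistFun_apply _ hz, h.twistFun_apply _ hz, h.twistFun_apply _ (twist_mem hz), twist_add]
  · rw [h.twistFun_of_notMem _ hy, h.twistFun_of_notMem _ hy, h.twistFun_of_notMem _ hy]

theorem twistFun_zero (h : TwistChart c R φ) (y : ℂ) : h.twistFun 0 y = y := by
  by_cases hy : y ∈ φ '' ball 0 2
  · obtain ⟨z, hz, rfl⟩ := hy
    rw [h.twistFun_apply _ hz, twist_zero]
  · exact h.twistFun_of_notMem _ hy

/-- Off the compact image of the disk of radius `√2` the transplanted rotations are the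
identity. -/
theorem twistFun_eq_self (h : TwistChart c R φ) (a : ℝ) {y : ℂ}
    (hy : y ∉ φ '' closedBall 0 √2) : h.twistFun a y = y := by
  by_cases hy' : y ∈ φ '' ball 0 2
  · obtain ⟨z, hz, rfl⟩ := hy'
    rw [h.twistFun_apply _ hz, twist_eq_self]
    have : z ∉ closedBall (0 : ℂ) √2 := fun hz' => hy (mem_image_of_mem φ hz')
    rw [mem_closedBall_zero_iff, not_le] at this
    exact (Real.sqrt_le_left (norm_nonneg z)).1 this.le
  · exact h.twistFun_of_notMem _ hy'

theorem isOpen_compl (h : TwistChart c R φ) : IsOpen (φ '' closedBall 0 √2)ᶜ := by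
  refine (IsCompact.isClosed ?_).isOpen_compl
  refine (isCompact_closedBall _ _).image_of_continuousOn
    (h.smooth.continuousOn.mono (closedBall_subset_ball ?_))
  rw [Real.sqrt_lt' (by norm_num)]
  norm_num

theorem continuous_twistFun (h : TwistChart c R φ) :
    Continuous fun p : ℝ × ℂ => h.twistFun p.1 p.2 := by
  refine continuous_iff_continuousAt.2 fun ⟨a, y⟩ => ?_
  by_cases hy : y ∈ φ '' ball 0 2
  · have h1 : (fun p : ℝ × ℂ => φ (twist p.1 (h.homeo.symm p.2))) =ᶠ[𝓝 (a, y)]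
        fun p : ℝ × ℂ => h.twistFun p.1 p.2 := by
      filter_upwards [continuousAt_snd (h.isOpen_image.mem_nhds hy)] with p hp
      exact (if_pos hp).symm
    refine ContinuousAt.congr ?_ h1
    have h2 : ContinuousAt (fun p : ℝ × ℂ => h.homeo.symm p.2) (a, y) :=
      ContinuousAt.comp (g := h.homeo.symm) (f := Prod.snd)
        (h.contDiffAt_homeo_symm hy).continuousAt continuousAt_snd
    have h3 : ContinuousAt (fun p : ℝ × ℂ => twist p.1 (h.homeo.symm p.2)) (a, y) :=
      ContinuousAt.comp (g := fun p : ℝ × ℂ => twist p.1 p.2)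
        (f := fun p : ℝ × ℂ => (p.1, h.homeo.symm p.2))
        continuous_twist.continuousAt (continuousAt_fst.prodMk h2)
    have h4 : ContinuousAt φ (twist a (h.homeo.symm y)) :=
      (h.contDiffAt (twist_mem (h.homeo_symm_mem hy))).continuousAt
    exact ContinuousAt.comp (x := (a, y)) (g := φ)
      (f := fun p : ℝ × ℂ => twist p.1 (h.homeo.symm p.2)) h4 h3
  · have hy' : y ∉ φ '' closedBall 0 √2 := fun h' => hy (image_mono (closedBall_subset_ball (by
      rw [Real.sqrt_lt' (by norm_num)]; norm_num)) h')
    refine continuousAt_snd.congr ?_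
    filter_upwards [continuousAt_snd (h.isOpen_compl.mem_nhds hy')] with p hp
    exact (h.twistFun_eq_self _ hp).symm

theorem contDiff_twistFun (h : TwistChart c R φ) (a : ℝ) : ContDiff ℝ ∞ (h.twistFun a) := by
  refine contDiff_iff_contDiffAt.2 fun y => ?_
  by_cases hy : y ∈ φ '' ball 0 2
  · have h1 : h.twistFun a =ᶠ[𝓝 y] φ ∘ twist a ∘ h.homeo.symm := by
      filter_upwards [h.isOpen_image.mem_nhds hy] with p hp
      exact if_pos hp
    refine ContDiffAt.congr_of_eventuallyEq ?_ h1
    exact (h.contDiffAt (twist_mem (h.homeo_symm_mem hy))).comp y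
      ((contDiff_twist a).contDiffAt.comp y (h.contDiffAt_homeo_symm hy))
  · have hy' : y ∉ φ '' closedBall 0 √2 := fun h' => hy (image_mono (closedBall_subset_ball (by
      rw [Real.sqrt_lt' (by norm_num)]; norm_num)) h')
    refine contDiffAt_id.congr_of_eventuallyEq ?_
    filter_upwards [h.isOpen_compl.mem_nhds hy'] with p hp
    exact h.twistFun_eq_self _ hp

/-- The transplanted damped rotation by `π a` as a homeomorphism of the plane. -/
def twistPlane (h : TwistChart c R φ) (a : ℝ) : ℂ ≃ₜ ℂ where
  toFun := h.twistFun a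
  invFun := h.twistFun (-a)
  left_inv y := by rw [← h.twistFun_add, neg_add_cancel, h.twistFun_zero]
  right_inv y := by rw [← h.twistFun_add, add_neg_cancel, h.twistFun_zero]
  continuous_toFun := (h.contDiff_twistFun a).continuous
  continuous_invFun := (h.contDiff_twistFun (-a)).continuous

theorem twistPlane_eq_self (h : TwistChart c R φ) (a : ℝ) (y : ℂ) (hy : y ∉ ball c R) :
    h.twistPlane a y = y := h.twistFun_of_notMem a fun hy' => hy (h.image_subset hy')

/-- The transplanted damped rotation by `π a` as a homeomorphism of `D`. -/
def twistDisk (h : TwistChart c R φ) (a : ℝ) : closedBall c R ≃ₜ closedBall c R :=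
  restrictDisk (h.twistPlane a) (h.twistPlane_eq_self a)

theorem coe_twistDisk (h : TwistChart c R φ) (a : ℝ) (y : closedBall c R) :
    (h.twistDisk a y : ℂ) = h.twistFun a y := rfl

theorem twistDisk_add (h : TwistChart c R φ) (a b : ℝ) :
    h.twistDisk (a + b) = h.twistDisk a * h.twistDisk b := by
  ext y
  exact h.twistFun_add a b y

theorem twistDisk_mem (h : TwistChart c R φ) (a : ℝ) : h.twistDisk a ∈ diskDiffeo c R :=
  restrictDisk_mem_diskDiffeo _ _ (h.contDiff_twistFun a) (h.contDiff_twistFun (-a))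

/-- The `n`-th power of a half-twist is carried by the motion in which the points `φ (-1)` and
`φ 1` turn around each other `n` times by `180` degrees in the chart. -/
theorem carries_twistDisk (h : TwistChart c R φ) (n : ℕ) {r : ℂ} (hr : r ∉ φ '' ball 0 2) :
    Carries (diskDiffeo c R) (fun t : I =>
      ![φ (-Complex.exp ((Real.pi * (n * t) : ℝ) * Complex.I)),
        φ (Complex.exp ((Real.pi * (n * t) : ℝ) * Complex.I)), r]) (h.twistDisk n) := by
  refine ⟨fun t => h.twistDisk (n * t), ⟨?_, ?_, fun t => h.twistDisk_mem _, ?_⟩, by simp⟩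
  · refine continuous_restrictDisk (fun t : I => h.twistPlane (n * t))
      (fun t => h.twistPlane_eq_self _) ?_
    exact h.continuous_twistFun.comp (f := fun p : I × ℂ => ((n * p.1 : ℝ), p.2)) (by fun_prop)
  · ext y
    simp only [coe_twistDisk, Icc.coe_zero, mul_zero, h.twistFun_zero]
    rfl
  · intro t i y hy
    rw [coe_twistDisk, hy]
    fin_cases i
    · have h1 : (-1 : ℂ) ∈ ball (0 : ℂ) 2 := by simp
      simp only [Icc.coe_zero, mul_zero, Complex.ofReal_zero, zero_mul, Complex.exp_zero,
        Fin.zero_eta, Matrix.cons_val_zero]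
      rw [h.twistFun_apply _ h1, twist_of_norm_le_one _ (by simp), mul_neg, mul_one]
    · have h1 : (1 : ℂ) ∈ ball (0 : ℂ) 2 := by simp
      simp only [Icc.coe_zero, mul_zero, Complex.ofReal_zero, zero_mul, Complex.exp_zero,
        Fin.mk_one, Matrix.cons_val_one, Matrix.cons_val_zero]
      rw [h.twistFun_apply _ h1, twist_of_norm_le_one _ (by simp), mul_one]
    · exact h.twistFun_of_notMem _ hr

end TwistChart

/-! ### Two points turning around each other in a chart -/

theorem injective_vec3 {a b r : ℂ} (hab : a ≠ b) (har : a ≠ r) (hbr : b ≠ r) :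
    Function.Injective ![a, b, r] := by
  intro i j h
  fin_cases i <;> fin_cases j <;> simp_all [eq_comm]

theorem continuous_vec3 {Z : Type*} [TopologicalSpace Z] {a b r : Z → ℂ} (ha : Continuous a)
    (hb : Continuous b) (hr : Continuous r) : Continuous fun z => ![a z, b z, r z] := by
  refine continuous_pi fun i => ?_
  fin_cases i
  exacts [ha, hb, hr]

/-- A homotopy of motions of two points in the complement of a fixed point `ρ`. -/
theorem ConfHomotopic.pair {A B : I × I → ℂ} {ρ : ℂ} (hA : Continuous A) (hB : Continuous B)
    (hAB : ∀ p, A p ≠ B p) (hAρ : ∀ p, A p ≠ ρ) (hBρ : ∀ p, B p ≠ ρ)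
    (hA0 : ∀ s, A (s, 0) = A (0, 0)) (hB0 : ∀ s, B (s, 0) = B (0, 0))
    (hA1 : ∀ s, A (s, 1) = A (0, 1)) (hB1 : ∀ s, B (s, 1) = B (0, 1)) :
    ConfHomotopic (fun t => ![A (0, t), B (0, t), ρ]) (fun t => ![A (1, t), B (1, t), ρ]) :=
  ⟨fun p => ![A p, B p, ρ], continuous_vec3 hA hB continuous_const,
    fun p => injective_vec3 (hAB p) (hAρ p) (hBρ p), fun _ => rfl, fun _ => rfl,
    fun s => by simp only [hA0 s, hB0 s], fun s => by simp only [hA1 s, hB1 s]⟩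

/-- A homotopy of motions of two points with midpoint `M` and half difference `Δ`. -/
theorem ConfHomotopic.symmPair {M Δ : I × I → ℂ} {ρ : ℂ} (hM : Continuous M) (hΔ : Continuous Δ)
    (hΔ0 : ∀ p, Δ p ≠ 0) (h1 : ∀ p, M p - Δ p ≠ ρ) (h2 : ∀ p, M p + Δ p ≠ ρ)
    (hMl : ∀ s, M (s, 0) = M (0, 0)) (hΔl : ∀ s, Δ (s, 0) = Δ (0, 0))
    (hMr : ∀ s, M (s, 1) = M (0, 1)) (hΔr : ∀ s, Δ (s, 1) = Δ (0, 1)) :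
    ConfHomotopic (fun t => ![M (0, t) - Δ (0, t), M (0, t) + Δ (0, t), ρ])
      (fun t => ![M (1, t) - Δ (1, t), M (1, t) + Δ (1, t), ρ]) := by
  refine ConfHomotopic.pair (A := fun p => M p - Δ p) (B := fun p => M p + Δ p) (hM.sub hΔ)
    (hM.add hΔ) (fun p h => hΔ0 p ?_) h1 h2 ?_ ?_ ?_ ?_
  · have : (2 : ℂ) * Δ p = 0 := by linear_combination -h
    simpa using this
  all_goals intro s; simp only [hMl s, hΔl s, hMr s, hΔr s]

/-- A homotopy is transported by an injective continuous map of the plane. -/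
theorem ConfHomotopic.map {ι : Type*} {γ γ' : I → ι → ℂ} (h : ConfHomotopic γ γ') {g : ℂ → ℂ}
    (hg : Continuous g) (hginj : Function.Injective g) :
    ConfHomotopic (fun t i => g (γ t i)) (fun t i => g (γ' t i)) := by
  obtain ⟨G, hG, hinj, hG0, hG1, hGl, hGr⟩ := h
  refine ⟨fun p i => g (G p i), continuous_pi fun i => hg.comp ((continuous_apply i).comp hG),
    fun p => hginj.comp (hinj p), ?_, ?_, ?_, ?_⟩ <;> intro t <;> simp only [*]

/-- The point `x + i k y` with `(x, y)` on the unit circle: a point of an ellipse. -/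
def ellipse (k : ℝ) (z : ℂ) : ℂ := z.re + k * z.im * Complex.I

theorem ellipse_re (k : ℝ) (z : ℂ) : (ellipse k z).re = z.re := by simp [ellipse]

theorem ellipse_im (k : ℝ) (z : ℂ) : (ellipse k z).im = k * z.im := by simp [ellipse]

theorem ellipse_one (z : ℂ) : ellipse 1 z = z := by
  apply Complex.ext <;> simp [ellipse_re, ellipse_im]

theorem ellipse_neg (k : ℝ) (z : ℂ) : ellipse k (-z) = -ellipse k z := by
  apply Complex.ext <;> simp [ellipse_re, ellipse_im]

theorem ellipse_of_im_eq_zero (k : ℝ) {z : ℂ} (hz : z.im = 0) : ellipse k z = z := by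
  apply Complex.ext <;> simp [ellipse_re, ellipse_im, hz]

theorem ellipse_ne_zero {k : ℝ} (hk : k ≠ 0) {z : ℂ} (hz : z ≠ 0) : ellipse k z ≠ 0 := by
  intro h
  apply hz
  have h1 := congrArg Complex.re h
  have h2 := congrArg Complex.im h
  rw [ellipse_re] at h1
  rw [ellipse_im] at h2
  exact Complex.ext h1 ((mul_eq_zero.1 h2).resolve_left hk)

theorem norm_ellipse_le {k : ℝ} (hk0 : 0 ≤ k) (hk : k ≤ 1) (z : ℂ) : ‖ellipse k z‖ ≤ ‖z‖ := by
  rw [← sq_le_sq₀ (norm_nonneg _) (norm_nonneg _), Complex.sq_norm, Complex.sq_norm,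
    Complex.normSq_apply, Complex.normSq_apply, ellipse_re, ellipse_im]
  have : k * k ≤ 1 := mul_le_one₀ hk hk0 hk
  nlinarith [mul_self_nonneg z.im]

theorem continuous_ellipse : Continuous fun p : ℝ × ℂ => ellipse p.1 p.2 := by
  unfold ellipse
  fun_prop

theorem ne_of_abs_im_lt {y ρ : ℂ} (h : |y.im| < |ρ.im|) : y ≠ ρ := by
  rintro rfl
  exact lt_irrefl _ h

theorem ne_of_norm_lt {y ρ : ℂ} (h : ‖y‖ < ‖ρ‖) : y ≠ ρ := by
  rintro rfl
  exact lt_irrefl _ h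

/-- The symmetric difference quotient of `f` at `0`, with its limit, the derivative `L`, at
`s = 0`. -/
def symmQuot (f : ℂ → ℂ) (L : ℂ →L[ℝ] ℂ) (s : ℝ) (z : ℂ) : ℂ :=
  open Classical in if s = 0 then L z else (2 * s : ℂ)⁻¹ * (f (s * z) - f (-(s * z)))

theorem symmQuot_neg (f : ℂ → ℂ) (L : ℂ →L[ℝ] ℂ) (s : ℝ) (z : ℂ) :
    symmQuot f L s (-z) = -symmQuot f L s z := by
  unfold symmQuot
  split_ifs
  · simp
  · rw [mul_neg, neg_neg]
    ring

theorem symmQuot_one (f : ℂ → ℂ) (L : ℂ →L[ℝ] ℂ) (z : ℂ) :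
    symmQuot f L 1 z = (f z - f (-z)) / 2 := by
  rw [symmQuot, if_neg one_ne_zero]
  simp
  ring

theorem mul_mem_ball_two {s : ℝ} (hs : s ∈ Icc (0 : ℝ) 1) {z : ℂ} (hz : ‖z‖ ≤ 1) :
    (s * z : ℂ) ∈ ball (0 : ℂ) 2 := by
  rw [mem_ball_zero_iff, norm_mul, Complex.norm_real, Real.norm_of_nonneg hs.1]
  have := mul_le_one₀ hs.2 (norm_nonneg z) hz
  linarith

theorem neg_mem_ball_two {z : ℂ} (hz : z ∈ ball (0 : ℂ) 2) : -z ∈ ball (0 : ℂ) 2 := by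
  rwa [mem_ball_zero_iff, norm_neg, ← mem_ball_zero_iff]

theorem symmQuot_ne_zero {f : ℂ → ℂ} (hf : InjOn f (ball 0 2)) {L : ℂ →L[ℝ] ℂ}
    (hL : ∀ z, z ≠ 0 → L z ≠ 0) {s : ℝ} (hs : s ∈ Icc (0 : ℝ) 1) {z : ℂ} (hz : ‖z‖ ≤ 1)
    (hz0 : z ≠ 0) : symmQuot f L s z ≠ 0 := by
  unfold symmQuot
  split_ifs with h
  · exact hL z hz0
  · have h1 := mul_mem_ball_two hs hz
    have hs0 : (s : ℂ) ≠ 0 := Complex.ofReal_ne_zero.2 h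
    refine mul_ne_zero (inv_ne_zero (mul_ne_zero two_ne_zero hs0)) (sub_ne_zero.2 fun h2 => ?_)
    have h3 := hf h1 (neg_mem_ball_two h1) h2
    have h4 : (2 : ℂ) * (s * z) = 0 := by linear_combination h3
    simp [hs0, hz0] at h4

/-- The symmetric difference quotient is continuous up to `s = 0`, by strict differentiability. -/
theorem continuous_symmQuot {Z : Type*} [TopologicalSpace Z] {f : ℂ → ℂ}
    (hf : ContinuousOn f (ball 0 2)) {L : ℂ →L[ℝ] ℂ} (hL : HasStrictFDerivAt f L 0) {e : Z → ℂ}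
    (he : Continuous e) (he1 : ∀ z, ‖e z‖ ≤ 1) :
    Continuous fun p : I × Z => symmQuot f L p.1 (e p.2) := by
  refine continuous_iff_continuousAt.2 fun ⟨s, z⟩ => ?_
  have hse : Continuous fun p : I × Z => ((p.1 : ℝ) * e p.2 : ℂ) := by fun_prop
  by_cases hs : (s : ℝ) = 0
  · have hlin : Continuous fun p : I × Z => L (e p.2) := by fun_prop
    have key : Filter.Tendsto (fun p : I × Z => symmQuot f L p.1 (e p.2) - L (e p.2))
        (𝓝 (s, z)) (𝓝 0) := by
      rw [Metric.tendsto_nhds]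
      intro ε hε
      have h0 : Filter.Tendsto
          (fun p : I × Z => (((p.1 : ℝ) * e p.2 : ℂ), -((p.1 : ℝ) * e p.2 : ℂ)))
          (𝓝 (s, z)) (𝓝 ((0 : ℂ), (0 : ℂ))) := by
        have := (hse.prodMk hse.neg).tendsto (s, z)
        simpa [hs] using this
      have h1 := h0.eventually (hL.isLittleO.def (half_pos hε))
      filter_upwards [h1] with p hp
      rw [dist_zero_right]
      unfold symmQuot
      split_ifs with hp0
      · simpa using hε
      · have hpos : 0 < (p.1 : ℝ) := lt_of_le_of_ne p.1.2.1 (Ne.symm hp0)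
        have hpc : (p.1 : ℂ) ≠ 0 := Complex.ofReal_ne_zero.2 hp0
        set w : ℂ := (p.1 : ℝ) * e p.2 with hw
        have e1 : w - -w = (2 * (p.1 : ℝ) : ℝ) • e p.2 := by
          rw [hw, Complex.real_smul]
          push_cast
          ring
        rw [e1, map_smul] at hp
        have e2 : (2 * (p.1 : ℝ) : ℂ)⁻¹ * (f w - f (-w)) - L (e p.2) =
            (2 * (p.1 : ℝ) : ℂ)⁻¹ * (f w - f (-w) - (2 * (p.1 : ℝ) : ℝ) • L (e p.2)) := by
          rw [Complex.real_smul]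
          push_cast
          field_simp
        rw [e2, norm_mul, norm_inv]
        have e3 : ‖(2 * (p.1 : ℝ) : ℂ)‖ = 2 * (p.1 : ℝ) := by
          rw [← Complex.ofReal_ofNat, ← Complex.ofReal_mul, Complex.norm_real,
            Real.norm_of_nonneg (by positivity)]
        rw [norm_smul, Real.norm_of_nonneg (by positivity)] at hp
        rw [e3, inv_mul_lt_iff₀ (by positivity)]
        refine hp.trans_lt ?_
        have h5 : ‖e p.2‖ ≤ 1 := he1 p.2
        have h6 : 2 * (p.1 : ℝ) * ‖e p.2‖ ≤ 2 * (p.1 : ℝ) * 1 := by gcongr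
        nlinarith
    have h2 := key.add (hlin.tendsto (s, z))
    rw [zero_add] at h2
    have h3 : symmQuot f L s (e z) = L (e z) := if_pos hs
    change Filter.Tendsto _ _ (𝓝 (symmQuot f L s (e z)))
    rw [h3]
    exact h2.congr fun p => by ring
  · have hev : ∀ᶠ p : I × Z in 𝓝 (s, z), (p.1 : ℝ) ≠ 0 :=
      (by fun_prop : Continuous fun p : I × Z => (p.1 : ℝ)).continuousAt.eventually_ne hs
    have h1 := mul_mem_ball_two s.2 (he1 z)
    have h2 : ContinuousAt (fun p : I × Z => f ((p.1 : ℝ) * e p.2)) (s, z) :=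
      ContinuousAt.comp (g := f) (f := fun p : I × Z => ((p.1 : ℝ) * e p.2 : ℂ))
        (hf.continuousAt (isOpen_ball.mem_nhds h1)) hse.continuousAt
    have h3 : ContinuousAt (fun p : I × Z => f (-((p.1 : ℝ) * e p.2))) (s, z) :=
      ContinuousAt.comp (g := f) (f := fun p : I × Z => (-((p.1 : ℝ) * e p.2) : ℂ))
        (hf.continuousAt (isOpen_ball.mem_nhds (neg_mem_ball_two h1))) hse.neg.continuousAt
    have h4 : ContinuousAt (fun p : I × Z => (2 * (p.1 : ℝ) : ℂ)⁻¹) (s, z) :=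
      ContinuousAt.inv₀ (by fun_prop) (mul_ne_zero two_ne_zero (Complex.ofReal_ne_zero.2 hs))
    refine (h4.mul (h2.sub h3)).congr ?_
    filter_upwards [hev] with p hp
    exact (if_neg hp).symm

section NormalizedChart

variable {e : I → ℂ} (he : Continuous e) (he1 : ∀ t, ‖e t‖ = 1) (h0 : e 0 = 1)
  (hend : e 1 = 1 ∨ e 1 = -1)

include he he1 h0 hend

/-- Let `f` embed the disk of radius `2` such that `[-1, 1]` is mapped to the real axis, with
`± 1` fixed, and let `ρ` be a point off the image, off the real axis and off the closed unit disk.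
A motion `(-e, e)` of two opposite points on the unit circle, taken by `f`, is homotopic to itself
in the complement of `ρ`. The unit circle is first flattened, so that its image comes close to the
real axis; there the heights can be made so small that what follows does not meet `ρ`: the midpoint
is moved to `0`, and the difference vector is moved through normalised symmetric difference
quotients to a linear motion, which turns in the positive sense as `f` preserves the
orientation. -/
theorem confHomotopic_of_normalized {f : ℂ → ℂ} (hf : ContinuousOn f (ball 0 2))
    (hinj : InjOn f (ball 0 2)) {L : ℂ →L[ℝ] ℂ} (hL : HasStrictFDerivAt f L 0)
    (hdet : 0 < (L Complex.I / L 1).im) (hreal : ∀ x : ℝ, |x| ≤ 1 → (f x).im = 0)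
    (hf1 : f 1 = 1) (hf1' : f (-1) = -1) {ρ : ℂ} (hρ : ρ ∉ f '' ball 0 2) (hρim : ρ.im ≠ 0)
    (hρn : 1 < ‖ρ‖) :
    ConfHomotopic (fun t => ![f (-e t), f (e t), ρ]) (fun t => ![-e t, e t, ρ]) := by
  have hρpos : 0 < |ρ.im| := abs_pos.2 hρim
  have he0 : ∀ t, e t ≠ 0 := fun t h => by simpa [h] using he1 t
  have him0 : (e 0).im = 0 := by simp [h0]
  have him1 : (e 1).im = 0 := by rcases hend with h | h <;> simp [h]
  have hL1 : L 1 ≠ 0 := fun h => by simp [h] at hdet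
  have hLz : ∀ z : ℂ, L z = L 1 * (z.re + z.im * (L Complex.I / L 1)) := by
    intro z
    have : z = z.re • (1 : ℂ) + z.im • Complex.I := by
      simp [Complex.real_smul, Complex.re_add_im]
    conv_lhs => rw [this, map_add, map_smul, map_smul]
    rw [Complex.real_smul, Complex.real_smul]
    field_simp
  have hL0 : ∀ z, z ≠ 0 → L z ≠ 0 := by
    intro z hz h
    rw [hLz] at h
    have h1 := (mul_eq_zero.1 h).resolve_left hL1
    have h2 := congrArg Complex.im h1
    have h3 := congrArg Complex.re h1
    simp [hdet.ne'] at h2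
    simp [h2] at h3
    exact hz (Complex.ext h3 h2)
  -- the flattened circle `ellipse δ (e t)` is mapped close to the real axis
  have hEn : ∀ {k : ℝ}, 0 ≤ k → k ≤ 1 → ∀ t, ‖ellipse k (e t)‖ ≤ 1 := fun hk hk' t =>
    (norm_ellipse_le hk hk' _).trans_eq (he1 t)
  have hEb : ∀ {k : ℝ}, 0 ≤ k → k ≤ 1 → ∀ t, ellipse k (e t) ∈ ball (0 : ℂ) 2 := by
    intro k hk hk' t
    rw [mem_ball_zero_iff]
    linarith [hEn hk hk' t]
  have hEc : Continuous fun p : I × I => ellipse p.1 (e p.2) :=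
    continuous_ellipse.comp (f := fun p : I × I => ((p.1 : ℝ), e p.2)) (by fun_prop)
  have hfE : Continuous fun p : I × I => f (ellipse p.1 (e p.2)) :=
    hf.comp_continuous hEc fun p => hEb p.1.2.1 p.1.2.2 p.2
  have hfE' : Continuous fun p : I × I => f (-ellipse p.1 (e p.2)) :=
    hf.comp_continuous hEc.neg fun p => neg_mem_ball_two (hEb p.1.2.1 p.1.2.2 p.2)
  obtain ⟨δ, hδ0, hδ1, hδ⟩ : ∃ δ : ℝ, 0 < δ ∧ δ ≤ 1 ∧ ∀ t,
      |(f (ellipse δ (e t))).im| < |ρ.im| / 2 ∧ |(f (-ellipse δ (e t))).im| < |ρ.im| / 2 := by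
    obtain ⟨η, hη, hu⟩ := Metric.uniformContinuous_iff.1
      (CompactSpace.uniformContinuous_of_continuous (hfE.prodMk hfE')) (|ρ.im| / 2) (by positivity)
    refine ⟨min (η / 2) 1, by positivity, min_le_right _ _, fun t => ?_⟩
    have hm : min (η / 2) 1 ∈ Icc (0 : ℝ) 1 := ⟨by positivity, min_le_right _ _⟩
    have h1 := @hu (⟨min (η / 2) 1, hm⟩, t) (0, t) (by
      rw [Prod.dist_eq, dist_self, max_eq_left dist_nonneg, Subtype.dist_eq, Real.dist_eq]
      simp only [Icc.coe_zero, sub_zero]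
      rw [abs_of_nonneg hm.1]
      linarith [min_le_left (η / 2) 1])
    rw [Prod.dist_eq, max_lt_iff, dist_eq_norm, dist_eq_norm] at h1
    have hre : |(e t).re| ≤ 1 := (Complex.abs_re_le_norm _).trans_eq (he1 t)
    have h2 : ellipse 0 (e t) = ((e t).re : ℝ) := by simp [ellipse]
    have h3 : (f (ellipse 0 (e t))).im = 0 := by rw [h2]; exact hreal _ hre
    have h4 : (f (-ellipse 0 (e t))).im = 0 := by
      rw [h2, ← Complex.ofReal_neg]
      exact hreal _ (by rwa [abs_neg])
    constructor
    · have := (Complex.abs_im_le_norm _).trans_lt h1.1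
      simpa [h3] using this
    · have := (Complex.abs_im_le_norm _).trans_lt h1.2
      simpa [h4] using this
  set E : I → ℂ := fun t => ellipse δ (e t) with hE
  have hEcont : Continuous E :=
    continuous_ellipse.comp (f := fun t : I => (δ, e t)) (by fun_prop)
  have hE0 : ∀ t, E t ≠ 0 := fun t => ellipse_ne_zero hδ0.ne' (he0 t)
  have hE1 : ∀ t, ‖E t‖ ≤ 1 := hEn hδ0.le hδ1
  have hEl : E 0 = 1 := by rw [hE]; simp only; rw [ellipse_of_im_eq_zero _ him0, h0]
  have hEr : E 1 = e 1 := ellipse_of_im_eq_zero _ him1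
  have stage1 : ConfHomotopic (fun t => ![f (-e t), f (e t), ρ])
      (fun t => ![f (-E t), f (E t), ρ]) := by
    have hk : ∀ s : I, 0 < 1 - (s : ℝ) * (1 - δ) ∧ 1 - (s : ℝ) * (1 - δ) ≤ 1 := by
      intro s
      have h1 := s.2.1
      have h2 := s.2.2
      constructor <;> nlinarith
    have hc : Continuous fun p : I × I => ellipse (1 - (p.1 : ℝ) * (1 - δ)) (e p.2) :=
      continuous_ellipse.comp (f := fun p : I × I => (1 - (p.1 : ℝ) * (1 - δ), e p.2))
        (by fun_prop)
    have hb := fun p : I × I => hEb (hk p.1).1.le (hk p.1).2 p.2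
    have := ConfHomotopic.pair (ρ := ρ)
      (A := fun p : I × I => f (-ellipse (1 - (p.1 : ℝ) * (1 - δ)) (e p.2)))
      (B := fun p : I × I => f (ellipse (1 - (p.1 : ℝ) * (1 - δ)) (e p.2)))
      (hf.comp_continuous hc.neg fun p => neg_mem_ball_two (hb p))
      (hf.comp_continuous hc hb)
      (fun p h => by
        have h1 := hinj (neg_mem_ball_two (hb p)) (hb p) h
        exact ellipse_ne_zero (hk p.1).1.ne' (he0 p.2) (self_eq_neg.1 h1.symm))
      (fun p h => hρ ⟨_, neg_mem_ball_two (hb p), h⟩) (fun p h => hρ ⟨_, hb p, h⟩)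
      (fun s => by simp only [ellipse_of_im_eq_zero _ him0])
      (fun s => by simp only [ellipse_of_im_eq_zero _ him0])
      (fun s => by simp only [ellipse_of_im_eq_zero _ him1])
      (fun s => by simp only [ellipse_of_im_eq_zero _ him1])
    simpa [ellipse_one, hE] using this
  -- normalised symmetric difference quotients
  set D : I × I → ℂ := fun p => symmQuot f L p.1 (E p.2) / symmQuot f L p.1 1 with hD
  have hQ1 : ∀ s : I, symmQuot f L s 1 ≠ 0 := fun s =>
    symmQuot_ne_zero hinj hL0 s.2 (by simp) one_ne_zero
  have hDc : Continuous D := by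
    refine (continuous_symmQuot hf hL hEcont hE1).div ?_ fun p => hQ1 p.1
    exact (continuous_symmQuot hf hL (Z := I) (e := fun _ => 1) continuous_const (by simp)).comp
      (f := fun p : I × I => (p.1, p.2)) (by fun_prop)
  have hD0 : ∀ p, D p ≠ 0 := fun p =>
    div_ne_zero (symmQuot_ne_zero hinj hL0 p.1.2 (hE1 _) (hE0 _)) (hQ1 _)
  have hDl : ∀ s, D (s, 0) = 1 := fun s => by
    simp only [hD, hEl]
    exact div_self (hQ1 s)
  have hDr : ∀ s, D (s, 1) = e 1 := fun s => by
    simp only [hD, hEr]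
    rcases hend with h | h
    · rw [h, div_self (hQ1 s)]
    · rw [h, symmQuot_neg, neg_div, div_self (hQ1 s)]
  have hD1 : ∀ t, D (1, t) = (f (E t) - f (-E t)) / 2 := fun t => by
    simp only [hD, Icc.coe_one, symmQuot_one, hf1, hf1']
    norm_num
  set b := L Complex.I / L 1 with hb
  have hDzero : ∀ t, D (0, t) = (e t).re + δ * (e t).im * b := fun t => by
    have h1 : ∀ z, symmQuot f L (0 : I) z = L z := fun z => if_pos rfl
    simp only [hD, h1]
    rw [hLz (E t), mul_div_cancel_left₀ _ hL1, hE]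
    simp only [ellipse_re, ellipse_im]
    push_cast
    ring
  -- heights are scaled by `κ`, which makes them smaller than that of `ρ`
  obtain ⟨κ, hκ0, hκ1, hκD, hκb, hκb1⟩ : ∃ κ : ℝ, 0 < κ ∧ κ ≤ 1 ∧ (∀ p, κ * |(D p).im| < |ρ.im|) ∧
      κ * (δ * b.im) < |ρ.im| ∧ κ * (δ * b.im) < 1 := by
    obtain ⟨B, hB⟩ := isCompact_univ.exists_bound_of_continuousOn
      (f := fun p => D p) hDc.continuousOn
    have hB0 : 0 ≤ B := (norm_nonneg _).trans (hB 0 (mem_univ _))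
    have hbp : 0 < δ * b.im := mul_pos hδ0 hdet
    set B' := 1 + B + δ * b.im
    have hB' : 0 < B' := by positivity
    have hκ0 : 0 < min 1 |ρ.im| / B' := by positivity
    have hκB : min 1 |ρ.im| / B' * B' = min 1 |ρ.im| := div_mul_cancel₀ _ hB'.ne'
    refine ⟨min 1 |ρ.im| / B', hκ0, ?_, fun p => ?_, ?_, ?_⟩
    · rw [div_le_one hB']
      exact (min_le_left _ _).trans (by simp only [B']; linarith)
    · refine lt_of_lt_of_le (mul_lt_mul_of_pos_left ?_ hκ0) (hκB.trans_le (min_le_right _ _))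
      have := (Complex.abs_im_le_norm _).trans (hB p (mem_univ _))
      simp only [B']
      linarith
    · refine lt_of_lt_of_le (mul_lt_mul_of_pos_left ?_ hκ0) (hκB.trans_le (min_le_right _ _))
      simp only [B']
      linarith
    · refine lt_of_lt_of_le (mul_lt_mul_of_pos_left ?_ hκ0) (hκB.trans_le (min_le_left _ _))
      simp only [B']
      linarith
  have stage2 : ConfHomotopic (fun t => ![f (-E t), f (E t), ρ])
      (fun t => ![-ellipse κ (D (1, t)), ellipse κ (D (1, t)), ρ]) := by
    have hk : ∀ s : I, 0 < 1 - (s : ℝ) * (1 - κ) ∧ 1 - (s : ℝ) * (1 - κ) ≤ 1 := by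
      intro s
      have h1 := s.2.1
      have h2 := s.2.2
      constructor <;> nlinarith
    set M : I → ℂ := fun t => (f (E t) + f (-E t)) / 2 with hM
    have hMc : Continuous M :=
      ((hf.comp_continuous hEcont fun t => hEb hδ0.le hδ1 t).add
        (hf.comp_continuous hEcont.neg fun t => neg_mem_ball_two (hEb hδ0.le hδ1 t))).div_const 2
    have hMl : M 0 = 0 := by simp [hM, hEl, hf1, hf1']
    have hMr : M 1 = 0 := by
      rcases hend with h | h <;> simp [hM, hEr, h, hf1, hf1']
    have hdl : (D (1, 0)).im = 0 := by simp [hDl]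
    have hdr : (D (1, 1)).im = 0 := by simp [hDr, him1]
    have hMD : ∀ t, |(M t).im| + |(D (1, t)).im| < |ρ.im| := by
      intro t
      have h1 := abs_lt.1 (hδ t).1
      have h2 := abs_lt.1 (hδ t).2
      have e1 : (M t).im = ((f (E t)).im + (f (-E t)).im) / 2 := by simp [hM]
      have e2 : (D (1, t)).im = ((f (E t)).im - (f (-E t)).im) / 2 := by simp [hD1]
      rw [e1, e2]
      rcases abs_cases (((f (E t)).im + (f (-E t)).im) / 2) with h3 | h3 <;>
      rcases abs_cases (((f (E t)).im - (f (-E t)).im) / 2) with h4 | h4 <;>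
      rw [h3.1, h4.1] <;> simp only [hE] <;> linarith
    have hne : ∀ (p : I × I) (ε : ℝ), |ε| = 1 →
        ellipse (1 - (p.1 : ℝ) * (1 - κ)) ((1 - (p.1 : ℝ)) * M p.2 + ε * D (1, p.2)) ≠ ρ := by
      intro p ε hε
      apply ne_of_abs_im_lt
      rw [ellipse_im, abs_mul, abs_of_pos (hk p.1).1]
      refine (mul_le_of_le_one_left (abs_nonneg _) (hk p.1).2).trans_lt ?_
      refine lt_of_le_of_lt ?_ (hMD p.2)
      have e3 : ((1 - (p.1 : ℝ)) * M p.2 + ε * D (1, p.2) : ℂ).im =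
          (1 - (p.1 : ℝ)) * (M p.2).im + ε * (D (1, p.2)).im := by
        rw [← Complex.ofReal_one, ← Complex.ofReal_sub, Complex.add_im, Complex.im_ofReal_mul,
          Complex.im_ofReal_mul]
      rw [e3]
      refine (abs_add_le _ _).trans ?_
      rw [abs_mul, abs_mul, hε, one_mul]
      have : |1 - (p.1 : ℝ)| ≤ 1 := by
        rw [abs_le]
        constructor <;> linarith [p.1.2.1, p.1.2.2]
      have := mul_le_of_le_one_left (abs_nonneg (M p.2).im) this
      linarith
    have hsplit : ∀ (k : ℝ) (z w : ℂ), ellipse k (z + w) = ellipse k z + ellipse k w := by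
      intro k z w
      apply Complex.ext <;> simp [ellipse_re, ellipse_im, mul_add]
    have := ConfHomotopic.symmPair (ρ := ρ)
      (M := fun p : I × I => ellipse (1 - (p.1 : ℝ) * (1 - κ)) ((1 - (p.1 : ℝ)) * M p.2))
      (Δ := fun p : I × I => ellipse (1 - (p.1 : ℝ) * (1 - κ)) (D (1, p.2)))
      (continuous_ellipse.comp (f := fun p : I × I =>
        (1 - (p.1 : ℝ) * (1 - κ), (1 - (p.1 : ℝ)) * M p.2)) (by fun_prop))
      (continuous_ellipse.comp (f := fun p : I × I =>
        (1 - (p.1 : ℝ) * (1 - κ), D (1, p.2))) (by fun_prop))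
      (fun p => ellipse_ne_zero (hk p.1).1.ne' (hD0 _))
      (fun p => by
        have := hne p (-1) (by simp)
        rwa [hsplit, Complex.ofReal_neg, Complex.ofReal_one, neg_one_mul, ellipse_neg,
          ← sub_eq_add_neg] at this)
      (fun p => by
        have := hne p 1 (by simp)
        rwa [hsplit, Complex.ofReal_one, one_mul] at this)
      (fun s => by simp [hMl, ellipse])
      (fun s => by simp only [ellipse_of_im_eq_zero _ hdl])
      (fun s => by simp [hMr, ellipse])
      (fun s => by simp only [ellipse_of_im_eq_zero _ hdr])
    convert this using 1
    · funext t
      simp only [Icc.coe_zero, zero_mul, sub_zero, ellipse_one, Complex.ofReal_zero, one_mul, hD1,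
        hM]
      congr 1
      · ring
      · congr 1
        ring
    · funext t
      simp [ellipse]
  have stage3 : ConfHomotopic (fun t => ![-ellipse κ (D (1, t)), ellipse κ (D (1, t)), ρ])
      (fun t => ![-ellipse κ (D (0, t)), ellipse κ (D (0, t)), ρ]) := by
    have hne : ∀ p, |(ellipse κ (D p)).im| < |ρ.im| := by
      intro p
      rw [ellipse_im, abs_mul, abs_of_pos hκ0]
      exact hκD p
    have := ConfHomotopic.symmPair (ρ := ρ) (M := fun _ => 0)
      (Δ := fun p : I × I => ellipse κ (D (unitInterval.symm p.1, p.2))) continuous_const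
      (continuous_ellipse.comp (f := fun p : I × I => (κ, D (unitInterval.symm p.1, p.2)))
        (by fun_prop))
      (fun p => ellipse_ne_zero hκ0.ne' (hD0 _))
      (fun p => ne_of_abs_im_lt (by simpa using hne _))
      (fun p => ne_of_abs_im_lt (by simpa using hne _))
      (fun s => rfl) (fun s => by simp [hDl]) (fun s => rfl) (fun s => by simp [hDr])
    simpa using this
  set κ' : ℝ := κ * (δ * b.im) with hκ'
  have hκ'0 : 0 < κ' := mul_pos hκ0 (mul_pos hδ0 hdet)
  have hime : ∀ t, |(e t).im| ≤ 1 := fun t => (Complex.abs_im_le_norm _).trans_eq (he1 t)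
  have stage4 : ConfHomotopic (fun t => ![-ellipse κ (D (0, t)), ellipse κ (D (0, t)), ρ])
      (fun t => ![-ellipse κ' (e t), ellipse κ' (e t), ρ]) := by
    set Δ : I × I → ℂ := fun p =>
      ellipse κ' (e p.2) + ((1 - (p.1 : ℝ)) * (δ * (e p.2).im * b.re) : ℝ) with hΔ
    have him : ∀ p, (Δ p).im = κ' * (e p.2).im := fun p => by
      simp only [hΔ, Complex.add_im, ellipse_im, Complex.ofReal_im, add_zero]
    have hre : ∀ p, (Δ p).re = (e p.2).re + (1 - (p.1 : ℝ)) * (δ * (e p.2).im * b.re) :=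
      fun p => by simp only [hΔ, Complex.add_re, ellipse_re, Complex.ofReal_re]
    have hlt : ∀ p, |(Δ p).im| < |ρ.im| := fun p => by
      rw [him, abs_mul, abs_of_pos hκ'0]
      exact (mul_le_of_le_one_right hκ'0.le (hime _)).trans_lt hκb
    have := ConfHomotopic.symmPair (ρ := ρ) (M := fun _ => 0) (Δ := Δ) continuous_const
      ((continuous_ellipse.comp (f := fun p : I × I => (κ', e p.2)) (by fun_prop)).add
        (by fun_prop))
      (fun p h => by
        have h1 := congrArg Complex.im h
        have h2 := congrArg Complex.re h
        rw [him, Complex.zero_im, mul_eq_zero] at h1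
        have h3 := h1.resolve_left hκ'0.ne'
        rw [hre, h3] at h2
        exact he0 p.2 (Complex.ext (by simpa using h2) h3))
      (fun p => ne_of_abs_im_lt (by simpa using hlt p))
      (fun p => ne_of_abs_im_lt (by simpa using hlt p))
      (fun s => rfl) (fun s => by simp [hΔ, him0]) (fun s => rfl)
      (fun s => by simp [hΔ, him1])
    have hs0 : ∀ t, Δ (0, t) = ellipse κ (D (0, t)) := by
      intro t
      apply Complex.ext
      · rw [hre, ellipse_re, hDzero]
        simp
      · rw [him, ellipse_im, hDzero]
        simp [hκ']
        ring
    have hs1 : ∀ t, Δ (1, t) = ellipse κ' (e t) := by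
      intro t
      simp [hΔ]
    simpa only [zero_sub, zero_add, hs0, hs1] using this
  have stage5 : ConfHomotopic (fun t => ![-ellipse κ' (e t), ellipse κ' (e t), ρ])
      (fun t => ![-e t, e t, ρ]) := by
    have hk : ∀ s : I, 0 < κ' + (s : ℝ) * (1 - κ') ∧ κ' + (s : ℝ) * (1 - κ') ≤ 1 := by
      intro s
      have h1 := s.2.1
      have h2 := s.2.2
      constructor <;> nlinarith
    have hlt : ∀ p : I × I, ‖ellipse (κ' + (p.1 : ℝ) * (1 - κ')) (e p.2)‖ < ‖ρ‖ := fun p =>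
      (hEn (hk p.1).1.le (hk p.1).2 p.2).trans_lt hρn
    have := ConfHomotopic.symmPair (ρ := ρ) (M := fun _ => 0)
      (Δ := fun p : I × I => ellipse (κ' + (p.1 : ℝ) * (1 - κ')) (e p.2)) continuous_const
      (continuous_ellipse.comp (f := fun p : I × I => (κ' + (p.1 : ℝ) * (1 - κ'), e p.2))
        (by fun_prop))
      (fun p => ellipse_ne_zero (hk p.1).1.ne' (he0 _))
      (fun p => ne_of_norm_lt (by simpa using hlt p))
      (fun p => ne_of_norm_lt (by simpa using hlt p))
      (fun s => rfl) (fun s => by simp only [ellipse_of_im_eq_zero _ him0]) (fun s => rfl)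
      (fun s => by simp only [ellipse_of_im_eq_zero _ him1])
    simpa [ellipse_one] using this
  exact (((stage1.trans stage2).trans stage3).trans stage4).trans stage5

end NormalizedChart

/-! ### Half-twists along a segment -/

theorem ConfHomotopic.symm {ι : Type*} {γ γ' : I → ι → ℂ} (h : ConfHomotopic γ γ') :
    ConfHomotopic γ' γ := by
  obtain ⟨G, hG, hinj, hG0, hG1, hGl, hGr⟩ := h
  refine ⟨fun p => G (unitInterval.symm p.1, p.2), by fun_prop, fun p => hinj _, ?_, ?_, ?_, ?_⟩
  · intro t
    simp [hG1]
  · intro t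
    simp [hG0]
  · intro s
    simp only [hGl, ← hG1]
  · intro s
    simp only [hGr, ← hG1]

section Realizes

variable {ι : Type*} {c : ℂ} {R : ℝ}

/-- The homeomorphism `f` of the disk is carried by a motion that is homotopic to `τ` in the
plane. The motion `τ` itself need not stay in the disk. -/
def Realizes (τ : I → ι → ℂ) (f : closedBall c R ≃ₜ closedBall c R) : Prop :=
  ∃ γ : I → ι → ℂ, (∀ t i, γ t i ∈ ball c R) ∧ Carries (boundaryFix c R) γ f ∧ ConfHomotopic γ τ

theorem Realizes.of_confHomotopic {τ τ' : I → ι → ℂ} {f : closedBall c R ≃ₜ closedBall c R}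
    (hf : Realizes τ f) (h : ConfHomotopic τ τ') : Realizes τ' f := by
  obtain ⟨γ, hγ, hc, hh⟩ := hf
  exact ⟨γ, hγ, hc, hh.trans h⟩

theorem Realizes.relabel {τ : I → ι → ℂ} {f : closedBall c R ≃ₜ closedBall c R}
    (hf : Realizes τ f) (e : ι ≃ ι) : Realizes (fun t => τ t ∘ e) f := by
  obtain ⟨γ, hγ, ⟨Ψ, hΨ, hΨ1⟩, G, hG, hinj, hG0, hG1, hGl, hGr⟩ := hf
  refine ⟨fun t => γ t ∘ e, fun t i => hγ t _, ⟨Ψ, ⟨hΨ.continuous, hΨ.zero, hΨ.mem,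
    fun t i y hy => hΨ.apply t (e i) y hy⟩, hΨ1⟩, fun p => G p ∘ e, ?_, ?_, ?_, ?_, ?_, ?_⟩
  · exact continuous_pi fun i => (continuous_apply (e i)).comp hG
  · exact fun p => (hinj p).comp e.injective
  all_goals intro t; simp only [*]

/-- Two diffeomorphisms that realize the same motion in the plane represent the same braid. -/
theorem toBraid_eq_of_realizes [Fintype ι] (hR : 0 < R) {K : Set ℂ} {τ : I → ι → ℂ}
    (hK : K = range (τ 0)) {f g : braidDiffeo c R K}
    (hf : Realizes τ (f : closedBall c R ≃ₜ closedBall c R))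
    (hg : Realizes τ (g : closedBall c R ≃ₜ closedBall c R)) : toBraid f = toBraid g := by
  obtain ⟨γ, hγ, hc, hh⟩ := hf
  obtain ⟨γ', hγ', hc', hh'⟩ := hg
  refine toBraid_eq_of_carries ?_ (hc.of_confHomotopic hR diskDiffeo_le_boundaryFix
    (hh.trans hh'.symm) hγ hγ') hc'
  obtain ⟨G, -, -, -, hG1, hGl, -⟩ := hh'
  rw [hK, ← hG1, hGl]

end Realizes

theorem mem_segment_iff_real {p q y : ℂ} :
    y ∈ segment ℝ p q ↔ ∃ x : ℝ, |x| ≤ 1 ∧ y = (p + q) / 2 + (q - p) / 2 * x := by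
  rw [segment_eq_image_lineMap]
  constructor
  · rintro ⟨s, ⟨hs0, hs1⟩, rfl⟩
    refine ⟨2 * s - 1, abs_le.2 ⟨by linarith, by linarith⟩, ?_⟩
    rw [AffineMap.lineMap_apply_module', Complex.real_smul]
    push_cast
    ring
  · rintro ⟨x, hx, rfl⟩
    rw [abs_le] at hx
    refine ⟨(x + 1) / 2, ⟨by linarith, by linarith⟩, ?_⟩
    rw [AffineMap.lineMap_apply_module', Complex.real_smul]
    push_cast
    ring

theorem mem_segment_neg_one_one {z : ℂ} :
    z ∈ segment ℝ (-1 : ℂ) 1 ↔ ∃ x : ℝ, |x| ≤ 1 ∧ z = x := by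
  rw [mem_segment_iff_real]
  norm_num

/-- The configuration in which `p` and `q` are turned by the angle `θ` around their midpoint. -/
def turn (p q r : ℂ) (θ : ℝ) : Fin 3 → ℂ :=
  ![(p + q) / 2 - (q - p) / 2 * Complex.exp (θ * Complex.I),
    (p + q) / 2 + (q - p) / 2 * Complex.exp (θ * Complex.I), r]

theorem range_vec3 (a b r : ℂ) : range ![a, b, r] = {a, b, r} := by
  ext y
  simp [Matrix.range_cons]
  tauto

theorem turn_zero (p q r : ℂ) : turn p q r 0 = ![p, q, r] := by
  simp only [turn, Complex.ofReal_zero, zero_mul, Complex.exp_zero, mul_one]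
  congr 1
  · ring
  · congr 1
    ring

/-- The point `r` lies off the line through `p` and `q` and off the closed disk with diameter
`[p, q]`. -/
structure IsApex (p q r : ℂ) : Prop where
  im_ne : ((r - (p + q) / 2) / ((q - p) / 2)).im ≠ 0
  lt_norm : 1 < ‖(r - (p + q) / 2) / ((q - p) / 2)‖

theorem IsApex.ne {p q r : ℂ} (h : IsApex p q r) : (q - p) / 2 ≠ 0 := fun h0 => by
  have := h.im_ne
  simp [h0] at this

theorem IsApex.swap {p q r : ℂ} (h : IsApex p q r) : IsApex q p r := by
  have e : (r - (q + p) / 2) / ((p - q) / 2) = -((r - (p + q) / 2) / ((q - p) / 2)) := by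
    rw [← div_neg]
    congr 1
    · ring
    · ring
  exact ⟨by rw [e]; simpa using h.im_ne, by rw [e, norm_neg]; exact h.lt_norm⟩

theorem det_eq (A : ℂ →L[ℝ] ℂ) :
    A.det = (A 1).re * (A Complex.I).im - (A Complex.I).re * (A 1).im := by
  rw [ContinuousLinearMap.det, ← LinearMap.det_toMatrix Complex.basisOneI, Matrix.det_fin_two]
  simp [LinearMap.toMatrix_apply]

theorem im_div_pos_of_det_pos {A : ℂ →L[ℝ] ℂ} (h : 0 < A.det) : 0 < (A Complex.I / A 1).im := by
  rw [det_eq] at h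
  have h1 : A 1 ≠ 0 := fun h1 => by simp [h1] at h
  rw [Complex.div_im, ← sub_div]
  refine div_pos ?_ (Complex.normSq_pos.2 h1)
  linarith

theorem exp_nat_mul_pi (n : ℕ) :
    Complex.exp ((Real.pi * (n * (1 : ℝ)) : ℝ) * Complex.I) = 1 ∨
      Complex.exp ((Real.pi * (n * (1 : ℝ)) : ℝ) * Complex.I) = -1 := by
  have h : Complex.exp ((Real.pi * (n * (1 : ℝ)) : ℝ) * Complex.I) = (-1) ^ n := by
    rw [← Complex.exp_pi_mul_I, ← Complex.exp_nat_mul]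
    congr 1
    push_cast
    ring
  rw [h]
  exact neg_one_pow_eq_or ℂ n

/-- The powers of a half-twist along the segment from `p` to `q` realize the rotations of `p` and
`q` around their midpoint. -/
theorem TwistChart.realizes {c : ℂ} {R : ℝ} {φ : ℂ → ℂ} (h : TwistChart c R φ) {p q r : ℂ}
    (hp : φ (-1) = p) (hq : φ 1 = q) (hseg : φ '' segment ℝ (-1) 1 = segment ℝ p q)
    (hr : IsApex p q r) (hrD : r ∈ ball c R) (hrφ : r ∉ φ '' ball 0 2) (n : ℕ) :
    Realizes (fun t : I => turn p q r (Real.pi * (n * t))) (h.twistDisk n) := by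
  set e : I → ℂ := fun t => Complex.exp ((Real.pi * (n * t) : ℝ) * Complex.I) with he
  have he1 : ∀ t, ‖e t‖ = 1 := fun t => Complex.norm_exp_ofReal_mul_I _
  have hec : Continuous e := by fun_prop
  have he2 : ∀ t, e t ∈ ball (0 : ℂ) 2 := fun t => by
    rw [mem_ball_zero_iff, he1]
    norm_num
  set m := (p + q) / 2 with hm
  set d := (q - p) / 2 with hd
  have hd0 : d ≠ 0 := hr.ne
  refine ⟨_, ?_, (h.carries_twistDisk n hrφ).mono diskDiffeo_le_boundaryFix, ?_⟩
  · intro t i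
    fin_cases i
    · exact h.image_subset ⟨_, neg_mem_ball_two (he2 t), rfl⟩
    · exact h.image_subset ⟨_, he2 t, rfl⟩
    · exact hrD
  have hzero : (0 : ℂ) ∈ ball (0 : ℂ) 2 := mem_ball_self (by norm_num)
  have key := confHomotopic_of_normalized (e := e) (f := fun z => d⁻¹ * (φ z - m))
    (L := d⁻¹ • fderiv ℝ φ 0) (ρ := (r - m) / d) hec he1 (by simp [he])
    (by simpa [he] using exp_nat_mul_pi n)
    (continuousOn_const.mul (h.smooth.continuousOn.sub continuousOn_const))
    (fun z hz w hw hzw => h.inj hz hw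
      (sub_left_injective (mul_left_cancel₀ (inv_ne_zero hd0) hzw)))
    ((((h.contDiffAt hzero).hasStrictFDerivAt (by simp)).sub_const m).const_mul d⁻¹)
    (by
      have := im_div_pos_of_det_pos (h.det_pos 0 hzero)
      simpa [mul_div_mul_left _ _ (inv_ne_zero hd0)] using this)
    (fun x hx => by
      have h1 : φ x ∈ segment ℝ p q := by
        rw [← hseg]
        exact ⟨x, mem_segment_neg_one_one.2 ⟨x, hx, rfl⟩, rfl⟩
      obtain ⟨y, -, hy⟩ := mem_segment_iff_real.1 h1
      rw [hy, add_sub_cancel_left, inv_mul_cancel_left₀ hd0, Complex.ofReal_im])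
    (by
      rw [hq, hm, inv_mul_eq_div, div_eq_one_iff_eq hd0, hd]
      ring)
    (by
      rw [hp, hm, inv_mul_eq_div, div_eq_iff hd0, hd]
      ring)
    (by
      rintro ⟨z, hz, hzr⟩
      refine hrφ ⟨z, hz, ?_⟩
      simp only [inv_mul_eq_div] at hzr
      exact sub_left_injective ((div_left_inj' hd0).1 hzr))
    hr.im_ne hr.lt_norm
  have hg : Function.Injective fun z : ℂ => m + d * z := fun z w hzw =>
    mul_left_cancel₀ hd0 (add_left_cancel hzw)
  have key2 := key.map (by fun_prop) hg
  convert key2 using 1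
  · funext t i
    fin_cases i
    · simp [hd0, he]
    · simp [hd0, he]
    · simp [mul_div_cancel₀ _ hd0]
  · funext t i
    fin_cases i
    · simp [turn, he, sub_eq_add_neg, hm, hd]
    · simp [turn, he, hm, hd]
    · simp [turn, mul_div_cancel₀ _ hd0]

/-- A half-twist comes from a chart. -/
theorem IsHalfTwist.exists_chart {c : ℂ} {R : ℝ} {K arc : Set ℂ}
    {h : closedBall c R ≃ₜ closedBall c R} (hh : IsHalfTwist K arc h) :
    ∃ (φ : ℂ → ℂ) (H : TwistChart c R φ), h = H.twistDisk 1 ∧ φ '' segment ℝ (-1) 1 = arc ∧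
      φ '' ball 0 2 ∩ K = {φ (-1), φ 1} := by
  obtain ⟨φ, h1, h2, h3, h4, h5, h6, h7, h8⟩ := hh
  refine ⟨φ, ⟨h1, h2, h3, h4⟩, ?_, h5, h6⟩
  ext y
  rw [TwistChart.coe_twistDisk]
  by_cases hy : (y : ℂ) ∈ φ '' ball 0 2
  · obtain ⟨z, hz, hzy⟩ := hy
    rw [h7 y z hz hzy.symm, ← hzy, TwistChart.twistFun_apply _ _ hz, twist_one]
  · rw [TwistChart.twistFun_of_notMem _ _ hy, h8 y hy]

theorem TwistChart.isHalfTwist {c : ℂ} {R : ℝ} {K arc : Set ℂ} {φ : ℂ → ℂ}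
    (H : TwistChart c R φ) (harc : φ '' segment ℝ (-1) 1 = arc)
    (hK : φ '' ball 0 2 ∩ K = {φ (-1), φ 1}) : IsHalfTwist K arc (H.twistDisk 1) := by
  refine ⟨φ, H.smooth, H.inj, H.det_pos, H.image_subset, harc, hK, ?_, ?_⟩
  · intro y z hz hy
    rw [TwistChart.coe_twistDisk, hy, H.twistFun_apply _ hz, twist_one]
  · intro y hy
    exact Subtype.ext (H.twistFun_of_notMem _ hy)

theorem IsHalfTwist.realizes {c : ℂ} {R : ℝ} {p q r : ℂ}
    {h : closedBall c R ≃ₜ closedBall c R}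
    (hh : IsHalfTwist {p, q, r} (segment ℝ p q) h) (hr : IsApex p q r) (hrD : r ∈ ball c R) :
    Realizes (fun t : I => turn p q r (Real.pi * ((1 : ℕ) * t))) h := by
  obtain ⟨φ, H, rfl, hseg, hK⟩ := hh.exists_chart
  have hsub : segment ℝ p q ⊆ φ '' ball 0 2 := by
    rw [← hseg]
    refine image_mono fun z hz => ?_
    obtain ⟨x, hx, rfl⟩ := mem_segment_neg_one_one.1 hz
    rw [mem_ball_zero_iff, Complex.norm_real, Real.norm_eq_abs]
    linarith
  have hpq : p ≠ q := fun h0 => hr.ne (by simp [h0])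
  have hrp : r ≠ p := by
    rintro rfl
    refine hr.im_ne ?_
    rw [show r - (r + q) / 2 = -((q - r) / 2) by ring, neg_div, div_self hr.ne]
    simp
  have hrq : r ≠ q := by
    rintro rfl
    refine hr.im_ne ?_
    rw [show r - (p + r) / 2 = (r - p) / 2 by ring, div_self hr.ne]
    simp
  have hpm : p ∈ ({φ (-1), φ 1} : Set ℂ) := hK ▸ ⟨hsub (left_mem_segment ℝ p q), by simp⟩
  have hqm : q ∈ ({φ (-1), φ 1} : Set ℂ) := hK ▸ ⟨hsub (right_mem_segment ℝ p q), by simp⟩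
  have hrφ : r ∉ φ '' ball 0 2 := by
    intro hrm
    have : r ∈ ({φ (-1), φ 1} : Set ℂ) := hK ▸ ⟨hrm, by simp⟩
    simp only [mem_insert_iff, mem_singleton_iff] at this hpm hqm
    rcases this with h1 | h1 <;> rcases hpm with h2 | h2 <;> rcases hqm with h3 | h3 <;>
    simp_all
  simp only [mem_insert_iff, mem_singleton_iff] at hpm hqm
  rcases hpm with hp | hp
  · rcases hqm with hq | hq
    · exact absurd (hp.trans hq.symm) hpq
    · simpa using H.realizes hp.symm hq.symm hseg hr hrD hrφ 1
  · rcases hqm with hq | hq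
    · rw [segment_symm ℝ p q] at hseg
      have := (H.realizes hq.symm hp.symm hseg hr.swap hrD hrφ 1).relabel (Equiv.swap 0 1)
      convert this using 1
      · funext t i
        fin_cases i
        · simp [turn]
          ring
        · simp [turn]
          ring
        · have : Equiv.swap (0 : Fin 3) 1 2 = 2 := by decide
          simp [turn, this]
      · simp
    · exact absurd (hp.trans hq.symm) hpq

/-- A segment in the open disk has a chart whose image is a thin neighbourhood of it. The
segment `[-1, 1]` is extended by a small amount at both ends by rescaling the arctangent. -/
theorem exists_twistChart {c : ℂ} {R : ℝ} {p q r : ℂ} (hp : p ∈ ball c R) (hq : q ∈ ball c R)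
    (hr : IsApex p q r) : ∃ φ : ℂ → ℂ, TwistChart c R φ ∧ φ (-1) = p ∧ φ 1 = q ∧
      φ '' segment ℝ (-1) 1 = segment ℝ p q ∧ r ∉ φ '' ball 0 2 := by
  set m := (p + q) / 2 with hm
  set d := (q - p) / 2 with hd
  have hd0 : d ≠ 0 := hr.ne
  obtain ⟨η, hη, hV⟩ : ∃ η, 0 < η ∧ thickening η ((fun x : ℝ => (x : ℂ)) '' Icc (-1) 1) ⊆
      {w | m + d * w ∈ ball c R ∧ m + d * w ≠ r} := by
    have hcont : Continuous fun w : ℂ => m + d * w := by fun_prop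
    refine (isCompact_Icc.image Complex.continuous_ofReal).exists_thickening_subset_open
      ((isOpen_ball.preimage hcont).inter (isOpen_compl_singleton.preimage hcont)) ?_
    rintro _ ⟨x, hx, rfl⟩
    have hs : m + d * x ∈ segment ℝ p q := mem_segment_iff_real.2 ⟨x, abs_le.2 hx, rfl⟩
    refine ⟨(convex_ball c R).segment_subset hp hq hs, fun h => hr.im_ne ?_⟩
    rw [← hm, ← hd, ← (h : m + d * x = r), add_sub_cancel_left, mul_div_cancel_left₀ _ hd0,
      Complex.ofReal_im]
  -- for large `k`, the function `g` maps the line to a slightly larger interval than `[-1, 1]`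
  obtain ⟨k, hk0, hk⟩ : ∃ k : ℝ, 0 < k ∧ Real.pi / 2 < (1 + η / 2) * Real.arctan k := by
    have h1 : Filter.Tendsto (fun k => (1 + η / 2) * Real.arctan k) Filter.atTop
        (𝓝 ((1 + η / 2) * (Real.pi / 2))) :=
      ((Real.tendsto_arctan_atTop).mono_right nhdsWithin_le_nhds).const_mul _
    have h2 : Real.pi / 2 < (1 + η / 2) * (Real.pi / 2) := by nlinarith [Real.pi_pos]
    obtain ⟨k, h3, h4⟩ :=
      ((h1.eventually (lt_mem_nhds h2)).and (Filter.eventually_gt_atTop 0)).exists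
    exact ⟨k, h4, h3⟩
  have hak : 0 < Real.arctan k := Real.arctan_pos.2 hk0
  set g : ℝ → ℝ := fun x => Real.arctan (k * x) / Real.arctan k with hg
  have hg1 : g 1 = 1 := by simp [hg, hak.ne']
  have hg1' : g (-1) = -1 := by simp [hg, Real.arctan_neg, hak.ne']
  have hgmono : StrictMono g := fun x y hxy =>
    div_lt_div_of_pos_right (Real.arctan_strictMono (mul_lt_mul_of_pos_left hxy hk0)) hak
  have hgs : ContDiff ℝ ∞ g :=
    (Real.contDiff_arctan.comp (contDiff_const.mul contDiff_id)).div_const _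
  have hgd : ∀ x, HasDerivAt g (1 / (1 + (k * x) ^ 2) * (k * 1) / Real.arctan k) x := fun x =>
    (((hasDerivAt_id x).const_mul k).arctan).div_const _
  have hgb : ∀ x, |g x| < 1 + η / 2 := by
    intro x
    rw [hg, abs_div, abs_of_pos hak, div_lt_iff₀ hak]
    refine lt_trans ?_ hk
    exact abs_lt.2 ⟨Real.neg_pi_div_two_lt_arctan _, Real.arctan_lt_pi_div_two _⟩
  set ε : ℝ := η / 8 with hε
  have hε0 : 0 < ε := by positivity
  set φ : ℂ → ℂ := fun z => m + d * ((g z.re : ℂ) + (ε * z.im : ℝ) * Complex.I) with hφ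
  have hinj : Function.Injective φ := by
    intro z w hzw
    have h1 := mul_left_cancel₀ hd0 (add_left_cancel hzw)
    have h2 := congrArg Complex.re h1
    have h3 := congrArg Complex.im h1
    simp [hε0.ne'] at h2 h3
    exact Complex.ext (hgmono.injective h2) h3
  have hmem : ∀ z ∈ ball (0 : ℂ) 2, φ z ∈ ball c R ∧ φ z ≠ r := by
    intro z hz
    have hzi : |z.im| < 2 := (Complex.abs_im_le_norm z).trans_lt (mem_ball_zero_iff.1 hz)
    refine @hV ((g z.re : ℂ) + (ε * z.im : ℝ) * Complex.I) ?_
    rw [mem_thickening_iff]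
    refine ⟨_, ⟨max (-1) (min 1 (g z.re)), ⟨le_max_left _ _,
      max_le (by norm_num) (min_le_left _ _)⟩, rfl⟩, ?_⟩
    rw [dist_eq_norm, add_sub_right_comm, ← Complex.ofReal_sub]
    refine (norm_add_le _ _).trans_lt ?_
    rw [norm_mul, Complex.norm_I, mul_one, Complex.norm_real, Complex.norm_real, Real.norm_eq_abs,
      Real.norm_eq_abs]
    have h1 : |g z.re - max (-1) (min 1 (g z.re))| ≤ η / 2 := by
      have := abs_lt.1 (hgb z.re)
      rw [abs_le]
      rcases max_cases (-1) (min 1 (g z.re)) with h | h <;>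
      rcases min_cases 1 (g z.re) with h' | h' <;> constructor <;> linarith
    have h2 : |ε * z.im| ≤ η / 4 := by
      rw [abs_mul, abs_of_pos hε0]
      nlinarith
    linarith
  have hreal : ∀ x : ℝ, φ x = m + d * (g x : ℝ) := fun x => by simp [hφ]
  refine ⟨φ, ⟨?_, hinj.injOn, ?_, ?_⟩, ?_, ?_, ?_, ?_⟩
  · refine ContDiff.contDiffOn (contDiff_const.add (contDiff_const.mul (ContDiff.add ?_ ?_)))
    · exact Complex.ofRealCLM.contDiff.comp (hgs.comp Complex.reCLM.contDiff)
    · exact (Complex.ofRealCLM.contDiff.comp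
        (contDiff_const.mul Complex.imCLM.contDiff)).mul contDiff_const
  · intro z _
    have h1 : HasFDerivAt (fun z : ℂ => (g z.re : ℂ)) _ z :=
      Complex.ofRealCLM.hasFDerivAt.comp z
        ((hgd z.re).comp_hasFDerivAt z Complex.reCLM.hasFDerivAt)
    have h2 : HasFDerivAt (fun z : ℂ => ((ε * z.im : ℝ) : ℂ)) _ z :=
      Complex.ofRealCLM.hasFDerivAt.comp z (Complex.imCLM.hasFDerivAt.const_mul ε)
    have h3 := ((h1.add (h2.mul_const Complex.I)).const_mul d).const_add m
    have h4 : HasFDerivAt φ _ z := h3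
    have hgp : 0 < 1 / (1 + (k * z.re) ^ 2) * (k * 1) / Real.arctan k := by positivity
    rw [h4.fderiv, det_eq]
    set a := 1 / (1 + (k * z.re) ^ 2) * (k * 1) / Real.arctan k
    have hdn : 0 < d.re * d.re + d.im * d.im := by
      rw [← Complex.normSq_apply]
      exact Complex.normSq_pos.2 hd0
    have := mul_pos (mul_pos hdn hgp) hε0
    simp
    nlinarith
  · rintro _ ⟨z, hz, rfl⟩
    exact (hmem z hz).1
  · have := hreal (-1)
    rw [hg1'] at this
    push_cast at this
    rw [this, hm, hd]
    ring
  · have := hreal 1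
    rw [hg1] at this
    push_cast at this
    rw [this, hm, hd]
    ring
  · ext y
    rw [mem_segment_iff_real]
    constructor
    · rintro ⟨z, hz, rfl⟩
      obtain ⟨x, hx, rfl⟩ := mem_segment_neg_one_one.1 hz
      refine ⟨g x, ?_, hreal x⟩
      rw [abs_le] at hx ⊢
      exact ⟨hg1'.symm.trans_le (hgmono.monotone hx.1), (hgmono.monotone hx.2).trans_eq hg1⟩
    · rintro ⟨x, hx, rfl⟩
      have hx' : x ∈ Icc (g (-1)) (g 1) := by rwa [hg1, hg1', mem_Icc, ← abs_le]
      obtain ⟨w, hw, rfl⟩ := intermediate_value_Icc (by norm_num : (-1 : ℝ) ≤ 1)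
        hgs.continuous.continuousOn hx'
      exact ⟨w, mem_segment_neg_one_one.2 ⟨w, abs_le.2 hw, rfl⟩, hreal w⟩
  · rintro ⟨z, hz, hzr⟩
    exact (hmem z hz).2 hzr

theorem twistDisk_mem_braidDiffeo {c : ℂ} {R : ℝ} {φ : ℂ → ℂ} {p q r : ℂ}
    (H : TwistChart c R φ) (hp : φ (-1) = p) (hq : φ 1 = q) (hr : r ∉ φ '' ball 0 2) :
    H.twistDisk 1 ∈ braidDiffeo c R {p, q, r} := by
  have h1 : (-1 : ℂ) ∈ ball (0 : ℂ) 2 := by simp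
  have h2 : (1 : ℂ) ∈ ball (0 : ℂ) 2 := by simp
  have e : Complex.exp ((Real.pi * 1 : ℝ) * Complex.I) = -1 := by simp
  have e1 : H.twistFun 1 p = q := by
    rw [← hp, H.twistFun_apply _ h1, twist_of_norm_le_one _ (by simp), e, neg_mul_neg, one_mul, hq]
  have e2 : H.twistFun 1 q = p := by
    rw [← hq, H.twistFun_apply _ h2, twist_of_norm_le_one _ (by simp), e, mul_one, hp]
  have e3 : H.twistFun 1 r = r := H.twistFun_of_notMem _ hr
  have hinj : Function.Injective (H.twistFun 1) := (H.twistPlane 1).injective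
  refine ⟨H.twistDisk_mem 1, fun y => ?_⟩
  rw [TwistChart.coe_twistDisk]
  simp only [mem_insert_iff, mem_singleton_iff]
  constructor
  · rintro (h | h | h)
    · exact Or.inr (Or.inl (hinj (h.trans e2.symm)))
    · exact Or.inl (hinj (h.trans e1.symm))
    · exact Or.inr (Or.inr (hinj (h.trans e3.symm)))
  · rintro (h | h | h) <;> simp [h, e1, e2, e3]

/-- The half-twists along the segment from `p` to `q` represent a unique braid, and its square
realizes the full rotation of `p` and `q` around their midpoint. -/
theorem exists_halfTwistBraid {c : ℂ} {R : ℝ} (hR : 0 < R) {K : Set ℂ} {p q r : ℂ}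
    (hK : K = {p, q, r}) (hKD : K ⊆ ball c R) (hr : IsApex p q r) :
    ∃ f : braidDiffeo c R K,
      (∀ b, IsHalfTwistBraid (segment ℝ p q) b ↔ b = toBraid f) ∧
      Realizes (fun t : I => turn p q r (Real.pi * ((2 : ℕ) * t)))
        ((f * f : braidDiffeo c R K) : closedBall c R ≃ₜ closedBall c R) := by
  subst hK
  have hrD : r ∈ ball c R := hKD (by simp)
  obtain ⟨φ, H, hp, hq, hseg, hrφ⟩ := exists_twistChart (hKD (by simp : p ∈ _))
    (hKD (by simp : q ∈ _)) hr
  have hmem := twistDisk_mem_braidDiffeo H hp hq hrφ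
  have hint : φ '' ball 0 2 ∩ {p, q, r} = {φ (-1), φ 1} := by
    rw [hp, hq]
    ext y
    constructor
    · rintro ⟨h1, h2⟩
      rcases h2 with rfl | rfl | rfl
      · simp
      · simp
      · exact absurd h1 hrφ
    · rintro (rfl | rfl)
      · exact ⟨⟨-1, by simp, hp⟩, by simp⟩
      · exact ⟨⟨1, by simp, hq⟩, by simp⟩
  have hht : IsHalfTwist {p, q, r} (segment ℝ p q) (H.twistDisk 1) := H.isHalfTwist hseg hint
  refine ⟨⟨_, hmem⟩, fun b => ⟨?_, ?_⟩, ?_⟩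
  · rintro ⟨g, hg, rfl⟩
    refine toBraid_eq_of_realizes hR ?_ (hg.realizes hr hrD) (hht.realizes hr hrD)
    simp only [Icc.coe_zero, mul_zero, turn_zero, range_vec3]
  · rintro rfl
    exact ⟨_, hht, rfl⟩
  · have h2 := H.realizes hp hq hseg hr hrD hrφ 2
    have h3 : H.twistDisk ((2 : ℕ) : ℝ) = H.twistDisk 1 * H.twistDisk 1 := by
      rw [← H.twistDisk_add]
      norm_num
    rw [h3] at h2
    exact h2

/-! ### Labelled fibres of the conic and the line -/

/-- The three points of the fibre over `x = u ^ 2`, the point on the line first. -/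
def fibreConf (x u : ℂ) : Fin 3 → ℂ := ![-x - 1, u, -u]

theorem fibre_conicLine {x u : ℂ} (h : u ^ 2 = x) :
    fibre conicLine x = range (fibreConf x u) := by
  rw [fibreConf, range_vec3]
  ext y
  have e : (y ^ 2 - x) * (y + x + 1) = (y - u) * (y - -u) * (y - (-x - 1)) := by
    rw [← h]
    ring
  change (y ^ 2 - x) * (y + x + 1) = 0 ↔ _
  rw [e]
  simp only [mem_insert_iff, mem_singleton_iff, mul_eq_zero, sub_eq_zero]
  tauto

theorem injective_fibreConf {x u : ℂ} (h : u ^ 2 = x) (hx : x ∉ branchSet conicLine 3) :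
    Function.Injective (fibreConf x u) := by
  have hcard : (3 : ℕ∞) ≤ ({-x - 1, u, -u} : Set ℂ).encard := by
    have h1 : ¬ (fibre conicLine x).encard < ((3 : ℕ) : ℕ∞) := hx
    have := not_lt.1 h1
    rwa [fibre_conicLine h, fibreConf, range_vec3] at this
  have h2 : ∀ a b : ℂ, ({-x - 1, u, -u} : Set ℂ) ⊆ {a, b} → False := by
    intro a b hab
    have h3 := (hcard.trans (encard_le_encard hab)).trans (encard_insert_le _ _)
    rw [encard_singleton] at h3
    exact absurd h3 (by norm_num)
  refine injective_vec3 (fun h1 => h2 u (-u) ?_) (fun h1 => h2 u (-u) ?_)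
    (fun h1 => h2 (-x - 1) u ?_)
  · rw [h1]
    simp
  · rw [h1, pair_comm u]
    simp
  · rw [← h1]
    simp

theorem ne_zero_of_notMem {x : ℂ} (hx : x ∉ branchSet conicLine 3) : x ≠ 0 := by
  rintro rfl
  have := injective_fibreConf (u := 0) (by simp) hx
  have h1 := @this 1 2 (by simp [fibreConf])
  exact absurd h1 (by decide)

theorem continuous_fibreConf {Z : Type*} [TopologicalSpace Z] {x u : Z → ℂ} (hx : Continuous x)
    (hu : Continuous u) : Continuous fun z => fibreConf (x z) (u z) :=
  continuous_vec3 (hx.neg.sub continuous_const) hu hu.neg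

/-- A continuous selection from finitely many distinct continuous functions is constant. -/
theorem eq_of_selection {Z ι : Type*} [TopologicalSpace Z] [PreconnectedSpace Z] [Finite ι]
    {k : Z → ℂ} {g : Z → ι → ℂ} (hk : Continuous k) (hg : Continuous g)
    (hinj : ∀ z, Function.Injective (g z)) (hkg : ∀ z, k z ∈ range (g z)) {z₀ : Z} {j : ι}
    (h0 : k z₀ = g z₀ j) (z : Z) : k z = g z j := by
  have hcl : ∀ i, IsClosed {z | k z = g z i} := fun i =>
    isClosed_eq hk ((continuous_apply i).comp hg)
  have hclopen : IsClopen {z | k z = g z j} := by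
    refine ⟨hcl j, ?_⟩
    have : {z | k z = g z j} = (⋃ i ∈ {i : ι | i ≠ j}, {z | k z = g z i})ᶜ := by
      ext z
      simp only [mem_compl_iff, mem_iUnion, not_exists]
      constructor
      · intro h i hi h'
        exact hi (hinj z (h'.symm.trans h))
      · intro h
        obtain ⟨i, hi⟩ := hkg z
        by_contra hne
        refine h i (fun hij => hne ?_) hi.symm
        rw [← hij]
        exact hi.symm
    rw [this, isOpen_compl_iff]
    exact (Set.toFinite _).isClosed_biUnion fun i _ => hcl i
  exact (hclopen.eq_univ ⟨z₀, h0⟩).symm.subset (mem_univ z)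

theorem mem_range_fibreConf {x u v : ℂ} (hu : u ^ 2 = x) (hv : v ^ 2 = x) :
    v ∈ range (fibreConf x u) := by
  rcases sq_eq_sq_iff_eq_or_eq_neg.1 (hv.trans hu.symm) with h | h
  · exact ⟨1, h.symm⟩
  · exact ⟨2, h.symm⟩

/-- A homotopy of paths off the branch set lifts to a homotopy of labelled fibres: the square
root lifts along the covering `z ↦ z ^ 2` of the punctured plane. -/
theorem exists_fibre_lift {a b : ℂ} {T T₀ : Path a b}
    (hT : HomotopicOff (branchSet conicLine 3) T T₀) {u₀ : I → ℂ} (hu₀ : Continuous u₀)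
    (hsq : ∀ t, u₀ t ^ 2 = T₀ t) :
    ∃ u : I → ℂ, Continuous u ∧ (∀ t, u t ^ 2 = T t) ∧ u 0 = u₀ 0 ∧ u 1 = u₀ 1 ∧
      ConfHomotopic (fun t => fibreConf (T t) (u t)) (fun t => fibreConf (T₀ t) (u₀ t)) := by
  obtain ⟨F, hF⟩ := hT
  have hF1 : ∀ t, F (1, t) = T₀ t := fun t => F.apply_one t
  have hF0 : ∀ t, F (0, t) = T t := fun t => F.apply_zero t
  have : ContractibleSpace I :=
    (convex_Icc (0 : ℝ) 1).contractibleSpace (nonempty_Icc.2 zero_le_one)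
  have : LocallyPathConnectedSpace I := (convex_Icc (0 : ℝ) 1).locallyPathConnectedSpace
  have hcov := isCoveringMapOn_npow (𝕜 := ℂ) 2 (by norm_num)
  obtain ⟨S, ⟨hS1, hS⟩, -⟩ := hcov.existsUnique_continuousMap_lifts (A := I × I)
    (F : C(I × I, ℂ)) (a₀ := (1, 0)) (e₀ := u₀ 0) (by
      change u₀ 0 ^ 2 = F (1, 0)
      rw [hF1, hsq]) (fun p => ne_zero_of_notMem (hF p))
  have hSq : ∀ p, S p ^ 2 = F p := fun p => congrFun hS p
  have hinj : ∀ p, Function.Injective (fibreConf (F p) (S p)) := fun p =>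
    injective_fibreConf (hSq p) (hF p)
  have hS1t : ∀ t, u₀ t = S (1, t) := eq_of_selection (j := (1 : Fin 3)) (z₀ := (0 : I)) hu₀
    (continuous_fibreConf (x := fun t : I => F (1, t)) (u := fun t : I => S (1, t))
      (by fun_prop) (by fun_prop)) (fun t => hinj _)
    (fun t => mem_range_fibreConf (hSq _) (by rw [hsq, hF1])) hS1.symm
  have hside : ∀ e : I, (∀ s, F (s, e) = F (1, e)) → ∀ s, S (s, e) = S (1, e) := by
    intro e he
    exact eq_of_selection (j := (1 : Fin 3)) (z₀ := (1 : I))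
      (g := fun _ => fibreConf (F (1, e)) (S (1, e))) (by fun_prop) continuous_const
      (fun _ => hinj _) (fun s => mem_range_fibreConf (hSq _) (by rw [hSq, he])) rfl
  have hFl : ∀ s, F (s, 0) = F (1, 0) := fun s => by rw [F.source, F.source]
  have hFr : ∀ s, F (s, 1) = F (1, 1) := fun s => by rw [F.target, F.target]
  refine ⟨fun t => S (0, t), by fun_prop, fun t => by rw [hSq, hF0], ?_, ?_, ?_⟩
  · exact (hside 0 hFl 0).trans hS1
  · exact (hside 1 hFr 0).trans (hS1t 1).symm
  · refine ⟨fun p => fibreConf (F p) (S p), continuous_fibreConf (by fun_prop) (by fun_prop), hinj,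
      fun t => by simp only [hF0], fun t => by simp only [hF1, hS1t], fun s => ?_, fun s => ?_⟩
    · change fibreConf (F (s, 0)) (S (s, 0)) = fibreConf (T 0) (S (0, 0))
      rw [hside 0 hFl s, hFl, hside 0 hFl 0, ← hF0, hFl 0]
    · change fibreConf (F (s, 1)) (S (s, 1)) = fibreConf (T 1) (S (0, 1))
      rw [hside 1 hFr s, hFr, hside 1 hFr 0, ← hF0, hFr 0]

section Lefschetz

variable {c : ℂ} {R : ℝ} {a b : ℂ} {T : Path a b} {u : I → ℂ}

/-- A Lefschetz diffeomorphism is carried by the motion of the labelled fibres. -/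
theorem IsLefschetzDiffeo.carries (hu : Continuous u) (hsq : ∀ t, u t ^ 2 = T t)
    (hT : ∀ t, T t ∉ branchSet conicLine 3) {ψ : closedBall c R ≃ₜ closedBall c R}
    (h : IsLefschetzDiffeo conicLine T ψ) :
    Carries (diskDiffeo c R) (fun t => fibreConf (T t) (u t)) ψ := by
  obtain ⟨Ψ, hΨ, h0, h1, hmem, himg⟩ := h
  refine ⟨Ψ, ⟨hΨ, h0, hmem, fun t i y hy => ?_⟩, h1⟩
  have hya : (y : ℂ) ∈ fibre conicLine a := by
    rw [fibre_conicLine ((hsq 0).trans T.source), hy, T.source]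
    exact mem_range_self i
  refine eq_of_selection (k := fun t => (Ψ t y : ℂ)) (z₀ := (0 : I)) ?_
    (continuous_fibreConf T.continuous hu) (fun t => injective_fibreConf (hsq t) (hT t)) ?_ ?_ t
  · exact continuous_subtype_val.comp (hΨ.comp (continuous_id.prodMk continuous_const))
  · intro t
    rw [← fibre_conicLine (hsq t), ← himg t]
    exact mem_image_of_mem _ hya
  · rw [h0]
    exact hy

theorem Moves.isLefschetzDiffeo (hsq : ∀ t, u t ^ 2 = T t)
    (hball : ∀ t, fibre conicLine (T t) ⊆ ball c R)
    {Ψ : I → (closedBall c R ≃ₜ closedBall c R)}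
    (h : Moves (diskDiffeo c R) (fun t => fibreConf (T t) (u t)) Ψ) :
    IsLefschetzDiffeo conicLine T (Ψ 1) := by
  refine ⟨Ψ, h.continuous, h.zero, rfl, h.mem, fun t => ?_⟩
  have h0 : fibre conicLine a = range (fibreConf (T 0) (u 0)) := by
    rw [← fibre_conicLine (hsq 0), T.source]
  rw [fibre_conicLine (hsq t)]
  ext y
  constructor
  · rintro ⟨z, hz, rfl⟩
    change (z : ℂ) ∈ fibre conicLine a at hz
    rw [h0] at hz
    obtain ⟨i, hi⟩ := hz
    exact ⟨i, (h.apply t i z hi.symm).symm⟩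
  · rintro ⟨i, rfl⟩
    have hi : fibreConf (T 0) (u 0) i ∈ closedBall c R := by
      refine ball_subset_closedBall (hball 0 ?_)
      rw [fibre_conicLine (hsq 0)]
      exact mem_range_self i
    refine ⟨⟨_, hi⟩, ?_, h.apply t i _ rfl⟩
    change fibreConf (T 0) (u 0) i ∈ fibre conicLine a
    rw [h0]
    exact mem_range_self i

theorem fibreConf_mem_ball (hsq : ∀ t, u t ^ 2 = T t)
    (hball : ∀ t, fibre conicLine (T t) ⊆ ball c R) (t : I) (i : Fin 3) :
    fibreConf (T t) (u t) i ∈ ball c R := by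
  apply hball t
  rw [fibre_conicLine (hsq t)]
  exact mem_range_self i

/-- There is a Lefschetz diffeomorphism along every path off the branch set whose fibres stay in
the open disk. -/
theorem exists_isLefschetzDiffeo (hu : Continuous u) (hsq : ∀ t, u t ^ 2 = T t)
    (hT : ∀ t, T t ∉ branchSet conicLine 3) (hball : ∀ t, fibre conicLine (T t) ⊆ ball c R) :
    ∃ ψ : closedBall c R ≃ₜ closedBall c R, IsLefschetzDiffeo conicLine T ψ := by
  obtain ⟨Ψ, hΨ⟩ := exists_moves (c := c) (R := R) (continuous_fibreConf T.continuous hu)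
    (fun t => injective_fibreConf (hsq t) (hT t)) (fibreConf_mem_ball hsq hball)
  exact ⟨_, hΨ.isLefschetzDiffeo hsq hball⟩

end Lefschetz

/-! ### The square root with positive imaginary part -/

/-- The square root of `x` in the upper half-plane, continuous off the positive real axis. -/
def upperRoot (x : ℂ) : ℂ := Complex.I * (-x) ^ ((1 / 2 : ℝ) : ℂ)

theorem upperRoot_sq (x : ℂ) : upperRoot x ^ 2 = x := by
  rw [upperRoot, mul_pow, Complex.I_sq, ← Complex.cpow_mul_nat]
  norm_num

theorem upperRoot_im_pos {x : ℂ} (hx : x.re < 0) : 0 < (upperRoot x).im := by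
  have h0 : -x ≠ 0 := fun h => by
    have := congrArg Complex.re h
    simp at this
    linarith
  have h1 : (upperRoot x).im = ‖-x‖ ^ (1 / 2 : ℝ) * Real.cos (Complex.arg (-x) * (1 / 2)) := by
    rw [upperRoot, Complex.I_mul_im, Complex.cpow_ofReal_re]
  rw [h1]
  refine mul_pos (Real.rpow_pos_of_pos (norm_pos_iff.2 h0) _) (Real.cos_pos_of_mem_Ioo ?_)
  have h2 := Complex.neg_pi_lt_arg (-x)
  have h3 : Complex.arg (-x) < Real.pi := by
    refine lt_of_le_of_ne (Complex.arg_le_pi _) fun h => ?_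
    have := (Complex.arg_eq_pi_iff.1 h).1
    simp at this
    linarith
  constructor <;> linarith

theorem continuousAt_upperRoot {x : ℂ} (hx : x.re < 0) : ContinuousAt upperRoot x := by
  unfold upperRoot
  refine continuousAt_const.mul (ContinuousAt.cpow continuousAt_neg continuousAt_const ?_)
  exact Or.inl (by simpa using hx)

theorem eq_of_sq_eq_sq_of_im_pos {u v : ℂ} (h : u ^ 2 = v ^ 2) (hu : 0 < u.im) (hv : 0 < v.im) :
    u = v := by
  rcases sq_eq_sq_iff_eq_or_eq_neg.1 h with h1 | h1
  · exact h1
  · rw [h1, Complex.neg_im] at hu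
    linarith

theorem upperRoot_xZero : upperRoot xZero = Complex.I / 2 := by
  refine eq_of_sq_eq_sq_of_im_pos ?_ (upperRoot_im_pos (by norm_num [xZero])) (by simp)
  rw [upperRoot_sq, div_pow, Complex.I_sq, xZero]
  norm_num

theorem upperRoot_xOne : upperRoot xOne = (√3 : ℝ) / 2 * Complex.I := by
  refine eq_of_sq_eq_sq_of_im_pos ?_ (upperRoot_im_pos (by norm_num [xOne])) (by simp)
  rw [upperRoot_sq, mul_pow, Complex.I_sq, div_pow, ← Complex.ofReal_pow,
    Real.sq_sqrt (by norm_num), xOne]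
  norm_num

/-- Real and imaginary part of the equation `upperRoot x ^ 2 = x`. -/
theorem upperRoot_eqns (x : ℂ) :
    (upperRoot x).re ^ 2 - (upperRoot x).im ^ 2 = x.re ∧
      2 * (upperRoot x).re * (upperRoot x).im = x.im := by
  have h := upperRoot_sq x
  rw [sq] at h
  constructor
  · rw [← congrArg Complex.re h, Complex.mul_re]
    ring
  · rw [← congrArg Complex.im h, Complex.mul_im]
    ring

/-! ### Straight-line homotopies to a full rotation -/

/-- `z` and `w` lie in a common open half-plane bounded by a line through the origin. -/
def SameSide (z w : ℂ) : Prop := ∃ v : ℂ, 0 < (z * v).re ∧ 0 < (w * v).re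

theorem SameSide.neg {z w : ℂ} (h : SameSide z w) : SameSide (-z) (-w) := by
  obtain ⟨v, h1, h2⟩ := h
  exact ⟨-v, by rwa [neg_mul_neg], by rwa [neg_mul_neg]⟩

theorem forall_sameSide {x y : Fin 3 → ℂ} (h01 : SameSide (x 0 - x 1) (y 0 - y 1))
    (h02 : SameSide (x 0 - x 2) (y 0 - y 2)) (h12 : SameSide (x 1 - x 2) (y 1 - y 2)) :
    ∀ i j, i ≠ j → SameSide (x i - x j) (y i - y j) := by
  intro i j hij
  fin_cases i <;> fin_cases j <;> simp only [Fin.zero_eta, Fin.mk_one, Fin.reduceFinMk] at hij ⊢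
  · exact absurd rfl hij
  · exact h01
  · exact h02
  · simpa using h01.neg
  · exact absurd rfl hij
  · exact h12
  · simpa using h02.neg
  · simpa using h12.neg
  · exact absurd rfl hij

/-- If at all times the differences of corresponding points of two motions lie in a common open
half-plane, then the straight-line homotopy between the motions avoids collisions. -/
theorem confHomotopic_of_sameSide {ι : Type*} {γ γ' : I → ι → ℂ} (hγ : Continuous γ)
    (hγ' : Continuous γ') (h0 : γ' 0 = γ 0) (h1 : γ' 1 = γ 1)
    (h : ∀ t i j, i ≠ j → SameSide (γ t i - γ t j) (γ' t i - γ' t j)) : ConfHomotopic γ γ' := by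
  refine ⟨fun p i => ((1 - (p.1 : ℝ) : ℝ) : ℂ) * γ p.2 i + ((p.1 : ℝ) : ℂ) * γ' p.2 i, ?_, ?_,
    ?_, ?_, ?_, ?_⟩
  · have h2 : ∀ i, Continuous fun t => γ t i := fun i => (continuous_apply i).comp hγ
    have h3 : ∀ i, Continuous fun t => γ' t i := fun i => (continuous_apply i).comp hγ'
    refine continuous_pi fun i => ?_
    have h4 := (h2 i).comp (continuous_snd : Continuous fun p : I × I => p.2)
    have h5 := (h3 i).comp (continuous_snd : Continuous fun p : I × I => p.2)
    exact ((Complex.continuous_ofReal.comp (by fun_prop)).mul h4).add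
      ((Complex.continuous_ofReal.comp (by fun_prop)).mul h5)
  · intro p i j hij
    by_contra hne
    obtain ⟨v, hv1, hv2⟩ := h p.2 i j hne
    have e : ((1 - (p.1 : ℝ) : ℝ) : ℂ) * ((γ p.2 i - γ p.2 j) * v) +
        ((p.1 : ℝ) : ℂ) * ((γ' p.2 i - γ' p.2 j) * v) = 0 := by
      simp only at hij
      linear_combination v * hij
    have e2 := congrArg Complex.re e
    rw [Complex.add_re, Complex.re_ofReal_mul, Complex.re_ofReal_mul, Complex.zero_re] at e2
    rcases p.1.2.1.eq_or_lt with h3 | h3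
    · rw [← h3] at e2
      linarith
    · have := mul_pos h3 hv2
      have := mul_nonneg (sub_nonneg.2 p.1.2.2) hv1.le
      linarith
  · intro t
    simp
  · intro t
    simp
  · intro s
    funext i
    simp only [h0]
    push_cast
    ring
  · intro s
    funext i
    simp only [h1]
    push_cast
    ring

theorem IsApex.of_normSq_lt {p q r : ℂ}
    (h1 : (r - (p + q) / 2).im * ((q - p) / 2).re ≠ (r - (p + q) / 2).re * ((q - p) / 2).im)
    (h2 : Complex.normSq ((q - p) / 2) < Complex.normSq (r - (p + q) / 2)) : IsApex p q r := by
  have h3 : (q - p) / 2 ≠ 0 := fun h => h1 (by rw [h, Complex.zero_re, Complex.zero_im, mul_zero,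
    mul_zero])
  have h4 := Complex.normSq_pos.2 h3
  constructor
  · rw [div_eq_mul_inv, Complex.inv_def, ← mul_assoc, Complex.im_mul_ofReal]
    refine mul_ne_zero ?_ (inv_ne_zero h4.ne')
    rw [Complex.mul_im, Complex.conj_re, Complex.conj_im]
    exact fun h => h1 (by linarith)
  · rw [norm_div, one_lt_div (norm_pos_iff.2 h3), ← sq_lt_sq₀ (norm_nonneg _) (norm_nonneg _),
      Complex.sq_norm, Complex.sq_norm]
    exact h2

theorem IsApex.injective_turn {p q r : ℂ} (h : IsApex p q r) (θ : ℝ) :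
    Function.Injective (turn p q r θ) := by
  have hd := h.ne
  have he : ‖Complex.exp (θ * Complex.I)‖ = 1 := Complex.norm_exp_ofReal_mul_I θ
  have hlt := h.lt_norm
  rw [norm_div, one_lt_div (norm_pos_iff.2 hd)] at hlt
  refine injective_vec3 (fun h1 => ?_) (fun h1 => ?_) (fun h1 => ?_)
  · have h2 : (q - p) / 2 * Complex.exp (θ * Complex.I) = 0 := by linear_combination -h1 / 2
    exact mul_ne_zero hd (Complex.exp_ne_zero _) h2
  · rw [← h1, sub_sub_cancel_left, norm_neg, norm_mul, he, mul_one] at hlt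
    exact lt_irrefl _ hlt
  · rw [← h1, add_sub_cancel_left, norm_mul, he, mul_one] at hlt
    exact lt_irrefl _ hlt

theorem continuous_turn (p q r : ℂ) : Continuous (turn p q r) :=
  continuous_vec3 (by fun_prop) (by fun_prop) continuous_const

/-- The homotopy class of a rotation depends only on the angles at the two ends. -/
theorem IsApex.confHomotopic_turn {p q r : ℂ} (h : IsApex p q r) {θ θ' : I → ℝ}
    (hθ : Continuous θ) (hθ' : Continuous θ') (h0 : θ' 0 = θ 0) (h1 : θ' 1 = θ 1) :
    ConfHomotopic (fun t => turn p q r (θ t)) (fun t => turn p q r (θ' t)) := by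
  refine ⟨fun x => turn p q r ((1 - x.1) * θ x.2 + x.1 * θ' x.2),
    (continuous_turn p q r).comp (by fun_prop), fun x => h.injective_turn _, ?_, ?_, ?_, ?_⟩
  · intro t
    simp
  · intro t
    simp
  · intro s
    simp only [h0]
    congr 1
    ring
  · intro s
    simp only [h1]
    congr 1
    ring

/-- The full turn, divided into quarters in the way in which `upperLoop` and `lowerLoop` are
divided into sides. -/
def fullTurn : Path (0 : ℝ) (2 * Real.pi) :=
  (((Path.segment 0 (Real.pi / 2)).trans (Path.segment (Real.pi / 2) Real.pi)).trans
    (Path.segment Real.pi (3 * Real.pi / 2))).trans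
      (Path.segment (3 * Real.pi / 2) (2 * Real.pi))

theorem forall_trans {X Y : Type*} [TopologicalSpace X] [TopologicalSpace Y] {P : X → Y → Prop}
    {x₀ x₁ x₂ : X} {y₀ y₁ y₂ : Y} {γ : Path x₀ x₁} {γ' : Path x₁ x₂} {δ : Path y₀ y₁}
    {δ' : Path y₁ y₂} (h : ∀ t, P (γ t) (δ t)) (h' : ∀ t, P (γ' t) (δ' t)) (t : I) :
    P ((γ.trans γ') t) ((δ.trans δ') t) := by
  rw [Path.trans_apply, Path.trans_apply]
  split_ifs
  exacts [h _, h' _]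

theorem quarter_turn_pos {z v : ℂ} (h1 : 0 < (z * v).re) (h2 : 0 < (z * Complex.I * v).re)
    (t : I) : 0 < (z * Complex.exp ((Real.pi / 2 * t : ℝ) * Complex.I) * v).re := by
  have e : z * Complex.exp ((Real.pi / 2 * t : ℝ) * Complex.I) * v =
      (Real.cos (Real.pi / 2 * t) : ℂ) * (z * v) +
        (Real.sin (Real.pi / 2 * t) : ℂ) * (z * Complex.I * v) := by
    rw [Complex.exp_mul_I, ← Complex.ofReal_cos, ← Complex.ofReal_sin]
    ring
  rw [e, Complex.add_re, Complex.re_ofReal_mul, Complex.re_ofReal_mul]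
  have ht0 := t.2.1
  have ht1 := t.2.2
  have hπ := Real.pi_pos
  have hc : 0 ≤ Real.cos (Real.pi / 2 * t) :=
    Real.cos_nonneg_of_mem_Icc ⟨by nlinarith, by nlinarith⟩
  have hs : 0 ≤ Real.sin (Real.pi / 2 * t) :=
    Real.sin_nonneg_of_nonneg_of_le_pi (by nlinarith) (by nlinarith)
  have hcs := Real.sin_sq_add_cos_sq (Real.pi / 2 * t)
  rcases hc.eq_or_lt with h | h
  · have : 0 < Real.sin (Real.pi / 2 * t) := by
      rcases hs.eq_or_lt with h' | h'
      · rw [← h, ← h'] at hcs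
        norm_num at hcs
      · exact h'
    rw [← h]
    have := mul_pos this h2
    linarith
  · have := mul_pos h h1
    have := mul_nonneg hs h2.le
    linarith

theorem exp_quarter (k : ℕ) (t : ℝ) :
    Complex.exp ((k * (Real.pi / 2) + Real.pi / 2 * t : ℝ) * Complex.I) =
      Complex.I ^ k * Complex.exp ((Real.pi / 2 * t : ℝ) * Complex.I) := by
  have h : Complex.exp (Real.pi / 2 * Complex.I) = Complex.I := Complex.exp_pi_div_two_mul_I
  nth_rewrite 2 [← h]
  rw [← Complex.exp_nat_mul, ← Complex.exp_add]
  congr 1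
  push_cast
  ring

/-- The differences of the points of the configuration `v` lie in a common half-plane with those
of the rotated configuration `turn p q r θ`. -/
def Matches (p q r : ℂ) (v : Fin 3 → ℂ) (θ : ℝ) : Prop :=
  ∀ i j, i ≠ j → SameSide (v i - v j) (turn p q r θ i - turn p q r θ j)

/-- In the `k`-th quarter of the full turn, it suffices to compare with the differences at the
two ends of the quarter. The differences with the third point stay in one half-plane, given by
`w`, all the time. -/
theorem matches_quarter {p q r w : ℂ} (hw : ‖w‖ = 1)
    (hr : ‖(q - p) / 2‖ < (((p + q) / 2 - r) * w).re) {a b : ℂ} {k : ℕ} (t : I) {θ : ℝ}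
    (hθ : θ = k * (Real.pi / 2) + Real.pi / 2 * t) (v : ℂ)
    (h01 : 0 < ((a - b) * v).re) (hk : 0 < ((p - q) * Complex.I ^ k * v).re)
    (hk' : 0 < ((p - q) * Complex.I ^ k * Complex.I * v).re) {s : ℂ}
    (h02 : 0 < ((a - s) * w).re) (h12 : 0 < ((b - s) * w).re) :
    Matches p q r ![a, b, s] θ := by
  have hb : ∀ z : ℂ, ‖z‖ = ‖(q - p) / 2‖ → 0 < (((p + q) / 2 + z - r) * w).re := by
    intro z hz
    have e : ((p + q) / 2 + z - r) * w = ((p + q) / 2 - r) * w + z * w := by ring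
    have h1 := Complex.abs_re_le_norm (z * w)
    rw [norm_mul, hw, mul_one, hz] at h1
    rw [e, Complex.add_re]
    linarith [(abs_le.1 h1).1]
  have he : ‖Complex.exp (θ * Complex.I)‖ = 1 := Complex.norm_exp_ofReal_mul_I θ
  have s01 : SameSide (a - b) (turn p q r θ 0 - turn p q r θ 1) := by
    refine ⟨v, h01, ?_⟩
    have e : turn p q r θ 0 - turn p q r θ 1 = (p - q) * Complex.I ^ k *
        Complex.exp ((Real.pi / 2 * t : ℝ) * Complex.I) := by
      rw [mul_assoc, ← exp_quarter, ← hθ]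
      simp only [turn, Matrix.cons_val_zero, Matrix.cons_val_one]
      ring
    rw [e]
    exact quarter_turn_pos hk hk' t
  have s02 : SameSide (a - s) (turn p q r θ 0 - turn p q r θ 2) := by
    refine ⟨w, h02, ?_⟩
    have := hb (-((q - p) / 2 * Complex.exp (θ * Complex.I)))
      (by rw [norm_neg, norm_mul, he, mul_one])
    simpa [turn, sub_eq_add_neg] using this
  have s12 : SameSide (b - s) (turn p q r θ 1 - turn p q r θ 2) := by
    refine ⟨w, h12, ?_⟩
    have := hb ((q - p) / 2 * Complex.exp (θ * Complex.I)) (by rw [norm_mul, he, mul_one])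
    simpa [turn] using this
  exact forall_sameSide s01 s02 s12

theorem segment_apply_real (a b : ℝ) (t : I) : Path.segment a b t = a + (b - a) * t := by
  simp [AffineMap.lineMap_apply]
  ring

theorem segment_apply_complex (a b : ℂ) (t : I) :
    Path.segment a b t = a + ((t : ℝ) : ℂ) * (b - a) := by
  simp [AffineMap.lineMap_apply]
  ring

theorem ConfHomotopic.of_matches {p q r : ℂ} (h : IsApex p q r) {γ : I → Fin 3 → ℂ}
    (hγ : Continuous γ) (h0 : γ 0 = ![p, q, r]) (h1 : γ 1 = ![p, q, r])
    (hm : ∀ t, Matches p q r (γ t) (fullTurn t)) :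
    ConfHomotopic γ (fun t : I => turn p q r (Real.pi * ((2 : ℕ) * t))) := by
  have e1 : turn p q r (2 * Real.pi) = ![p, q, r] := by
    rw [← turn_zero p q r, turn, turn]
    simp
  have h2 : ConfHomotopic γ (fun t : I => turn p q r (fullTurn t)) :=
    confHomotopic_of_sameSide hγ ((continuous_turn p q r).comp fullTurn.continuous)
      (by simp only [fullTurn.source, turn_zero, h0]) (by simp only [fullTurn.target, e1, h1]) hm
  refine h2.trans (h.confHomotopic_turn fullTurn.continuous (by fun_prop) ?_ ?_)
  · simp
  · simp
    ring

/-! ### The loops around the intersection points -/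

theorem HomotopicOff.notMem {N : Set ℂ} {a b : ℂ} {T T₀ : Path a b} (h : HomotopicOff N T T₀)
    (t : I) : T t ∉ N := by
  obtain ⟨F, hF⟩ := h
  simpa using hF (0, t)

theorem IsLefschetzDiffeo.apply_mem_fibre_iff {c : ℂ} {R : ℝ} {S : Set (ℂ × ℂ)} {a b : ℂ}
    {T : Path a b} {ψ : closedBall c R ≃ₜ closedBall c R} (h : IsLefschetzDiffeo S T ψ)
    (y : closedBall c R) : (ψ y : ℂ) ∈ fibre S b ↔ (y : ℂ) ∈ fibre S a := by
  obtain ⟨Ψ, -, -, rfl, -, himg⟩ := h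
  have h1 := himg 1
  rw [T.target] at h1
  rw [← h1]
  constructor
  · rintro ⟨z, hz, hzy⟩
    rwa [← (Ψ 1).injective (Subtype.ext hzy)]
  · exact fun hy => ⟨y, hy, rfl⟩

theorem IsLefschetzDiffeo.mem_diskDiffeo {c : ℂ} {R : ℝ} {S : Set (ℂ × ℂ)} {a b : ℂ}
    {T : Path a b} {ψ : closedBall c R ≃ₜ closedBall c R} (h : IsLefschetzDiffeo S T ψ) :
    ψ ∈ diskDiffeo c R := by
  obtain ⟨Ψ, -, -, rfl, hmem, -⟩ := h
  exact hmem 1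

/-- If the labelled fibres along a loop match a full rotation of `p` and `q`, then the loop induces
the square of the half-twist along the segment from `p` to `q`. -/
theorem exists_halfTwist_sq_of_matches {c : ℂ} {R : ℝ} {a p q r : ℂ}
    (hA : fibre conicLine a ⊆ ball c R) (hr : IsApex p q r) {T₀ : Path a a} {u : I → ℂ}
    (hu : Continuous u) (hsq : ∀ t, u t ^ 2 = T₀ t)
    (h0 : fibreConf (T₀ 0) (u 0) = ![p, q, r]) (h1 : fibreConf (T₀ 1) (u 1) = ![p, q, r])
    (hm : ∀ t, Matches p q r (fibreConf (T₀ t) (u t)) (fullTurn t)) :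
    ∃ η : Braid c R (fibre conicLine a),
      (∀ b, IsHalfTwistBraid (segment ℝ p q) b ↔ b = η) ∧
      ∀ l : Path a a, HomotopicOff (branchSet conicLine 3) l T₀ →
        (∀ t, fibre conicLine (l t) ⊆ ball c R) →
        ∀ b, IsLefschetzBraid conicLine l b ↔ b = η ^ 2 := by
  have hK : fibre conicLine a = {p, q, r} := by
    rw [← range_vec3, ← h0, ← fibre_conicLine (hsq 0), T₀.source]
  have hR : 0 < R := pos_of_mem_ball (hA (by simp [hK] : p ∈ fibre conicLine a))
  obtain ⟨f, hf, hreal⟩ := exists_halfTwistBraid hR hK hA hr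
  refine ⟨toBraid f, hf, fun l hl hball b => ?_⟩
  obtain ⟨v, hv, hvsq, -, -, hh⟩ := exists_fibre_lift hl hu hsq
  have hturn := ConfHomotopic.of_matches hr (continuous_fibreConf T₀.continuous hu) h0 h1 hm
  have key : ∀ g : braidDiffeo c R (fibre conicLine a),
      IsLefschetzDiffeo conicLine l (g : closedBall c R ≃ₜ closedBall c R) →
        toBraid g = toBraid f ^ 2 := by
    intro g hg
    have e : toBraid f ^ 2 = toBraid (f * f) := sq _
    rw [e]
    refine toBraid_eq_of_realizes hR ?_ ⟨_, fibreConf_mem_ball hvsq hball,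
      (hg.carries hv hvsq hl.notMem).mono diskDiffeo_le_boundaryFix, hh.trans hturn⟩ hreal
    simp only [Nat.cast_ofNat, Set.Icc.coe_zero, mul_zero, turn_zero, range_vec3, hK]
  constructor
  · rintro ⟨g, hg, rfl⟩
    exact key g hg
  · rintro rfl
    obtain ⟨ψ, hψ⟩ := exists_isLefschetzDiffeo hv hvsq hl.notMem hball
    exact ⟨⟨ψ, hψ.mem_diskDiffeo, hψ.apply_mem_fibre_iff⟩, hψ, key _ hψ⟩

/-- For `x` on a side with `Re x = -1/4`, where `a` and `b` are the absolute values of the real and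
the imaginary part of `√x`. -/
theorem side_quarter {a b : ℝ} (ha : 0 ≤ a) (hb : 0 < b) (h : a ^ 2 - b ^ 2 = -1 / 4) :
    0 < 3 / 4 - a - b + 2 * (a * b) := by
  have h1 : 1 / 2 ≤ b := by nlinarith
  rcases le_total (1 / 2) a with h2 | h2
  · nlinarith [mul_nonneg (sub_nonneg.2 h2) (sub_nonneg.2 h1)]
  · have h3 : b ≤ a + 1 / 2 := by nlinarith
    nlinarith [mul_nonneg (sub_nonneg.2 h2) (sub_nonneg.2 h3), sq_nonneg (a - 1 / 4)]

/-- For `x` on a side with `Re x = -3/4`, with `a` and `b` as in `side_quarter`; `|Im x| ≤ 2` gives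
`a * b ≤ 1`. -/
theorem side_threeQuarters {a b : ℝ} (ha : 0 ≤ a) (hb : 0 < b) (h : a ^ 2 - b ^ 2 = -3 / 4)
    (hab : a * b ≤ 1) : 0 < 2 * (a - 1 / 4) + b - 2 * (a * b) := by
  have h1 : 1 / 2 < b := by nlinarith
  rcases le_total b 1 with h2 | h2
  · nlinarith [mul_nonneg ha (sub_nonneg.2 h2)]
  · have h3 : a ≤ 1 := by nlinarith
    have h4 : b < 3 / 2 := by nlinarith
    nlinarith [mul_nonneg (sub_nonneg.2 h3) (sub_nonneg.2 h2)]

/-- For `x` on a horizontal side with `|Im x| = 2`, with `a` and `b` as in `side_quarter`. -/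
theorem side_two {a b : ℝ} (hb : 0 < b)
    (h : -3 / 4 ≤ a ^ 2 - b ^ 2) (hab : a * b = 1) : b < 2 := by
  by_contra! h2
  have h3 : a ≤ 1 / 2 := by nlinarith
  have h4 : 0 < a := by nlinarith
  nlinarith

theorem continuous_upperRoot_comp {f : I → ℂ} (hf : Continuous f) (hre : ∀ t, (f t).re < 0) :
    Continuous fun t => upperRoot (f t) :=
  continuous_iff_continuousAt.2 fun t =>
    ContinuousAt.comp (f := f) (continuousAt_upperRoot (hre t)) hf.continuousAt

theorem isApex_upper : IsApex (-3 / 4) (-Complex.I / 2) (Complex.I / 2) := by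
  refine IsApex.of_normSq_lt ?_ ?_ <;> norm_num [Complex.normSq_apply]

theorem isApex_lower : IsApex (-3 / 4) (Complex.I / 2) (-Complex.I / 2) := by
  refine IsApex.of_normSq_lt ?_ ?_ <;> norm_num [Complex.normSq_apply]

theorem norm_lt_of_sq {d : ℂ} {x : ℝ} (hx : 0 < x) (h : Complex.normSq d < x ^ 2) : ‖d‖ < x := by
  rw [← sq_lt_sq₀ (norm_nonneg _) hx.le, Complex.sq_norm]
  exact h

/-- The difference of the point on the line and the lower root is compared with the full rotation on
each side of the rectangle, by the half-planes `0 < Re (z * v)` with `v = -1 + i`, `i`, `2 - i`,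
`-i` on the sides in turn. The upper root lies above the other two points all the time. -/
theorem matches_upperLoop (t : I) : (upperLoop t).re < 0 ∧
    Matches (-3 / 4) (-Complex.I / 2) (Complex.I / 2)
      (fibreConf (upperLoop t) (-upperRoot (upperLoop t))) (fullTurn t) := by
  let P : ℂ → ℝ → Prop := fun x θ => x.re < 0 ∧ Matches (-3 / 4) (-Complex.I / 2) (Complex.I / 2)
      (fibreConf x (-upperRoot x)) θ
  have key : ∀ (k : ℕ) (v x : ℂ) (t : I) (θ : ℝ), θ = k * (Real.pi / 2) + Real.pi / 2 * t →
      x.re < 0 → 0 ≤ x.im →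
      0 < ((-x - 1 - -upperRoot x) * v).re →
      0 < ((-3 / 4 - -Complex.I / 2) * Complex.I ^ k * v).re →
      0 < ((-3 / 4 - -Complex.I / 2) * Complex.I ^ k * Complex.I * v).re → P x θ := by
    intro k v x t θ hθ hx hx' h1 h2 h3
    refine ⟨hx, ?_⟩
    have hs := upperRoot_im_pos hx
    rw [fibreConf, neg_neg]
    refine matches_quarter (w := Complex.I) Complex.norm_I ?_ t hθ v h1 h2 h3 ?_ ?_
    · refine norm_lt_of_sq ?_ ?_ <;> norm_num [Complex.normSq_apply]
    · simp
      linarith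
    · simp
      linarith
  refine forall_trans (P := P) (forall_trans (forall_trans (fun t => ?_) fun t => ?_)
    fun t => ?_) (fun t => ?_) t
  all_goals
    rw [segment_apply_real, segment_apply_complex]
    have ht0 := t.2.1
    have ht1 := t.2.2
  · generalize hx : xZero + _ = x
    have hre : x.re = -1 / 4 := by rw [← hx]; norm_num [xZero]
    have him : x.im = 2 * t := by rw [← hx]; norm_num [xZero]; ring
    have hb := upperRoot_im_pos (x := x) (by linarith)
    obtain ⟨e1, e2⟩ := upperRoot_eqns x
    have ha : 0 ≤ (upperRoot x).re := by nlinarith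
    have := side_quarter ha hb (by linarith)
    refine key 0 (-1 + Complex.I) x t _ (by push_cast; ring) (by linarith) (by linarith) ?_
      (by norm_num) (by norm_num)
    simp
    nlinarith
  · generalize hx : xZero + _ + _ = x
    have hre : x.re = -1 / 4 - t / 2 := by rw [← hx]; norm_num [xZero, xOne]; ring
    have him : x.im = 2 := by rw [← hx]; norm_num [xZero, xOne]
    have hb := upperRoot_im_pos (x := x) (by linarith)
    obtain ⟨e1, e2⟩ := upperRoot_eqns x
    have := side_two (a := (upperRoot x).re) hb (by linarith) (by linarith)
    refine key 1 Complex.I x t _ (by push_cast; ring) (by linarith) (by linarith) ?_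
      (by norm_num) (by norm_num)
    simp
    nlinarith
  · generalize hx : xOne + _ + _ = x
    have hre : x.re = -3 / 4 := by rw [← hx]; norm_num [xZero, xOne]
    have him : x.im = 2 - 2 * t := by rw [← hx]; norm_num [xZero, xOne]; ring
    have hb := upperRoot_im_pos (x := x) (by linarith)
    obtain ⟨e1, e2⟩ := upperRoot_eqns x
    have ha : 0 ≤ (upperRoot x).re := by nlinarith
    have := side_threeQuarters ha hb (by linarith) (by linarith)
    refine key 2 (2 - Complex.I) x t _ (by push_cast; ring) (by linarith) (by linarith) ?_
      (by norm_num) (by norm_num)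
    simp
    nlinarith
  · generalize hx : xOne + _ = x
    have hre : x.re = -3 / 4 + t / 2 := by rw [← hx]; norm_num [xZero, xOne]; ring
    have him : x.im = 0 := by rw [← hx]; norm_num [xZero, xOne]
    have hb := upperRoot_im_pos (x := x) (by linarith)
    refine key 3 (-Complex.I) x t _ (by push_cast; ring) (by linarith) (by linarith) ?_
      (by norm_num [pow_succ]) (by norm_num [pow_succ])
    simp
    linarith

/-- The difference of the point on the line and the upper root is compared with the full rotation on
each side of the rectangle, by the half-planes `0 < Re (z * v)` with `v = i`, `2 + i`, `-i`,
`-1 - i` on the sides in turn. The lower root lies below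
the other two points all the time. -/
theorem matches_lowerLoop (t : I) : (lowerLoop t).re < 0 ∧
    Matches (-3 / 4) (Complex.I / 2) (-Complex.I / 2)
      (fibreConf (lowerLoop t) (upperRoot (lowerLoop t))) (fullTurn t) := by
  let P : ℂ → ℝ → Prop := fun x θ => x.re < 0 ∧ Matches (-3 / 4) (Complex.I / 2) (-Complex.I / 2)
      (fibreConf x (upperRoot x)) θ
  have key : ∀ (k : ℕ) (v x : ℂ) (t : I) (θ : ℝ), θ = k * (Real.pi / 2) + Real.pi / 2 * t →
      x.re < 0 → x.im ≤ 0 →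
      0 < ((-x - 1 - upperRoot x) * v).re →
      0 < ((-3 / 4 - Complex.I / 2) * Complex.I ^ k * v).re →
      0 < ((-3 / 4 - Complex.I / 2) * Complex.I ^ k * Complex.I * v).re → P x θ := by
    intro k v x t θ hθ hx hx' h1 h2 h3
    refine ⟨hx, ?_⟩
    have hs := upperRoot_im_pos hx
    refine matches_quarter (w := -Complex.I) (by simp) ?_ t hθ v h1 h2 h3 ?_ ?_
    · refine norm_lt_of_sq ?_ ?_ <;> norm_num [Complex.normSq_apply]
    · simp
      linarith
    · simp
      linarith
  refine forall_trans (P := P) (forall_trans (forall_trans (fun t => ?_) fun t => ?_)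
    fun t => ?_) (fun t => ?_) t
  all_goals
    rw [segment_apply_real, segment_apply_complex]
    have ht0 := t.2.1
    have ht1 := t.2.2
  · generalize hx : xZero + _ = x
    have hre : x.re = -1 / 4 - t / 2 := by rw [← hx]; norm_num [xZero, xOne]; ring
    have him : x.im = 0 := by rw [← hx]; norm_num [xZero, xOne]
    have hb := upperRoot_im_pos (x := x) (by linarith)
    refine key 0 Complex.I x t _ (by push_cast; ring) (by linarith) (by linarith) ?_
      (by norm_num) (by norm_num)
    simp
    linarith
  · generalize hx : xOne + _ = x
    have hre : x.re = -3 / 4 := by rw [← hx]; norm_num [xZero, xOne]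
    have him : x.im = -(2 * t) := by rw [← hx]; norm_num [xZero, xOne]; ring
    have hb := upperRoot_im_pos (x := x) (by linarith)
    obtain ⟨e1, e2⟩ := upperRoot_eqns x
    have ha : 0 ≤ -(upperRoot x).re := by nlinarith
    have := side_threeQuarters ha hb (by linarith) (by linarith)
    refine key 1 (2 + Complex.I) x t _ (by push_cast; ring) (by linarith) (by linarith) ?_
      (by norm_num) (by norm_num)
    simp
    nlinarith
  · generalize hx : xOne - _ + _ = x
    have hre : x.re = -3 / 4 + t / 2 := by rw [← hx]; norm_num [xZero, xOne]; ring
    have him : x.im = -2 := by rw [← hx]; norm_num [xZero, xOne]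
    have hb := upperRoot_im_pos (x := x) (by linarith)
    obtain ⟨e1, e2⟩ := upperRoot_eqns x
    have := side_two (a := -(upperRoot x).re) hb (by linarith) (by linarith)
    refine key 2 (-Complex.I) x t _ (by push_cast; ring) (by linarith) (by linarith) ?_
      (by norm_num) (by norm_num)
    simp
    nlinarith
  · generalize hx : xZero - _ + _ = x
    have hre : x.re = -1 / 4 := by rw [← hx]; norm_num [xZero]
    have him : x.im = -2 + 2 * t := by rw [← hx]; norm_num [xZero]; ring
    have hb := upperRoot_im_pos (x := x) (by linarith)
    obtain ⟨e1, e2⟩ := upperRoot_eqns x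
    have ha : 0 ≤ -(upperRoot x).re := by nlinarith
    have := side_quarter ha hb (by linarith)
    refine key 3 (-1 - Complex.I) x t _ (by push_cast; ring) (by linarith) (by linarith) ?_
      (by norm_num [pow_succ]) (by norm_num [pow_succ])
    simp
    nlinarith

theorem exists_halfTwist_sq_upperLoop {c : ℂ} {R : ℝ} (hA : fibre conicLine xZero ⊆ ball c R) :
    ∃ η : Braid c R (fibre conicLine xZero),
      (∀ b, IsHalfTwistBraid (segment ℝ (-3 / 4) (-Complex.I / 2)) b ↔ b = η) ∧
      ∀ l : Path xZero xZero, HomotopicOff (branchSet conicLine 3) l upperLoop →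
        (∀ t, fibre conicLine (l t) ⊆ ball c R) →
        ∀ b, IsLefschetzBraid conicLine l b ↔ b = η ^ 2 := by
  have h0 : fibreConf xZero (-upperRoot xZero) = ![-3 / 4, -Complex.I / 2, Complex.I / 2] := by
    rw [fibreConf, upperRoot_xZero, neg_neg, neg_div 2, xZero]
    norm_num
  exact exists_halfTwist_sq_of_matches hA isApex_upper (u := fun t => -upperRoot (upperLoop t))
    (continuous_upperRoot_comp upperLoop.continuous fun t => (matches_upperLoop t).1).neg
    (fun t => by rw [neg_sq, upperRoot_sq]) (by rw [upperLoop.source, h0])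
    (by rw [upperLoop.target, h0]) fun t => (matches_upperLoop t).2

theorem exists_halfTwist_sq_lowerLoop {c : ℂ} {R : ℝ} (hA : fibre conicLine xZero ⊆ ball c R) :
    ∃ η : Braid c R (fibre conicLine xZero),
      (∀ b, IsHalfTwistBraid (segment ℝ (-3 / 4) (Complex.I / 2)) b ↔ b = η) ∧
      ∀ l : Path xZero xZero, HomotopicOff (branchSet conicLine 3) l lowerLoop →
        (∀ t, fibre conicLine (l t) ⊆ ball c R) →
        ∀ b, IsLefschetzBraid conicLine l b ↔ b = η ^ 2 := by
  have h0 : fibreConf xZero (upperRoot xZero) = ![-3 / 4, Complex.I / 2, -Complex.I / 2] := by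
    rw [fibreConf, upperRoot_xZero, neg_div 2, xZero]
    norm_num
  exact exists_halfTwist_sq_of_matches hA isApex_lower
    (continuous_upperRoot_comp lowerLoop.continuous fun t => (matches_lowerLoop t).1)
    (fun t => upperRoot_sq _) (by rw [lowerLoop.source, h0])
    (by rw [lowerLoop.target, h0]) fun t => (matches_lowerLoop t).2

/-! ### Diffeomorphisms that preserve the coordinate axes -/

/-- The motion along the axes from `-3/4`, `i/2`, `-i/2` to `-1/4`, `(√3/2) i`, `-(√3/2) i`. -/
def axisMotion (t : I) : Fin 3 → ℂ :=
  ![((-3 / 4 + t / 2 : ℝ) : ℂ), ((1 / 2 + t * ((√3 - 1) / 2) : ℝ) : ℂ) * Complex.I,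
    -(((1 / 2 + t * ((√3 - 1) / 2) : ℝ) : ℂ) * Complex.I)]

theorem continuous_axisMotion : Continuous axisMotion :=
  continuous_vec3 (by fun_prop) (by fun_prop) (by fun_prop)

theorem axisMotion_zero : axisMotion 0 = ![-3 / 4, Complex.I / 2, -Complex.I / 2] := by
  simp only [axisMotion, Set.Icc.coe_zero]
  congr 1
  · norm_num
  · congr 1
    · push_cast
      ring
    · congr 1
      push_cast
      ring

theorem axisMotion_one :
    axisMotion 1 = ![-1 / 4, (√3 : ℝ) / 2 * Complex.I, -((√3 : ℝ) / 2 * Complex.I)] := by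
  simp only [axisMotion, Set.Icc.coe_one]
  congr 1
  · norm_num
  · congr 1
    · push_cast
      ring
    · congr 1
      push_cast
      ring

theorem axisMotion_eq (t : I) (i : Fin 3) :
    axisMotion t i = (1 - t : ℝ) • axisMotion 0 i + (t : ℝ) • axisMotion 1 i := by
  fin_cases i <;> simp [axisMotion] <;> ring

/-- A configuration with the first point on the negative real half-axis and the other two on the
positive and on the negative imaginary half-axis. -/
structure OnHalfAxes (x : Fin 3 → ℂ) : Prop where
  im_zero : (x 0).im = 0
  re_zero : (x 0).re < 0
  re_one : (x 1).re = 0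
  im_one : 0 < (x 1).im
  re_two : (x 2).re = 0
  im_two : (x 2).im < 0

theorem OnHalfAxes.sameSide {x y : Fin 3 → ℂ} (hx : OnHalfAxes x) (hy : OnHalfAxes y) :
    ∀ i j, i ≠ j → SameSide (x i - x j) (y i - y j) := by
  obtain ⟨x1, x2, x3, x4, x5, x6⟩ := hx
  obtain ⟨y1, y2, y3, y4, y5, y6⟩ := hy
  have s01 : SameSide (x 0 - x 1) (y 0 - y 1) := ⟨-1, by simp; linarith, by simp; linarith⟩
  have s02 : SameSide (x 0 - x 2) (y 0 - y 2) := ⟨-1, by simp; linarith, by simp; linarith⟩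
  have s12 : SameSide (x 1 - x 2) (y 1 - y 2) :=
    ⟨-Complex.I, by simp; linarith, by simp; linarith⟩
  exact forall_sameSide s01 s02 s12

theorem OnHalfAxes.injective {x : Fin 3 → ℂ} (hx : OnHalfAxes x) : Function.Injective x := by
  intro i j hij
  by_contra hne
  obtain ⟨v, hv, -⟩ := hx.sameSide hx i j hne
  simp [hij] at hv

theorem half_le_axis_im (t : I) : (1 / 2 : ℝ) ≤ 1 / 2 + t * ((√3 - 1) / 2) := by
  have h1 : (1 : ℝ) ≤ √3 := Real.one_le_sqrt.2 (by norm_num)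
  have := mul_nonneg t.2.1 (by linarith : (0 : ℝ) ≤ (√3 - 1) / 2)
  linarith

theorem onHalfAxes_axisMotion (t : I) : OnHalfAxes (axisMotion t) := by
  have h1 := half_le_axis_im t
  have h2 := t.2.2
  constructor <;> simp [axisMotion] <;> linarith

theorem axisMotion_mem_ball {c : ℂ} {R : ℝ} (h0 : ∀ i, axisMotion 0 i ∈ ball c R)
    (h1 : ∀ i, axisMotion 1 i ∈ ball c R) (t : I) (i : Fin 3) : axisMotion t i ∈ ball c R := by
  rw [axisMotion_eq]
  exact convex_ball c R (h0 i) (h1 i) (sub_nonneg.2 t.2.2) t.2.1 (by ring)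

section AxisShift

variable {c : ℂ} {R : ℝ}

/-- The diffeomorphisms of the disk that are the identity on the boundary and off `W`, and that
preserve the real and the imaginary axis. -/
def axisDiffeo (c : ℂ) (R : ℝ) (W : Set ℂ) : Subgroup (closedBall c R ≃ₜ closedBall c R) where
  carrier := {f | f ∈ diskDiffeo c R ∧ (∀ y : closedBall c R, (f y : ℂ).im = 0 ↔ (y : ℂ).im = 0) ∧
    (∀ y : closedBall c R, (f y : ℂ).re = 0 ↔ (y : ℂ).re = 0) ∧
    ∀ y : closedBall c R, (y : ℂ) ∉ W → f y = y}
  mul_mem' := by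
    rintro f g ⟨hf, hf1, hf2, hf3⟩ ⟨hg, hg1, hg2, hg3⟩
    refine ⟨mul_mem hf hg, fun y => (hf1 (g y)).trans (hg1 y), fun y => (hf2 (g y)).trans (hg2 y),
      fun y hy => ?_⟩
    change f (g y) = y
    rw [hg3 y hy, hf3 y hy]
  one_mem' := ⟨one_mem _, fun _ => Iff.rfl, fun _ => Iff.rfl, fun _ _ => rfl⟩
  inv_mem' := by
    rintro f ⟨hf, hf1, hf2, hf3⟩
    refine ⟨inv_mem hf, fun y => ?_, fun y => ?_, fun y hy => ?_⟩
    · have h := hf1 (f.symm y)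
      rw [f.apply_symm_apply] at h
      exact h.symm
    · have h := hf2 (f.symm y)
      rw [f.apply_symm_apply] at h
      exact h.symm
    · change f.symm y = y
      rw [Homeomorph.symm_apply_eq, hf3 y hy]

theorem dist_lt_of_bump_ne_zero {δ : ℝ} (hδ : 0 < δ) {y z : ℂ}
    (h : bump (δ⁻¹ • (y - z)) ≠ 0) : dist y z < δ := by
  by_contra! hle
  refine h (bump_eq_zero ?_)
  rwa [norm_smul, norm_inv, Real.norm_of_nonneg hδ.le, ← dist_eq_norm, le_inv_mul_iff₀ hδ, mul_one]

theorem abs_bump_mul_le (z : ℂ) (x : ℝ) : |bump z * x| ≤ |x| := by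
  rw [abs_mul, abs_of_nonneg bump.nonneg]
  exact mul_le_of_le_one_left (abs_nonneg x) bump.le_one

/-- Short pushes of the points of `axisMotion t` along the axes preserve the axes. The points have
distance at least `1/4` from the other axis, which a push with `δ ≤ 1/16` does not reach. -/
theorem axis_iff_displacement {δ : ℝ} (hδ : 0 < δ) (hδ' : δ ≤ 1 / 16) {t s : I}
    (hv : ∀ i, ‖axisMotion s i - axisMotion t i‖ ≤ δ) (y : ℂ) :
    ((y + displacement δ (axisMotion t) (axisMotion s - axisMotion t) y).im = 0 ↔ y.im = 0) ∧
    ((y + displacement δ (axisMotion t) (axisMotion s - axisMotion t) y).re = 0 ↔ y.re = 0) := by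
  have ht := onHalfAxes_axisMotion t
  have hs := onHalfAxes_axisMotion s
  have hre : (displacement δ (axisMotion t) (axisMotion s - axisMotion t) y).re =
      bump (δ⁻¹ • (y - axisMotion t 0)) * (axisMotion s 0 - axisMotion t 0).re := by
    simp only [displacement, Fin.sum_univ_three, Complex.add_re, Pi.sub_apply, Complex.real_smul,
      Complex.re_ofReal_mul, Complex.sub_re, ht.re_one, hs.re_one, ht.re_two, hs.re_two]
    ring
  have him : (displacement δ (axisMotion t) (axisMotion s - axisMotion t) y).im =
      bump (δ⁻¹ • (y - axisMotion t 1)) * (axisMotion s 1 - axisMotion t 1).im +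
        bump (δ⁻¹ • (y - axisMotion t 2)) * (axisMotion s 2 - axisMotion t 2).im := by
    simp only [displacement, Fin.sum_univ_three, Complex.add_im, Pi.sub_apply, Complex.real_smul,
      Complex.im_ofReal_mul, Complex.sub_im, ht.im_zero, hs.im_zero]
    ring
  have b0 := abs_le.1 ((abs_bump_mul_le (δ⁻¹ • (y - axisMotion t 0)) _).trans
    ((Complex.abs_re_le_norm _).trans (hv 0)))
  have b1 := abs_le.1 ((abs_bump_mul_le (δ⁻¹ • (y - axisMotion t 1)) _).trans
    ((Complex.abs_im_le_norm _).trans (hv 1)))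
  have b2 := abs_le.1 ((abs_bump_mul_le (δ⁻¹ • (y - axisMotion t 2)) _).trans
    ((Complex.abs_im_le_norm _).trans (hv 2)))
  -- a point that is pushed is close to a point of the configuration, hence far from the other axis
  have near_im : ∀ i, bump (δ⁻¹ • (y - axisMotion t i)) ≠ 0 →
      |y.im - (axisMotion t i).im| < δ := fun i hi => by
    refine lt_of_le_of_lt ?_ (dist_lt_of_bump_ne_zero hδ hi)
    rw [dist_eq_norm, ← Complex.sub_im]
    exact Complex.abs_im_le_norm _
  have near_re : ∀ i, bump (δ⁻¹ • (y - axisMotion t i)) ≠ 0 →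
      |y.re - (axisMotion t i).re| < δ := fun i hi => by
    refine lt_of_le_of_lt ?_ (dist_lt_of_bump_ne_zero hδ hi)
    rw [dist_eq_norm, ← Complex.sub_re]
    exact Complex.abs_re_le_norm _
  have hh := half_le_axis_im t
  have p0 : (axisMotion t 0).re ≤ -1 / 4 := by
    have := t.2.2
    simp only [axisMotion, Matrix.cons_val_zero, Complex.ofReal_re]
    linarith
  have p1 : 1 / 2 ≤ (axisMotion t 1).im := by simpa [axisMotion] using hh
  have p2 : (axisMotion t 2).im ≤ -1 / 2 := by
    have : (axisMotion t 2).im = -(1 / 2 + t * ((√3 - 1) / 2)) := by simp [axisMotion]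
    linarith
  rw [Complex.add_im, Complex.add_re, hre, him]
  constructor
  · by_cases h1 : bump (δ⁻¹ • (y - axisMotion t 1)) = 0
    · by_cases h2 : bump (δ⁻¹ • (y - axisMotion t 2)) = 0
      · rw [h1, h2, zero_mul, zero_mul, add_zero, add_zero]
      · have := abs_lt.1 (near_im 2 h2)
        constructor <;> intro h <;> linarith
    · have := abs_lt.1 (near_im 1 h1)
      constructor <;> intro h <;> linarith
  · by_cases h0 : bump (δ⁻¹ • (y - axisMotion t 0)) = 0
    · rw [h0, zero_mul, add_zero]
    · have := abs_lt.1 (near_re 0 h0)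
      constructor <;> intro h <;> linarith

/-- Axis-preserving diffeomorphisms that move points along `axisMotion` exist, with support in
every neighbourhood of the axes. -/
theorem exists_isAxisShift (h0 : ∀ i, axisMotion 0 i ∈ ball c R)
    (h1 : ∀ i, axisMotion 1 i ∈ ball c R) {W : Set ℂ} (hW : IsOpen W)
    (hWax : {y ∈ closedBall c R | y.re = 0 ∨ y.im = 0} ⊆ W) :
    ∃ β : closedBall c R ≃ₜ closedBall c R, IsAxisShift W β := by
  have hball := axisMotion_mem_ball h0 h1
  have hmemW : ∀ t i, axisMotion t i ∈ W := by
    intro t i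
    refine hWax ⟨ball_subset_closedBall (hball t i), ?_⟩
    have ht := onHalfAxes_axisMotion t
    fin_cases i
    exacts [Or.inr ht.im_zero, Or.inl ht.re_one, Or.inl ht.re_two]
  obtain ⟨δ₁, hδ₁, hsep, -⟩ := exists_margin (c := c) (R := R) continuous_axisMotion
    (fun t => (onHalfAxes_axisMotion t).injective) hball
  have hcomp : IsCompact (range fun p : I × Fin 3 => axisMotion p.1 p.2) := by
    refine isCompact_range (continuous_prod_of_discrete_right.2 fun i => ?_)
    exact (continuous_apply i).comp continuous_axisMotion
  obtain ⟨δ₂, hδ₂, hthick⟩ := hcomp.exists_thickening_subset_open (hW.inter isOpen_ball)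
    (show range (fun p : I × Fin 3 => axisMotion p.1 p.2) ⊆ W ∩ ball c R by
      rintro _ ⟨p, rfl⟩
      exact ⟨hmemW _ _, hball _ _⟩)
  set δ := min (1 / 16) (min δ₁ δ₂) with hδdef
  have hδ : 0 < δ := lt_min (by norm_num) (lt_min hδ₁ hδ₂)
  have hδ16 : δ ≤ 1 / 16 := min_le_left _ _
  have hδ₁' : δ ≤ δ₁ := (min_le_right _ _).trans (min_le_left _ _)
  have hδ₂' : δ ≤ δ₂ := (min_le_right _ _).trans (min_le_right _ _)
  have hnear : ∀ t i y, dist y (axisMotion t i) < δ → y ∈ W ∩ ball c R := fun t i y hy =>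
    hthick (mem_thickening_iff.2 ⟨_, ⟨(t, i), rfl⟩, hy.trans_le hδ₂'⟩)
  set C : ℝ := Fintype.card (Fin 3) * bumpLip with hC
  have hC0 : 0 ≤ C := by positivity
  obtain ⟨η, hη, hunif⟩ := Metric.uniformContinuous_iff.1
    (CompactSpace.uniformContinuous_of_continuous continuous_axisMotion) (δ / 2 / (C + 1))
    (by positivity)
  have key : ∃ f ∈ axisDiffeo c R W, ∀ i (y : closedBall c R), (y : ℂ) = axisMotion 0 i →
      (f y : ℂ) = axisMotion 1 i := by
    refine forall_of_uniform_step (p := fun t => ∃ f ∈ axisDiffeo c R W,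
      ∀ i (y : closedBall c R), (y : ℂ) = axisMotion 0 i → (f y : ℂ) = axisMotion t i) (s₀ := 0)
      ⟨1, one_mem _, fun i y hy => hy⟩ hη ?_ 1
    rintro t s hts ⟨f, hf, hft⟩
    have hv : ∀ i, ‖axisMotion s i - axisMotion t i‖ ≤ δ / 2 / (C + 1) := fun i => by
      rw [← dist_eq_norm, dist_comm]
      exact (dist_le_pi_dist _ _ i).trans (hunif hts).le
    have hv1 : ∀ i, ‖axisMotion s i - axisMotion t i‖ ≤ δ := fun i => by
      refine (hv i).trans ((div_le_self (by positivity) (by linarith)).trans (by linarith))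
    have hv2 : ∀ i, C * ‖axisMotion s i - axisMotion t i‖ ≤ δ / 2 := fun i =>
      calc C * ‖axisMotion s i - axisMotion t i‖ ≤ (C + 1) * (δ / 2 / (C + 1)) := by
            gcongr
            · linarith
            · exact hv i
        _ = δ / 2 := by field_simp
    let u : ℂ → ℂ := displacement δ (axisMotion t) (axisMotion s - axisMotion t)
    have hu : LipschitzWith (1 / 2) u := lipschitzWith_displacement hδ hv2
    have hoff : ∀ y, y ∉ W ∩ ball c R → perturbation u hu y = y := by
      intro y hy
      rw [perturbation_apply, show u y = 0 from displacement_eq_zero hδ fun i => ?_, add_zero]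
      by_contra hlt
      exact hy (hnear t i y (not_le.1 hlt))
    have hoff' : ∀ y, y ∉ ball c R → perturbation u hu y = y := fun y hy =>
      hoff y fun h => hy h.2
    refine ⟨restrictDisk (perturbation u hu) hoff' * f, mul_mem ⟨?_, ?_, ?_, ?_⟩ hf, ?_⟩
    · exact restrictDisk_mem_diskDiffeo _ _
        (contDiff_perturbation _ _ (contDiff_displacement _ _ _))
        (contDiff_perturbation_symm _ _ (contDiff_displacement _ _ _))
    · exact fun y => (axis_iff_displacement hδ hδ16 hv1 y).1
    · exact fun y => (axis_iff_displacement hδ hδ16 hv1 y).2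
    · exact fun y hy => Subtype.ext (hoff y fun h => hy h.1)
    · intro i y hy
      change (f y : ℂ) + u (f y) = _
      rw [hft i y hy, show u (axisMotion t i) = _ from
        displacement_self hδ (fun i j hij => hδ₁'.trans (hsep t i j hij)) i]
      simp
  obtain ⟨β, ⟨hd, hre, him, hoff⟩, hmove⟩ := key
  simp only [axisMotion_zero, axisMotion_one] at hmove
  exact ⟨β, hd, hmove 0, hmove 1, hmove 2, hre, him, hoff⟩

/-- The extension by the identity of a homeomorphism of the disk that is the identity on the
boundary. -/
def extendFun (f : closedBall c R ≃ₜ closedBall c R) (y : ℂ) : ℂ :=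
  open scoped Classical in if h : y ∈ closedBall c R then f ⟨y, h⟩ else y

theorem extendFun_of_mem (f : closedBall c R ≃ₜ closedBall c R) {y : ℂ} (h : y ∈ closedBall c R) :
    extendFun f y = f ⟨y, h⟩ := dif_pos h

theorem extendFun_of_notMem {f : closedBall c R ≃ₜ closedBall c R} (hf : f ∈ boundaryFix c R)
    {y : ℂ} (h : y ∉ ball c R) : extendFun f y = y := by
  by_cases h1 : y ∈ closedBall c R
  · rw [extendFun_of_mem f h1, hf ⟨y, h1⟩ (le_antisymm h1 (not_lt.1 h))]
  · exact dif_neg h1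

theorem extendFun_extendFun {f g : closedBall c R ≃ₜ closedBall c R} (h : f * g = 1) (y : ℂ) :
    extendFun f (extendFun g y) = y := by
  by_cases h1 : y ∈ closedBall c R
  · rw [extendFun_of_mem g h1, extendFun_of_mem f (g ⟨y, h1⟩).2]
    exact congrArg Subtype.val (congrArg (fun k : closedBall c R ≃ₜ closedBall c R => k ⟨y, h1⟩) h)
  · have h2 : ∀ k : closedBall c R ≃ₜ closedBall c R, extendFun k y = y := fun k => dif_neg h1
    rw [h2, h2]

theorem continuous_extendFun {f : closedBall c R ≃ₜ closedBall c R} (hf : f ∈ boundaryFix c R) :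
    Continuous (extendFun f) := by
  rw [← continuousOn_univ]
  have h1 : ContinuousOn (extendFun f) (closedBall c R) := by
    rw [continuousOn_iff_continuous_domRestrict]
    refine (continuous_subtype_val.comp f.continuous).congr fun y => ?_
    exact (extendFun_of_mem f y.2).symm
  have h2 : ContinuousOn (extendFun f) (ball c R)ᶜ :=
    continuousOn_id.congr fun y hy => extendFun_of_notMem hf hy
  refine (h1.union_of_isClosed h2 isClosed_closedBall isOpen_ball.isClosed_compl).mono
    fun y _ => ?_
  by_cases hy : y ∈ ball c R
  exacts [Or.inl (ball_subset_closedBall hy), Or.inr hy]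

/-- The extension by the identity, as a homeomorphism of the plane. -/
def extendDisk (f : closedBall c R ≃ₜ closedBall c R) (hf : f ∈ boundaryFix c R) : ℂ ≃ₜ ℂ where
  toFun := extendFun f
  invFun := extendFun f⁻¹
  left_inv := extendFun_extendFun (inv_mul_cancel f)
  right_inv := extendFun_extendFun (mul_inv_cancel f)
  continuous_toFun := continuous_extendFun hf
  continuous_invFun := continuous_extendFun (inv_mem hf)

/-- The conjugate of a homeomorphism of the plane by multiplication with `t`, as in the Alexander
trick; the identity for `t = 0`. -/
def rescale (e : ℂ ≃ₜ ℂ) (t : ℝ) : ℂ ≃ₜ ℂ :=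
  open scoped Classical in if h : (t : ℂ) = 0 then Homeomorph.refl ℂ else
    (Homeomorph.mulLeft₀ (t : ℂ) h).symm.trans (e.trans (Homeomorph.mulLeft₀ (t : ℂ) h))

theorem rescale_apply (e : ℂ ≃ₜ ℂ) (t : ℝ) (y : ℂ) :
    rescale e t y = y + t * (e ((t : ℂ)⁻¹ * y) - (t : ℂ)⁻¹ * y) := by
  by_cases h : (t : ℂ) = 0
  · simp [rescale, h]
  · rw [rescale, dif_neg h, mul_sub, mul_inv_cancel_left₀ h, add_sub_cancel]
    rfl

theorem continuous_rescale {e : ℂ ≃ₜ ℂ} {M : ℝ} (hM : ∀ y, ‖e y - y‖ ≤ M) :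
    Continuous fun p : ℝ × ℂ => rescale e p.1 p.2 := by
  simp only [rescale_apply]
  refine continuous_snd.add (continuous_iff_continuousAt.2 fun p => ?_)
  by_cases h : (p.1 : ℂ) = 0
  · rw [ContinuousAt, h, zero_mul]
    refine squeeze_zero_norm (a := fun p : ℝ × ℂ => |p.1| * M) (fun q => ?_) ?_
    · rw [norm_mul, Complex.norm_real, Real.norm_eq_abs]
      exact mul_le_mul_of_nonneg_left (hM _) (abs_nonneg _)
    · have h1 : p.1 = 0 := by exact_mod_cast h
      have h2 : Continuous fun p : ℝ × ℂ => |p.1| * M := by fun_prop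
      simpa [h1] using h2.tendsto p
  · have h1 : ContinuousAt (fun q : ℝ × ℂ => (q.1 : ℂ)) p := by fun_prop
    have h2 : ContinuousAt (fun q : ℝ × ℂ => (q.1 : ℂ)⁻¹ * q.2) p :=
      (h1.inv₀ h).mul continuousAt_snd
    exact h1.mul ((ContinuousAt.comp (g := e) e.continuous.continuousAt h2).sub h2)

theorem apply_mem_ball_of_eq_off {e : ℂ ≃ₜ ℂ} (he : ∀ y, y ∉ ball c R → e y = y) {y : ℂ}
    (hy : y ∈ ball c R) : e y ∈ ball c R := by
  by_contra h
  rw [e.injective (he _ h)] at h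
  exact h hy

/-- By the Alexander trick centred at the origin, an axis-preserving diffeomorphism is carried by
a motion along the half-axes. All such motions are homotopic. -/
theorem IsAxisShift.realizes {W : Set ℂ} {β : closedBall c R ≃ₜ closedBall c R}
    (hβ : IsAxisShift W β) (h0 : ∀ i, axisMotion 0 i ∈ ball c R) : Realizes axisMotion β := by
  have hβb := diskDiffeo_le_boundaryFix hβ.diffeo
  have hzero : (0 : ℂ) ∈ ball c R := by
    have := (convex_ball c R) (h0 1) (h0 2) (a := 1 / 2) (b := 1 / 2) (by norm_num) (by norm_num)
      (by norm_num)
    convert this using 1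
    simp [axisMotion]
  set e := extendDisk β hβb with he
  have heoff : ∀ y, y ∉ ball c R → e y = y := fun y hy => extendFun_of_notMem hβb hy
  have hein : ∀ y : closedBall c R, e y = β y := fun y => extendFun_of_mem β y.2
  have him : ∀ y, (e y).im = 0 ↔ y.im = 0 := by
    intro y
    by_cases hy : y ∈ closedBall c R
    · rw [hein ⟨y, hy⟩]
      exact hβ.realAxis ⟨y, hy⟩
    · rw [heoff y fun h => hy (ball_subset_closedBall h)]
  have hre : ∀ y, (e y).re = 0 ↔ y.re = 0 := by
    intro y
    by_cases hy : y ∈ closedBall c R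
    · rw [hein ⟨y, hy⟩]
      exact hβ.imagAxis ⟨y, hy⟩
    · rw [heoff y fun h => hy (ball_subset_closedBall h)]
  have hM : ∀ y, ‖e y - y‖ ≤ 2 * R := by
    have hR : 0 < R := pos_of_mem_ball hzero
    intro y
    by_cases hy : y ∈ ball c R
    · have h1 := apply_mem_ball_of_eq_off heoff hy
      rw [← dist_eq_norm]
      rw [mem_ball] at h1 hy
      linarith [dist_triangle_right (e y) y c]
    · rw [heoff y hy, sub_self, norm_zero]
      positivity
  have hrim : ∀ (t : ℝ) y, (rescale e t y).im = 0 ↔ y.im = 0 := by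
    intro t y
    by_cases ht : (t : ℂ) = 0
    · rw [rescale, dif_pos ht, Homeomorph.refl_apply, id]
    · have ht' : t ≠ 0 := fun h => ht (by rw [h, Complex.ofReal_zero])
      rw [rescale, dif_neg ht]
      change ((t : ℂ) * e ((t : ℂ)⁻¹ * y)).im = 0 ↔ _
      rw [Complex.im_ofReal_mul, mul_eq_zero_iff_left ht', him, ← Complex.ofReal_inv,
        Complex.im_ofReal_mul, mul_eq_zero_iff_left (inv_ne_zero ht')]
  have hrre : ∀ (t : ℝ) y, (rescale e t y).re = 0 ↔ y.re = 0 := by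
    intro t y
    by_cases ht : (t : ℂ) = 0
    · rw [rescale, dif_pos ht, Homeomorph.refl_apply, id]
    · have ht' : t ≠ 0 := fun h => ht (by rw [h, Complex.ofReal_zero])
      rw [rescale, dif_neg ht]
      change ((t : ℂ) * e ((t : ℂ)⁻¹ * y)).re = 0 ↔ _
      rw [Complex.re_ofReal_mul, mul_eq_zero_iff_left ht', hre, ← Complex.ofReal_inv,
        Complex.re_ofReal_mul, mul_eq_zero_iff_left (inv_ne_zero ht')]
  have hroff : ∀ (t : I) y, y ∉ ball c R → rescale e t y = y := by
    intro t y hy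
    rw [rescale_apply]
    by_cases ht : ((t : ℝ) : ℂ) = 0
    · rw [ht, zero_mul, add_zero]
    · rw [heoff, sub_self, mul_zero, add_zero]
      intro h
      refine hy ?_
      have := (convex_ball c R) h hzero t.2.1 (sub_nonneg.2 t.2.2) (by ring)
      rwa [smul_zero, add_zero, Complex.real_smul, mul_inv_cancel_left₀ ht] at this
  have hcont : Continuous fun p : I × ℂ => rescale e p.1 p.2 :=
    (continuous_rescale hM).comp (f := fun p : I × ℂ => ((p.1 : ℝ), p.2)) (by fun_prop)
  have hone : ∀ y, rescale e (1 : I) y = e y := fun y => by simp [rescale_apply]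
  have hzer : ∀ y, rescale e (0 : I) y = y := fun y => by simp [rescale_apply]
  let γ : I → Fin 3 → ℂ := fun t i => rescale e t (axisMotion 0 i)
  have hγ : ∀ i, Continuous fun t => γ t i := fun i =>
    hcont.comp (continuous_id.prodMk continuous_const)
  have hγ0 : γ 0 = axisMotion 0 := funext fun i => hzer _
  have hγ1 : γ 1 = axisMotion 1 := by
    have hb : ∀ i, γ 1 i = β ⟨_, ball_subset_closedBall (h0 i)⟩ := fun i => by
      rw [← hein]
      exact hone _
    rw [axisMotion_one]
    funext i
    rw [hb]
    fin_cases i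
    · exact hβ.line _ (congrFun axisMotion_zero 0)
    · exact hβ.upper _ (congrFun axisMotion_zero 1)
    · exact hβ.lower _ (congrFun axisMotion_zero 2)
  have hax := onHalfAxes_axisMotion 0
  -- a coordinate that never vanishes keeps its sign
  have hpos : ∀ g : I → ℝ, Continuous g → (∀ t, g t ≠ 0) → 0 < g 0 → ∀ t, 0 < g t := by
    intro g hg hne hg0 t
    by_contra! hle
    obtain ⟨s, hs⟩ := mem_range_of_exists_le_of_exists_ge hg ⟨t, hle⟩ ⟨0, hg0.le⟩
    exact hne s hs
  have hhalf : ∀ t, OnHalfAxes (γ t) := by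
    intro t
    refine ⟨(hrim t _).2 hax.im_zero, ?_, (hrre t _).2 hax.re_one, ?_, (hrre t _).2 hax.re_two, ?_⟩
    · have := hpos (fun t => -(γ t 0).re) (Complex.continuous_re.comp (hγ 0)).neg
        (fun t => neg_ne_zero.2 fun h => hax.re_zero.ne ((hrre t _).1 h))
        (by
          rw [hγ0]
          exact neg_pos.2 hax.re_zero) t
      linarith
    · exact hpos (fun t => (γ t 1).im) (Complex.continuous_im.comp (hγ 1))
        (fun t h => hax.im_one.ne' ((hrim t _).1 h))
        (by
          rw [hγ0]
          exact hax.im_one) t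
    · have := hpos (fun t => -(γ t 2).im) (Complex.continuous_im.comp (hγ 2)).neg
        (fun t => neg_ne_zero.2 fun h => hax.im_two.ne ((hrim t _).1 h))
        (by
          rw [hγ0]
          exact neg_pos.2 hax.im_two) t
      linarith
  refine ⟨γ, fun t i => apply_mem_ball_of_eq_off (hroff t) (h0 i), ⟨fun t =>
    restrictDisk (rescale e t) (hroff t), ⟨?_, ?_, ?_, ?_⟩, ?_⟩, ?_⟩
  · exact continuous_restrictDisk (fun t : I => rescale e t) hroff hcont
  · ext y
    exact hzer y
  · intro t y hy
    exact Subtype.ext (hroff t y (sphere_notMem_ball hy))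
  · intro t i y hy
    rw [hγ0] at hy
    change rescale e t y = _
    rw [hy]
  · ext y
    exact (hone y).trans (hein y)
  · exact confHomotopic_of_sameSide (continuous_pi hγ) continuous_axisMotion hγ0.symm hγ1.symm
      fun t => (hhalf t).sameSide (onHalfAxes_axisMotion t)

end AxisShift

/-! ### The path below the intersection point, followed by the axis shift -/

section Concat

variable {ι : Type*}

/-- The motion `γ` followed by the motion `δ`. -/
def concat (γ δ : I → ι → ℂ) (t : I) : ι → ℂ :=
  if (t : ℝ) ≤ 1 / 2 then γ (projIcc 0 1 zero_le_one (2 * t))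
  else δ (projIcc 0 1 zero_le_one (2 * t - 1))

theorem concat_zero (γ δ : I → ι → ℂ) : concat γ δ 0 = γ 0 := by
  simp [concat]

theorem concat_one (γ δ : I → ι → ℂ) : concat γ δ 1 = δ 1 := by
  norm_num [concat, projIcc_right]

theorem continuous_concat {γ δ : I → ι → ℂ} (hγ : Continuous γ) (hδ : Continuous δ)
    (h : γ 1 = δ 0) : Continuous (concat γ δ) :=
  (continuous_glue (Z := Unit) (A := fun p => γ p.1) (B := fun p => δ p.1) (by fun_prop)
    (by fun_prop) fun _ => h).comp (f := fun t : I => (t, ())) (by fun_prop)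

theorem ConfHomotopic.concat {γ γ' δ δ' : I → ι → ℂ} (hγ : ConfHomotopic γ γ')
    (hδ : ConfHomotopic δ δ') (h : γ 1 = δ 0) :
    ConfHomotopic (PlaneBraid.concat γ δ) (PlaneBraid.concat γ' δ') := by
  obtain ⟨G, hG, hinj, hG0, hG1, hGl, hGr⟩ := hγ
  obtain ⟨H, hH, hinj', hH0, hH1, hHl, hHr⟩ := hδ
  have hc := (continuous_glue (A := fun p : I × I => G (p.2, p.1))
    (B := fun p : I × I => H (p.2, p.1)) (by fun_prop) (by fun_prop)
    fun s => by rw [hGr, hHl, h]).comp continuous_swap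
  refine ⟨_, hc, ?_, ?_, ?_, ?_, ?_⟩
  · intro p
    simp only [Function.comp_apply]
    split_ifs
    exacts [hinj _, hinj' _]
  · intro t
    simp only [Function.comp_apply, Prod.fst_swap, Prod.snd_swap, hG0, hH0]
    rfl
  · intro t
    simp only [Function.comp_apply, Prod.fst_swap, Prod.snd_swap, hG1, hH1]
    rfl
  · intro s
    simp [concat_zero, hGl]
  · intro s
    rw [concat_one]
    norm_num [projIcc_right, hHr]

/-- Motions are followed one after the other by composing the homeomorphisms that they carry. -/
theorem Carries.concat {c : ℂ} {R : ℝ} {S : Subgroup (closedBall c R ≃ₜ closedBall c R)}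
    {γ δ : I → ι → ℂ} {f g : closedBall c R ≃ₜ closedBall c R} (hf : Carries S γ f)
    (hg : Carries S δ g) (h : γ 1 = δ 0) : Carries S (PlaneBraid.concat γ δ) (g * f) := by
  obtain ⟨Ψ, hΨ, rfl⟩ := hf
  obtain ⟨Φ, hΦ, rfl⟩ := hg
  let Θ : I → (closedBall c R ≃ₜ closedBall c R) := fun t =>
    if (t : ℝ) ≤ 1 / 2 then Ψ (projIcc 0 1 zero_le_one (2 * t))
    else Φ (projIcc 0 1 zero_le_one (2 * t - 1)) * Ψ 1
  refine ⟨Θ, ⟨?_, ?_, ?_, ?_⟩, ?_⟩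
  · refine (continuous_glue (A := fun p : I × closedBall c R => Ψ p.1 p.2)
      (B := fun p : I × closedBall c R => Φ p.1 (Ψ 1 p.2)) hΨ.continuous
      (hΦ.continuous.comp (continuous_fst.prodMk ((Ψ 1).continuous.comp continuous_snd)))
      fun y => by rw [hΦ.zero]; rfl).congr fun p => ?_
    by_cases hp : (p.1 : ℝ) ≤ 1 / 2
    · simp only [Θ, if_pos hp]
    · simp only [Θ, if_neg hp]
      rfl
  · simp [Θ, hΨ.zero]
  · intro t
    simp only [Θ]
    split_ifs
    exacts [hΨ.mem _, mul_mem (hΦ.mem _) (hΨ.mem _)]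
  · intro t i y hy
    rw [concat_zero] at hy
    by_cases ht : (t : ℝ) ≤ 1 / 2
    · simp only [Θ, PlaneBraid.concat, if_pos ht]
      exact hΨ.apply _ i y hy
    · simp only [Θ, PlaneBraid.concat, if_neg ht]
      exact hΦ.apply _ i _ ((hΨ.apply 1 i y hy).trans (congrFun h i))
  · norm_num [Θ, projIcc_right]

theorem Realizes.concat {c : ℂ} {R : ℝ} {γ δ : I → ι → ℂ}
    {f g : closedBall c R ≃ₜ closedBall c R} (hf : Realizes γ f) (hg : Realizes δ g)
    (h : γ 1 = δ 0) : Realizes (PlaneBraid.concat γ δ) (g * f) := by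
  obtain ⟨γ', hγ', hc, hh⟩ := hf
  obtain ⟨δ', hδ', hc', hh'⟩ := hg
  have e : γ' 1 = δ' 0 := by
    obtain ⟨G, -, -, -, hG1, -, hGr⟩ := hh
    obtain ⟨H, -, -, -, hH1, hHl, -⟩ := hh'
    rw [← hGr 1, ← hHl 1, hG1, hH1, h]
  refine ⟨_, ?_, hc.concat hc' e, hh.concat hh' e⟩
  intro t i
  unfold PlaneBraid.concat
  split_ifs
  exacts [hγ' _ _, hδ' _ _]

theorem forall_concat {Y : Type*} [TopologicalSpace Y] {P : (ι → ℂ) → Y → Prop}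
    {y₀ y₁ y₂ : Y} {γ δ : I → ι → ℂ} {θ : Path y₀ y₁} {θ' : Path y₁ y₂}
    (h : ∀ t, P (γ t) (θ t)) (h' : ∀ t, P (δ t) (θ' t)) (t : I) :
    P (concat γ δ t) ((θ.trans θ') t) := by
  rw [Path.trans_apply, concat]
  split_ifs with ht
  · rw [projIcc_of_mem _ (unitInterval.mul_pos_mem_iff zero_lt_two |>.2 ⟨t.2.1, ht⟩)]
    exact h _
  · rw [projIcc_of_mem _ (unitInterval.two_mul_sub_one_mem_iff.2 ⟨(not_le.1 ht).le, t.2.2⟩)]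
    exact h' _

end Concat

theorem isApex_shifted : IsApex (-1 / 4) ((√3 : ℝ) / 2 * Complex.I)
    (-((√3 : ℝ) / 2 * Complex.I)) := by
  have h3 : (√3 : ℝ) * √3 = 3 := Real.mul_self_sqrt (by norm_num)
  have h0 : (0 : ℝ) < √3 := Real.sqrt_pos.2 (by norm_num)
  refine IsApex.of_normSq_lt ?_ ?_
  · norm_num
    intro h
    nlinarith
  · norm_num [Complex.normSq_apply]
    nlinarith

/-- Along `lowerArc` the difference of the point on the line and the upper root makes three quarters
of a full turn, one on each segment; the last quarter is made along `axisMotion`. The half-planes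
are `0 < Re (z * v)` with `v = 2 + i`, `1 - i`, `-1 - i`, `-1 + i` in turn. -/
theorem matches_lowerArc :
    (∀ t, (lowerArc t).re < 0) ∧
    ∀ t, Matches (-1 / 4) ((√3 : ℝ) / 2 * Complex.I) (-((√3 : ℝ) / 2 * Complex.I))
      (concat (fun t => fibreConf (lowerArc t) (upperRoot (lowerArc t))) axisMotion t)
      (fullTurn t) := by
  have h3 : (√3 : ℝ) * √3 = 3 := Real.mul_self_sqrt (by norm_num)
  have h1 : (3 / 2 : ℝ) ≤ √3 := Real.le_sqrt_of_sq_le (by norm_num)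
  let Q : (Fin 3 → ℂ) → ℝ → Prop :=
    Matches (-1 / 4) ((√3 : ℝ) / 2 * Complex.I) (-((√3 : ℝ) / 2 * Complex.I))
  have keyQ : ∀ (k : ℕ) (v a b s : ℂ) (t : I) (θ : ℝ),
      θ = k * (Real.pi / 2) + Real.pi / 2 * t →
      0 < ((a - b) * v).re →
      0 < ((-1 / 4 - (√3 : ℝ) / 2 * Complex.I) * Complex.I ^ k * v).re →
      0 < ((-1 / 4 - (√3 : ℝ) / 2 * Complex.I) * Complex.I ^ k * Complex.I * v).re →
      s.im < a.im → s.im < b.im → Q ![a, b, s] θ := by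
    intro k v a b s t θ hθ h1 h2 h3 h4 h5
    refine matches_quarter (w := -Complex.I) (by simp) ?_ t hθ v h1 h2 h3 ?_ ?_
    · refine norm_lt_of_sq ?_ ?_
      · norm_num
        nlinarith
      · norm_num [Complex.normSq_apply]
        nlinarith
    · simpa using h4
    · simpa using h5
  let P : ℂ → ℝ → Prop := fun x θ => x.re < 0 ∧ Q (fibreConf x (upperRoot x)) θ
  have key : ∀ (k : ℕ) (v x : ℂ) (t : I) (θ : ℝ), θ = k * (Real.pi / 2) + Real.pi / 2 * t →
      x.re < 0 → x.im ≤ 0 →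
      0 < ((-x - 1 - upperRoot x) * v).re →
      0 < ((-1 / 4 - (√3 : ℝ) / 2 * Complex.I) * Complex.I ^ k * v).re →
      0 < ((-1 / 4 - (√3 : ℝ) / 2 * Complex.I) * Complex.I ^ k * Complex.I * v).re → P x θ := by
    intro k v x t θ hθ hx hx' h1 h2 h3
    have hs := upperRoot_im_pos hx
    refine ⟨hx, keyQ k v _ _ _ t θ hθ h1 h2 h3 ?_ ?_⟩
    · simp
      linarith
    · simp
      linarith
  have hP : ∀ t, P (lowerArc t) ((((Path.segment 0 (Real.pi / 2)).trans
      (Path.segment (Real.pi / 2) Real.pi)).trans (Path.segment Real.pi (3 * Real.pi / 2))) t) := by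
    refine forall_trans (forall_trans (fun t => ?_) fun t => ?_) fun t => ?_
    all_goals
      rw [segment_apply_real, segment_apply_complex]
      have ht0 := t.2.1
      have ht1 := t.2.2
    · generalize hx : xOne + _ = x
      have hre : x.re = -3 / 4 := by rw [← hx]; norm_num [xZero, xOne]
      have him : x.im = -(2 * t) := by rw [← hx]; norm_num [xZero, xOne]; ring
      have hb := upperRoot_im_pos (x := x) (by linarith)
      obtain ⟨e1, e2⟩ := upperRoot_eqns x
      have ha : 0 ≤ -(upperRoot x).re := by nlinarith
      have := side_threeQuarters ha hb (by linarith) (by linarith)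
      refine key 0 (2 + Complex.I) x t _ (by push_cast; ring) (by linarith) (by linarith) ?_ ?_ ?_
      · simp
        nlinarith
      · norm_num
        linarith
      · norm_num
        linarith
    · generalize hx : xOne - _ + _ = x
      have hre : x.re = -3 / 4 + t / 2 := by rw [← hx]; norm_num [xZero, xOne]; ring
      have him : x.im = -2 := by rw [← hx]; norm_num [xZero, xOne]
      have hb := upperRoot_im_pos (x := x) (by linarith)
      obtain ⟨e1, e2⟩ := upperRoot_eqns x
      have hb2 := side_two (a := -(upperRoot x).re) hb (by linarith) (by linarith)
      have ha : 0 < -(upperRoot x).re := by nlinarith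
      refine key 1 (1 - Complex.I) x t _ (by push_cast; ring) (by linarith) (by linarith) ?_ ?_ ?_
      · simp
        nlinarith
      · norm_num
        linarith
      · norm_num
        linarith
    · generalize hx : xZero - _ + _ = x
      have hre : x.re = -1 / 4 := by rw [← hx]; norm_num [xZero]
      have him : x.im = -2 + 2 * t := by rw [← hx]; norm_num [xZero]; ring
      have hb := upperRoot_im_pos (x := x) (by linarith)
      obtain ⟨e1, e2⟩ := upperRoot_eqns x
      have ha : 0 ≤ -(upperRoot x).re := by nlinarith
      have := side_quarter ha hb (by linarith)
      refine key 2 (-1 - Complex.I) x t _ (by push_cast; ring) (by linarith) (by linarith) ?_ ?_ ?_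
      · simp
        nlinarith
      · norm_num
        linarith
      · norm_num
        linarith
  refine ⟨fun t => (hP t).1, forall_concat (P := Q) (fun t => (hP t).2) fun t => ?_⟩
  rw [segment_apply_real]
  have hh := half_le_axis_im t
  have ht1 := t.2.2
  refine keyQ 3 (-1 + Complex.I) _ _ _ t _ (by push_cast; ring) ?_ ?_ ?_ ?_ ?_
  · simp
    linarith
  · norm_num [pow_succ]
    linarith
  · norm_num [pow_succ]
    linarith
  · simp
    linarith
  · simp
    linarith

theorem exists_halfTwist_sq_lowerArc {c : ℂ} {R : ℝ} (hA : fibre conicLine xZero ⊆ ball c R)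
    (hA' : fibre conicLine xOne ⊆ ball c R) :
    ∃ η : Braid c R (fibre conicLine xOne),
      (∀ b, IsHalfTwistBraid (segment ℝ (-1 / 4) ((√3 : ℝ) / 2 * Complex.I)) b ↔ b = η) ∧
      ∀ W : Set ℂ, IsOpen W → {y ∈ closedBall c R | y.re = 0 ∨ y.im = 0} ⊆ W →
        (∃ β : closedBall c R ≃ₜ closedBall c R, IsAxisShift W β) ∧
        ∀ β : closedBall c R ≃ₜ closedBall c R, IsAxisShift W β →
          ∀ l : Path xOne xZero, HomotopicOff (branchSet conicLine 3) l lowerArc →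
            (∀ t, fibre conicLine (l t) ⊆ ball c R) →
            ∀ b, (∃ ψ : closedBall c R ≃ₜ closedBall c R, IsLefschetzDiffeo conicLine l ψ ∧
                ∃ f : braidDiffeo c R (fibre conicLine xOne),
                  (f : closedBall c R ≃ₜ closedBall c R) = β * ψ ∧ toBraid f = b) ↔
              b = η ^ 2 := by
  set τ : I → Fin 3 → ℂ := fun t => fibreConf (lowerArc t) (upperRoot (lowerArc t)) with hτ
  have e0 : fibreConf xZero (upperRoot xZero) = axisMotion 0 := by
    rw [fibreConf, upperRoot_xZero, axisMotion_zero, neg_div 2, xZero]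
    norm_num
  have e1 : fibreConf xOne (upperRoot xOne) = axisMotion 1 := by
    rw [fibreConf, upperRoot_xOne, axisMotion_one, xOne]
    norm_num
  have f0 : fibre conicLine xZero = range (axisMotion 0) := by
    rw [← e0, fibre_conicLine (upperRoot_sq _)]
  have f1 : fibre conicLine xOne = range (axisMotion 1) := by
    rw [← e1, fibre_conicLine (upperRoot_sq _)]
  have m0 : ∀ i, axisMotion 0 i ∈ ball c R := fun i => hA (f0 ▸ mem_range_self i)
  have m1 : ∀ i, axisMotion 1 i ∈ ball c R := fun i => hA' (f1 ▸ mem_range_self i)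
  have τ0 : τ 0 = axisMotion 1 := by simp only [hτ, lowerArc.source, e1]
  have τ1 : τ 1 = axisMotion 0 := by simp only [hτ, lowerArc.target, e0]
  obtain ⟨hre, hm⟩ := matches_lowerArc
  have hroot := continuous_upperRoot_comp lowerArc.continuous hre
  have hK : fibre conicLine xOne =
      {-1 / 4, (√3 : ℝ) / 2 * Complex.I, -((√3 : ℝ) / 2 * Complex.I)} := by
    rw [f1, axisMotion_one, range_vec3]
  have hR : 0 < R := pos_of_mem_ball (m0 0)
  obtain ⟨f, hf, hreal⟩ := exists_halfTwistBraid hR hK hA' isApex_shifted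
  have hturn := ConfHomotopic.of_matches isApex_shifted
    (continuous_concat (continuous_fibreConf lowerArc.continuous hroot) continuous_axisMotion τ1)
    (by rw [concat_zero, ← axisMotion_one]; exact τ0) (by rw [concat_one, axisMotion_one]) hm
  refine ⟨toBraid f, hf, fun W hW hWax => ⟨exists_isAxisShift m0 m1 hW hWax,
    fun β hβ l hl hball b => ?_⟩⟩
  obtain ⟨v, hv, hvsq, -, -, hh⟩ := exists_fibre_lift hl hroot fun t => upperRoot_sq _
  have key : ∀ ψ, IsLefschetzDiffeo conicLine l ψ → ∀ g : braidDiffeo c R (fibre conicLine xOne),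
      (g : closedBall c R ≃ₜ closedBall c R) = β * ψ → toBraid g = toBraid f ^ 2 := by
    intro ψ hψ g hg
    have e : toBraid f ^ 2 = toBraid (f * f) := sq _
    have hψr : Realizes τ ψ := ⟨_, fibreConf_mem_ball hvsq hball,
      (hψ.carries hv hvsq hl.notMem).mono diskDiffeo_le_boundaryFix, hh⟩
    rw [e]
    refine toBraid_eq_of_realizes hR ?_ ?_ hreal
    · simp only [Nat.cast_ofNat, Set.Icc.coe_zero, mul_zero, turn_zero, range_vec3, hK]
    · rw [hg]
      exact (hψr.concat (hβ.realizes m0) τ1).of_confHomotopic hturn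
  constructor
  · rintro ⟨ψ, hψ, g, hg, rfl⟩
    exact key ψ hψ g hg
  · rintro rfl
    obtain ⟨ψ, hψ⟩ := exists_isLefschetzDiffeo hv hvsq hl.notMem hball
    have hβ0 : ∀ i (y : closedBall c R), (y : ℂ) = axisMotion 0 i → (β y : ℂ) = axisMotion 1 i := by
      simp only [axisMotion_zero, axisMotion_one]
      intro i
      fin_cases i
      exacts [hβ.line, hβ.upper, hβ.lower]
    have hβK : ∀ y : closedBall c R,
        (β y : ℂ) ∈ fibre conicLine xOne ↔ (y : ℂ) ∈ fibre conicLine xZero := by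
      intro y
      rw [f0, f1]
      constructor
      · rintro ⟨i, hi⟩
        have h2 := hβ0 i ⟨_, ball_subset_closedBall (m0 i)⟩ rfl
        rw [← β.injective (Subtype.ext (h2.trans hi))]
        exact mem_range_self i
      · rintro ⟨i, hi⟩
        exact ⟨i, (hβ0 i y hi.symm).symm⟩
    have hmem : β * ψ ∈ braidDiffeo c R (fibre conicLine xOne) :=
      ⟨mul_mem hβ.diffeo hψ.mem_diskDiffeo,
        fun y => (hβK (ψ y)).trans (hψ.apply_mem_fibre_iff y)⟩
    exact ⟨ψ, hψ, ⟨_, hmem⟩, rfl, key ψ hψ _ rfl⟩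

end PlaneBraid

end

theorem corollary2p2 (c : ℂ) (R : ℝ)
    (hA : fibre conicLine xZero ⊆ Metric.ball c R)
    (hA' : fibre conicLine xOne ⊆ Metric.ball c R) :
    -- the loop `l₁` and the segment `σ₂` from `-3/4` to `-i/2`
    (∃ η : Braid c R (fibre conicLine xZero),
      (∀ b, IsHalfTwistBraid (segment ℝ (-3 / 4) (-Complex.I / 2)) b ↔ b = η) ∧
      ∀ l₁ : Path xZero xZero, HomotopicOff (branchSet conicLine 3) l₁ upperLoop →
        (∀ t, fibre conicLine (l₁ t) ⊆ Metric.ball c R) →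
        ∀ b, IsLefschetzBraid conicLine l₁ b ↔ b = η ^ 2) ∧
    -- the loop `l₂` and the segment `σ₁` from `-3/4` to `i/2`
    (∃ η : Braid c R (fibre conicLine xZero),
      (∀ b, IsHalfTwistBraid (segment ℝ (-3 / 4) (Complex.I / 2)) b ↔ b = η) ∧
      ∀ l₂ : Path xZero xZero, HomotopicOff (branchSet conicLine 3) l₂ lowerLoop →
        (∀ t, fibre conicLine (l₂ t) ⊆ Metric.ball c R) →
        ∀ b, IsLefschetzBraid conicLine l₂ b ↔ b = η ^ 2) ∧
    -- the path `l₃`, followed by `β`, and the segment `σ'₁` from `-1/4` to `(√3/2) i`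
    (∃ η : Braid c R (fibre conicLine xOne),
      (∀ b, IsHalfTwistBraid (segment ℝ (-1 / 4) ((√3 : ℝ) / 2 * Complex.I)) b ↔ b = η) ∧
      ∀ W : Set ℂ, IsOpen W → {y ∈ Metric.closedBall c R | y.re = 0 ∨ y.im = 0} ⊆ W →
        (∃ β : Metric.closedBall c R ≃ₜ Metric.closedBall c R, IsAxisShift W β) ∧
        ∀ β : Metric.closedBall c R ≃ₜ Metric.closedBall c R, IsAxisShift W β →
          ∀ l₃ : Path xOne xZero, HomotopicOff (branchSet conicLine 3) l₃ lowerArc →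
            (∀ t, fibre conicLine (l₃ t) ⊆ Metric.ball c R) →
            ∀ b, (∃ ψ : Metric.closedBall c R ≃ₜ Metric.closedBall c R,
                IsLefschetzDiffeo conicLine l₃ ψ ∧
                ∃ f : braidDiffeo c R (fibre conicLine xOne),
                  (f : Metric.closedBall c R ≃ₜ Metric.closedBall c R) = β * ψ ∧
                  toBraid f = b) ↔ b = η ^ 2) := by
  exact ⟨exists_halfTwist_sq_upperLoop hA, exists_halfTwist_sq_lowerLoop hA,
    exists_halfTwist_sq_lowerArc hA hA'⟩
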